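/- Write $B_r(z)$ for the open disc of radius $r$ about $z$ in $\mathbb{R}^2$ and $B_1=B_1(0)$. (a) Let $2<p\le\infty$ and $C_0>0$. There are constants $C_1,C_2>0$ and $R_0>1$, depending only on $p$ and $C_0$, with the following property. Let $W$ be a real vector field on $\mathbb{R}^2\setminus B_1$ with $\|W\|_{L^p(\mathbb{R}^2\setminus B_1)}\le 1$, and let $u$ be a real weak solution of $$\Delta u-W\cdot\nabla u=0\quad\text{in }\mathbb{R}^2\setminus B_1,$$ that is, $u\in L^1_{\rm loc}$ has a weak gradient $\nabla u$ in $\{|x|>1\}$ and $\int(\nabla u\cdot\nabla\varphi+(W\cdot\nabla u)\,\varphi)\,dx=0$ for all $\varphi\in C_c^\infty(\{|x|>1\})$. Assume that $\|\nabla u\|_{L^\infty(\mathbb{R}^2\setminus B_1)}\le 1$ and $$\inf_{|z_0|=3}\int_{B_1(z_0)}|\nabla u|^2\,dx\ge C_0 .$$ Then $$\inf_{|z_0|=R}\ \sup_{|z-z_0|<1}|u(z)|\ \ge\ C_2\exp(-C_1R\log^2R)\qquad\text{for all }R\ge R_0 ,$$ where the supremum is the essential supremum (equivalently, the supremum of the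 continuous representative of $u$). (b) For $p=\infty$ the linear growth in $R$ of the exponent is sharp up to the logarithmic factor. Namely, $u(x)=e^{-|x|}(1+|x|)$ and $W(x)=\frac{2-|x|}{|x|^2}\,x$ satisfy all the hypotheses of (a) with $p=\infty$ and some $C_0>0$, while $\sup_{|z-z_0|<1}|u(z)|\le |z_0|\,e^{1-|z_0|}$ whenever $|z_0|\ge 2$. Consequently, if $g:\mathbb{R}\to\mathbb{R}$ satisfies $g(R)/R\to0$ as $R\to\infty$, then for no $C_1,C_2>0$ does this $u$ satisfy $\inf_{|z_0|=R}\sup_{|z-z_0|<1}|u(z)|\ge C_2\exp(-C_1g(R))$ for all sufficiently large $R$. -/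

import Mathlib

open MeasureTheory Filter Topology Metric
open scoped ENNReal ContDiff Gradient RealInnerProductSpace

/-- The Euclidean plane `ℝ²`. -/
abbrev Plane : Type := EuclideanSpace ℝ (Fin 2)

/-- The exterior domain `{x ∈ ℝ² : |x| > 1}`. It differs from `ℝ² ∖ B₁` (with `B₁` the open unit
disc) by the unit circle, a null set, so `L^p` norms over the two sets agree. -/
def exteriorDomain : Set Plane := (closedBall (0 : Plane) 1)ᶜ

/-- Test functions `φ ∈ C_c^∞(D)`. -/
structure IsTestFunction (D : Set Plane) (φ : Plane → ℝ) : Prop where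
  smooth : ContDiff ℝ ∞ φ
  compactSupport : HasCompactSupport φ
  support_subset : tsupport φ ⊆ D

/-- `G` is the weak (distributional) gradient of `u ∈ L¹_loc(D)` in the open set `D`, with
`G ∈ L¹_loc(D)`: one has `∫ u ∇φ = -∫ φ G` for all `φ ∈ C_c^∞(D)`. -/
structure IsWeakGradient (D : Set Plane) (u : Plane → ℝ) (G : Plane → Plane) : Prop where
  locInt : LocallyIntegrableOn u D volume
  locInt_grad : LocallyIntegrableOn G D volume
  byParts : ∀ φ : Plane → ℝ, IsTestFunction D φ →
    ∫ x in D, u x • ∇ φ x = -∫ x in D, φ x • G x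

/-- `u`, with weak gradient `∇u = G`, is a real weak solution of `Δu - W·∇u = 0` in `D`:
`∫ (∇u·∇φ + (W·∇u) φ) = 0` for all `φ ∈ C_c^∞(D)`. -/
structure IsWeakDriftSolution (D : Set Plane) (W : Plane → Plane) (u : Plane → ℝ)
    (G : Plane → Plane) : Prop where
  weakGradient : IsWeakGradient D u G
  locInt_drift : LocallyIntegrableOn (fun x => ⟪W x, G x⟫) D volume
  equation : ∀ φ : Plane → ℝ, IsTestFunction D φ →
    ∫ x in D, (⟪G x, ∇ φ x⟫ + ⟪W x, G x⟫ * φ x) = 0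

/-- The hypotheses on a solution `u` (with gradient `G = ∇u`) and a drift `W` in the exterior
domain: the equation, `‖W‖_{L^p} ≤ 1`, `‖∇u‖_{L^∞} ≤ 1`, and
`inf_{|z₀| = 3} ∫_{B₁(z₀)} |∇u|² ≥ C₀`. -/
structure IsNormalizedSolution (p : ℝ≥0∞) (C₀ : ℝ) (W : Plane → Plane) (u : Plane → ℝ)
    (G : Plane → Plane) : Prop where
  solution : IsWeakDriftSolution exteriorDomain W u G
  drift_memLp : MemLp W p (volume.restrict exteriorDomain)
  drift_le : eLpNorm W p (volume.restrict exteriorDomain) ≤ 1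
  grad_le : eLpNorm G ⊤ (volume.restrict exteriorDomain) ≤ 1
  grad_lower : ENNReal.ofReal C₀ ≤
    ⨅ z₀ ∈ sphere (0 : Plane) 3, ∫⁻ z in ball z₀ 1, ‖G z‖ₑ ^ 2

/-- `inf_{|z₀| = R} sup_{|z - z₀| < 1} |u(z)|`, as an extended nonnegative number. The supremum is
the essential one, so that it does not depend on the representative of `u`; for continuous `u` it
is the pointwise supremum. -/
noncomputable def infSup (u : Plane → ℝ) (R : ℝ) : ℝ≥0∞ :=
  ⨅ z₀ ∈ sphere (0 : Plane) R, eLpNorm u ⊤ (volume.restrict (ball z₀ 1))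

/-- The function `u(x) = exp(-|x|) (1 + |x|)`. -/
noncomputable def exampleSolution (x : Plane) : ℝ := Real.exp (-‖x‖) * (1 + ‖x‖)

/-- The drift `W(x) = ((2 - |x|) / |x|²) x`. -/
noncomputable def exampleDrift (x : Plane) : Plane := ((2 - ‖x‖) / ‖x‖ ^ 2) • x

/-! The complex gradient `V = u_x - i u_y` satisfies `∂V/∂z̄ = α V` with `|α| ≤ |W|`: the real part
of this identity is the drift equation, the imaginary part says that a gradient is curl-free
(`IsNormalizedSolution.exists_isWeakDbarSolution`). Restrict `α` to `1 < |z| < 6R` and let `h` be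
its Cauchy transform. Because `p > 2`, the kernel `1/z` pairs with `L^p` and `|h| ≤ K R`
(`exists_lintegral_mul_enorm_inv_le`). Hence `F = V e^{-h}` is weakly holomorphic in the annulus
(`IsWeakDbarSolution.gauge`) and is comparable with `V` up to factors `e^{KR}`.

Now fix `|a| = R` and apply the Cauchy–Pompeiu formula to `F` times a cutoff times the weight `z^m /
(z - a)^k`. On `2 < |z| < 4`, where `V` is not small, `V` is thereby controlled by three terms, one
for each place where the cutoff varies (`exists_ae_norm_le_of_isWeakDbarSolution`). Near the unit
circle the zero of order `m` at the origin gains a factor `(3/4)^m`, and the pole costs only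
`e^{O(k/R)}`. Near `|z| = 5R` the pole gains `2^{-k}` against a loss of `(5R/2)^m`. Near `a` there
remains the integral of `|V|` over a small disc, multiplied by about `R^{m+2k}`. Taking `m` a large
multiple of `R` beats `e^{2KR}`; the outer ring then forces `k` to be of order `m log R`, and `R^k`
becomes `exp(O(R log² R))`. One logarithm comes from the size of `k`, the other from the size of the
weight near `a`. The first two terms are thus absorbed, so the integral of `|V|` near `a` is at
least `exp(-O(R log² R))` (`exists_exponents_of_pole_estimate`).

A Caccioppoli inequality bounds the integral of `|∇u|²` near `a` by a multiple of `sup |u|`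
(`exists_setLIntegral_sq_enorm_grad_le`), which transfers the lower bound to `u` at the cost of
doubling the exponent. No regularity theory is used: `V` is only a bounded measurable function, and
every identity is obtained by testing and mollifying.

For the example, `∇u = -e^{-|x|} x`, so everything is explicit; a decay rate of essentially `e^{-R}`
contradicts any lower bound whose exponent is `o(R)`. -/

/-! ### Calculus of the Cauchy–Riemann operator -/

/-- The Cauchy–Riemann operator `∂f/∂z̄ = (∂ₓf + i ∂ᵧf) / 2`. -/
noncomputable def dbar (f : ℂ → ℂ) (z : ℂ) : ℂ :=
  (fderiv ℝ f z 1 + Complex.I * fderiv ℝ f z Complex.I) / 2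

theorem dbar_mul {f g : ℂ → ℂ} {z : ℂ} (hf : DifferentiableAt ℝ f z)
    (hg : DifferentiableAt ℝ g z) :
    dbar (fun w => f w * g w) z = dbar f z * g z + f z * dbar g z := by
  simp only [dbar, fderiv_fun_mul hf hg, _root_.add_apply,
    _root_.smul_apply, smul_eq_mul]
  ring

theorem dbar_cexp {f : ℂ → ℂ} {z : ℂ} (hf : DifferentiableAt ℝ f z) :
    dbar (fun w => Complex.exp (f w)) z = Complex.exp (f z) * dbar f z := by
  simp only [dbar, hf.hasFDerivAt.cexp.fderiv, _root_.smul_apply, smul_eq_mul]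
  ring

theorem dbar_neg {f : ℂ → ℂ} {z : ℂ} : dbar (fun w => -f w) z = -dbar f z := by
  simp only [dbar, fderiv_fun_neg, _root_.neg_apply]
  ring

theorem dbar_one_sub {f : ℂ → ℂ} {z : ℂ} : dbar (fun w => 1 - f w) z = -dbar f z := by
  simp only [dbar, fderiv_const_sub, _root_.neg_apply]
  ring

theorem dbar_eq_zero_of_differentiableAt {f : ℂ → ℂ} {z : ℂ} (hf : DifferentiableAt ℂ f z) :
    dbar f z = 0 := by
  have h : ∀ v, fderiv ℝ f z v = deriv f z * v := fun v => by
    rw [hf.hasDerivAt.complexToReal_fderiv.fderiv]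
    simp
  simp only [dbar, h]
  ring_nf
  simp

theorem dbar_comp_sub_mul {f : ℂ → ℂ} (hf : Differentiable ℝ f) (s : ℝ) (a z : ℂ) :
    dbar (fun w => f (s * (w - a))) z = s * dbar f (s * (z - a)) := by
  have h : HasFDerivAt (fun w : ℂ => (s : ℂ) * (w - a)) (s • ContinuousLinearMap.id ℝ ℂ) z := by
    have := ((hasFDerivAt_id (𝕜 := ℝ) z).sub_const a).const_smul s
    simpa only [Complex.real_smul] using! this
  have h2 := (hf (s * (z - a))).hasFDerivAt.comp z h
  have h3 : fderiv ℝ (fun w => f (s * (w - a))) z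
      = (fderiv ℝ f (s * (z - a))).comp (s • ContinuousLinearMap.id ℝ ℂ) := h2.fderiv
  simp only [dbar, h3, ContinuousLinearMap.comp_smul, ContinuousLinearMap.comp_id,
    _root_.smul_apply, Complex.real_smul]
  ring

theorem ContDiff.dbar {f : ℂ → ℂ} (hf : ContDiff ℝ ∞ f) : ContDiff ℝ ∞ (dbar f) := by
  have h : ContDiff ℝ ∞ (fderiv ℝ f) := hf.fderiv_right (by simp)
  unfold _root_.dbar
  exact ((h.clm_apply contDiff_const).add
    (contDiff_const.mul (h.clm_apply contDiff_const))).div_const _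

theorem support_dbar_subset (f : ℂ → ℂ) : Function.support (dbar f) ⊆ tsupport f := by
  intro z hz
  by_contra h
  apply hz
  have := support_fderiv_subset ℝ (f := f)
  have h0 : fderiv ℝ f z = 0 := by
    by_contra h1
    exact h (this h1)
  simp [dbar, h0]

theorem dbar_of_notMem_tsupport {f : ℂ → ℂ} {z : ℂ} (h : z ∉ tsupport f) : dbar f z = 0 := by
  by_contra h1
  exact h (support_dbar_subset f h1)

theorem HasCompactSupport.dbar {f : ℂ → ℂ} (hf : HasCompactSupport f) :
    HasCompactSupport (dbar f) :=
  hf.mono' (support_dbar_subset f)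

theorem Filter.EventuallyEq.dbar_eq {f g : ℂ → ℂ} {z : ℂ} (h : f =ᶠ[𝓝 z] g) :
    dbar f z = dbar g z := by
  simp only [dbar, h.fderiv_eq]

/-! ### The Cauchy–Pompeiu formula and the Cauchy transform -/

theorem integral_Ioi_fderiv_ray {φ : ℂ → ℂ} (hφ : ContDiff ℝ 1 φ) (hc : HasCompactSupport φ)
    {e : ℂ} (he : ‖e‖ = 1) : ∫ r in Set.Ioi (0 : ℝ), fderiv ℝ φ (r * e) e = -φ 0 := by
  have hd : ∀ r : ℝ, HasDerivAt (fun r : ℝ => φ (r * e)) (fderiv ℝ φ (r * e) e) r := by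
    intro r
    have h1 : HasDerivAt (fun r : ℝ => (r : ℂ) * e) e r := by
      simpa using (Complex.ofRealCLM.hasDerivAt (x := r)).mul_const e
    exact ((hφ.differentiable one_ne_zero _).hasFDerivAt).comp_hasDerivAt r h1
  have h1 : ContDiff ℝ 1 (fun r : ℝ => φ (r * e)) :=
    hφ.comp (Complex.ofRealCLM.contDiff.mul contDiff_const)
  have h2 : HasCompactSupport (fun r : ℝ => φ (r * e)) := by
    obtain ⟨ρ, hρ⟩ := hc.isCompact.isBounded.subset_closedBall 0
    refine HasCompactSupport.of_support_subset_isCompact (isCompact_closedBall (0 : ℝ) ρ) ?_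
    intro r hr
    have := hρ (subset_tsupport _ hr)
    simpa [he] using this
  have h3 := h2.integral_Ioi_deriv_eq h1 0
  simpa only [(hd _).deriv, Complex.ofReal_zero, zero_mul] using h3

/-- The integrand is, up to the factor `r`, the angular derivative of a periodic function. -/
theorem integral_Ioo_fderiv_circle {φ : ℂ → ℂ} (hφ : ContDiff ℝ 1 φ) {r : ℝ} (hr : 0 < r) :
    ∫ θ in Set.Ioo (-Real.pi) Real.pi, fderiv ℝ φ (r * (Real.cos θ + Real.sin θ * Complex.I))
      (Complex.I * (Real.cos θ + Real.sin θ * Complex.I)) = 0 := by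
  set e : ℝ → ℂ := fun θ => Real.cos θ + Real.sin θ * Complex.I
  have he : ∀ θ, HasDerivAt e (Complex.I * e θ) θ := by
    intro θ
    have h1 : HasDerivAt (fun θ : ℝ => ((Real.cos θ : ℝ) : ℂ)) ((-Real.sin θ : ℝ) : ℂ) θ :=
      (Real.hasDerivAt_cos θ).ofReal_comp
    have h2 : HasDerivAt (fun θ : ℝ => ((Real.sin θ : ℝ) : ℂ)) ((Real.cos θ : ℝ) : ℂ) θ :=
      (Real.hasDerivAt_sin θ).ofReal_comp
    refine (h1.add (h2.mul_const Complex.I)).congr_deriv ?_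
    simp only [e, mul_add, Complex.ofReal_neg]
    linear_combination -(Real.sin θ : ℂ) * Complex.I_mul_I
  have hec : Continuous e := continuous_iff_continuousAt.2 fun θ => (he θ).continuousAt
  have hd : ∀ θ, HasDerivAt (fun θ => φ (r * e θ))
      (r * fderiv ℝ φ (r * e θ) (Complex.I * e θ)) θ := by
    intro θ
    have h1 := ((hφ.differentiable one_ne_zero (r * e θ)).hasFDerivAt).comp_hasDerivAt θ
      ((he θ).const_mul (r : ℂ))
    refine h1.congr_deriv ?_
    rw [← Complex.real_smul, ← Complex.real_smul, map_smul, Complex.real_smul, Complex.real_smul]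
  have hcont : Continuous fun θ => fderiv ℝ φ (r * e θ) (Complex.I * e θ) :=
    ((hφ.continuous_fderiv one_ne_zero).comp (continuous_const.mul hec)).clm_apply
      (continuous_const.mul hec)
  have h := intervalIntegral.integral_eq_sub_of_hasDerivAt (a := -Real.pi) (b := Real.pi)
    (fun θ _ => hd θ) ((continuous_const.mul hcont).intervalIntegrable _ _)
  have h0 : e Real.pi = e (-Real.pi) := by simp [e]
  rw [h0, sub_self, intervalIntegral.integral_const_mul,
    intervalIntegral.integral_of_le (by linarith [Real.pi_pos]), integral_Ioc_eq_integral_Ioo] at h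
  have hr' : (r : ℂ) ≠ 0 := by exact_mod_cast hr.ne'
  exact (mul_eq_zero.1 h).resolve_left hr'

/-- The **Cauchy–Pompeiu formula** for compactly supported functions, at the origin. -/
theorem integral_dbar_div_self {φ : ℂ → ℂ} (hφ : ContDiff ℝ 1 φ) (hc : HasCompactSupport φ) :
    ∫ z, dbar φ z / z = -(Real.pi * φ 0) := by
  set e : ℝ → ℂ := fun θ => Real.cos θ + Real.sin θ * Complex.I with he_def
  have he : ∀ θ, ‖e θ‖ = 1 := by
    intro θ
    simp only [he_def, Complex.ofReal_cos, Complex.ofReal_sin, ← Complex.exp_mul_I,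
      Complex.norm_exp_ofReal_mul_I]
  have hec : Continuous e := by simp only [he_def]; fun_prop
  obtain ⟨ρ, hρ⟩ := hc.isCompact.isBounded.subset_closedBall 0
  have hz : ∀ r : ℝ, ∀ θ, ρ < r → 0 < r → fderiv ℝ φ (r * e θ) = 0 := by
    intro r θ h h0
    by_contra h1
    have := hρ (support_fderiv_subset ℝ h1)
    simp only [mem_closedBall, dist_zero_right, norm_mul, he, mul_one, Complex.norm_real,
      Real.norm_eq_abs, abs_of_pos h0] at this
    linarith
  have hfd := hφ.continuous_fderiv one_ne_zero
  have key : ∀ g : ℝ → ℂ, Continuous g →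
      IntegrableOn (fun p : ℝ × ℝ => fderiv ℝ φ (p.1 * e p.2) (g p.2))
        (Set.Ioi 0 ×ˢ Set.Ioo (-Real.pi) Real.pi) (volume.prod volume) := by
    intro g hg
    have hcont : Continuous (fun p : ℝ × ℝ => fderiv ℝ φ (p.1 * e p.2) (g p.2)) :=
      (hfd.comp ((Complex.continuous_ofReal.comp continuous_fst).mul
        (hec.comp continuous_snd))).clm_apply (hg.comp continuous_snd)
    have hK : IsCompact (Set.Icc (0 : ℝ) ρ ×ˢ Set.Icc (-Real.pi) Real.pi) :=
      isCompact_Icc.prod isCompact_Icc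
    refine (hcont.continuousOn.integrableOn_compact hK).of_forall_sdiff_eq_zero
      (measurableSet_Ioi.prod measurableSet_Ioo) ?_
    rintro ⟨r, θ⟩ ⟨⟨hr, hθ⟩, hn⟩
    have : ρ < r := by
      by_contra! hle
      exact hn ⟨⟨le_of_lt hr, hle⟩, ⟨hθ.1.le, hθ.2.le⟩⟩
    simp [hz r θ this hr]
  -- In polar coordinates `∂/∂z̄ = (e^{iθ} / 2) (∂_r + (i / r) ∂_θ)`. Dividing by `z = r e^{iθ}`
  -- removes the phase, and the Jacobian `r` removes the singularity. The radial part then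
  -- integrates to the value at the origin and the angular part to zero.
  have hpt : ∀ p ∈ polarCoord.target, p.1 • (dbar φ (Complex.polarCoord.symm p) /
      Complex.polarCoord.symm p) = (1 / 2 : ℂ) * fderiv ℝ φ (p.1 * e p.2) (e p.2) +
        (Complex.I / 2) * fderiv ℝ φ (p.1 * e p.2) (Complex.I * e p.2) := by
    rintro ⟨r, θ⟩ ⟨hr, -⟩
    have hr' : (r : ℂ) ≠ 0 := by exact_mod_cast (ne_of_gt hr)
    have he0 : e θ ≠ 0 := by
      intro h
      simpa [h] using he θ
    rw [Complex.polarCoord_symm_apply]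
    change r • (dbar φ (r * e θ) / (r * e θ)) = (1 / 2 : ℂ) * fderiv ℝ φ (r * e θ) (e θ) +
        (Complex.I / 2) * fderiv ℝ φ (r * e θ) (Complex.I * e θ)
    set D := fderiv ℝ φ (r * e θ) with hD
    have h1 : D (e θ) = Real.cos θ * D 1 + Real.sin θ * D Complex.I := by
      have : e θ = Real.cos θ • (1 : ℂ) + Real.sin θ • Complex.I := by simp [he_def]
      rw [this, map_add, map_smul, map_smul, Complex.real_smul, Complex.real_smul]
    have h2 : D (Complex.I * e θ) = -Real.sin θ * D 1 + Real.cos θ * D Complex.I := by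
      have : Complex.I * e θ = (-Real.sin θ) • (1 : ℂ) + Real.cos θ • Complex.I := by
        simp only [he_def, Complex.real_smul, Complex.ofReal_neg]
        linear_combination (Real.sin θ : ℂ) * Complex.I_mul_I
      rw [this, map_add, map_smul, map_smul, Complex.real_smul, Complex.real_smul]
      push_cast
      ring
    have h3 : (Real.cos θ - Real.sin θ * Complex.I) * e θ = 1 := by
      simp only [he_def]
      have := congrArg (fun x : ℝ => (x : ℂ)) (Real.cos_sq_add_sin_sq θ)
      push_cast at this ⊢
      linear_combination this - (Complex.sin θ) ^ 2 * Complex.I_sq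
    rw [h1, h2, Complex.real_smul, dbar, ← hD]
    have h4 : (e θ)⁻¹ = Real.cos θ - Real.sin θ * Complex.I := by
      exact (eq_inv_of_mul_eq_one_left h3).symm
    rw [div_eq_mul_inv _ (_ * _), mul_inv, h4]
    field_simp
    linear_combination (-Real.sin θ * D Complex.I) * Complex.I_sq
  rw [← Complex.integral_comp_polarCoord_symm,
    setIntegral_congr_fun polarCoord.open_target.measurableSet hpt]
  have hA := key e hec
  have hB := key (fun θ => Complex.I * e θ) (continuous_const.mul hec)
  change ∫ p in Set.Ioi 0 ×ˢ Set.Ioo (-Real.pi) Real.pi, _ ∂(volume.prod volume) = _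
  rw [integral_add (hA.const_mul _) (hB.const_mul _), integral_const_mul, integral_const_mul,
    setIntegral_prod _ hB]
  have hB0 : ∫ r in Set.Ioi (0 : ℝ), ∫ θ in Set.Ioo (-Real.pi) Real.pi,
      fderiv ℝ φ (r * e θ) (Complex.I * e θ) = 0 := by
    rw [setIntegral_congr_fun (g := fun _ => (0 : ℂ)) measurableSet_Ioi]
    · simp
    · intro r hr
      exact integral_Ioo_fderiv_circle hφ hr
  have hA0 : ∫ p in Set.Ioi (0 : ℝ) ×ˢ Set.Ioo (-Real.pi) Real.pi,
      fderiv ℝ φ ((p.1 : ℝ) * e p.2) (e p.2) ∂(volume.prod volume) = -(2 * Real.pi * φ 0) := by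
    rw [setIntegral_prod _ hA, integral_integral_swap
      (f := fun r θ => fderiv ℝ φ ((r : ℝ) * e θ) (e θ))]
    · simp only [integral_Ioi_fderiv_ray hφ hc (he _), integral_const, measureReal_restrict_apply_univ,
        Real.volume_real_Ioo_of_le (show -Real.pi ≤ Real.pi by linarith [Real.pi_pos]),
        Complex.real_smul]
      push_cast
      ring
    · rw [Measure.prod_restrict]
      exact hA
  simp only [hB0, hA0]
  ring

theorem locallyIntegrable_complex_inv : LocallyIntegrable (fun z : ℂ => z⁻¹) := by
  refine locallyIntegrable_of_norm_le_rpow (C := 1) (α := 1) (by simp) (by simp)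
    (Eventually.of_forall fun z => ?_) measurable_inv.aestronglyMeasurable
  rw [Real.rpow_neg_one, norm_inv, one_mul]

/-- The Cauchy transform `π⁻¹ ∫ α(ζ) / (z - ζ) dζ`. -/
noncomputable def cauchyTransform (α : ℂ → ℂ) (z : ℂ) : ℂ :=
  (Real.pi : ℂ)⁻¹ * ∫ ζ, α ζ * (z - ζ)⁻¹

theorem cauchyTransform_eq_convolution (ψ : ℂ → ℂ) :
    cauchyTransform ψ = fun z => (Real.pi : ℂ)⁻¹ *
      (convolution (fun z : ℂ => z⁻¹) ψ (ContinuousLinearMap.mul ℝ ℂ) volume) z := by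
  funext z
  rw [cauchyTransform, convolution_def, ← integral_sub_left_eq_self _ volume z]
  simp only [sub_sub_cancel, ContinuousLinearMap.mul_apply', mul_comm]

theorem ContDiff.cauchyTransform {ψ : ℂ → ℂ} (hψ : ContDiff ℝ ∞ ψ) (hc : HasCompactSupport ψ) :
    ContDiff ℝ ∞ (cauchyTransform ψ) := by
  rw [cauchyTransform_eq_convolution]
  exact contDiff_const.mul
    (hc.contDiff_convolution_right (n := ⊤) _ locallyIntegrable_complex_inv hψ)

/-- As a convolution with the locally integrable kernel `1/z`, the transform may be differentiated
on the smooth factor; what results is the Cauchy–Pompeiu formula for `t ↦ ψ (z - t)` at the origin.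
-/
theorem dbar_cauchyTransform {ψ : ℂ → ℂ} (hψ : ContDiff ℝ ∞ ψ) (hc : HasCompactSupport ψ)
    (z : ℂ) : dbar (cauchyTransform ψ) z = ψ z := by
  have hψ1 : ContDiff ℝ 1 ψ := hψ.of_le (by norm_cast)
  have hf := (hc.hasFDerivAt_convolution_right (ContinuousLinearMap.mul ℝ ℂ)
    locallyIntegrable_complex_inv hψ1 z).const_mul (Real.pi : ℂ)⁻¹
  have hcd : HasCompactSupport (fderiv ℝ ψ) := hc.fderiv ℝ
  have hcont : Continuous (fderiv ℝ ψ) := hψ1.continuous_fderiv one_ne_zero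
  have hv : ∀ v, fderiv ℝ (cauchyTransform ψ) z v
      = (Real.pi : ℂ)⁻¹ * ∫ t, t⁻¹ * fderiv ℝ ψ (z - t) v := by
    intro v
    rw [cauchyTransform_eq_convolution, hf.fderiv, _root_.smul_apply,
      convolution_precompR_apply _ locallyIntegrable_complex_inv hcd hcont]
    simp [convolution_def]
  have hint : ∀ v, Integrable fun t : ℂ => t⁻¹ * fderiv ℝ ψ (z - t) v := by
    intro v
    have h1 : HasCompactSupport fun a => fderiv ℝ ψ a v :=
      hcd.comp_left (g := fun L : ℂ →L[ℝ] ℂ => L v) (by simp)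
    have := (h1.convolutionExists_right (ContinuousLinearMap.mul ℝ ℂ) locallyIntegrable_complex_inv
      (hcont.clm_apply continuous_const)) z
    simpa [ConvolutionExistsAt] using this
  have hφ : ContDiff ℝ 1 fun t => ψ (z - t) := hψ1.comp (contDiff_const.sub contDiff_id)
  have hφc : HasCompactSupport fun t => ψ (z - t) :=
    hc.comp_homeomorph (Homeomorph.subLeft z)
  have hd : ∀ t, dbar (fun t => ψ (z - t)) t = -dbar ψ (z - t) := by
    intro t
    have : ∀ v, fderiv ℝ (fun t => ψ (z - t)) t v = - fderiv ℝ ψ (z - t) v := by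
      intro v
      have h1 : HasFDerivAt (fun t : ℂ => z - t) (-ContinuousLinearMap.id ℝ ℂ) t :=
        (hasFDerivAt_id t).const_sub z
      have h2 := ((hψ1.differentiable one_ne_zero (z - t)).hasFDerivAt).comp t h1
      rw [show fderiv ℝ (fun t => ψ (z - t)) t = _ from h2.fderiv]
      simp
    simp only [dbar, this]
    ring
  have hcp := integral_dbar_div_self hφ hφc
  simp only [hd, sub_zero] at hcp
  have hsum : ∫ t, -dbar ψ (z - t) / t
      = -((∫ t, t⁻¹ * fderiv ℝ ψ (z - t) 1) + Complex.I * ∫ t, t⁻¹ * fderiv ℝ ψ (z - t) Complex.I) / 2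
      := by
    rw [← integral_const_mul, ← integral_add (hint 1) ((hint _).const_mul _), ← integral_neg,
      ← integral_div]
    congr 1
    funext t
    rw [dbar]
    ring
  rw [hsum] at hcp
  have hpi : (Real.pi : ℂ) ≠ 0 := by exact_mod_cast Real.pi_ne_zero
  rw [dbar, hv, hv]
  rw [← mul_right_inj' hpi]
  generalize (∫ t, t⁻¹ * fderiv ℝ ψ (z - t) 1) = A at *
  generalize (∫ t, t⁻¹ * fderiv ℝ ψ (z - t) Complex.I) = B at *
  linear_combination -hcp + (A + Complex.I * B) / 2 * mul_inv_cancel₀ hpi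

/-! ### Bounds for the Cauchy kernel -/

theorem enorm_cauchyTransform_le (α : ℂ → ℂ) (z : ℂ) :
    ‖cauchyTransform α z‖ₑ ≤ ∫⁻ ζ, ‖α ζ‖ₑ * ‖(z - ζ)⁻¹‖ₑ := by
  rw [cauchyTransform, enorm_mul]
  have h1 : ‖(Real.pi : ℂ)⁻¹‖ₑ ≤ 1 := by
    rw [← ofReal_norm, norm_inv, Complex.norm_real, Real.norm_of_nonneg Real.pi_pos.le]
    refine ENNReal.ofReal_le_one.2 (inv_le_one_of_one_le₀ (by linarith [Real.pi_gt_three]))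
  calc _ ≤ 1 * ‖∫ ζ, α ζ * (z - ζ)⁻¹‖ₑ := by gcongr
    _ ≤ _ := by
      rw [one_mul]
      refine (enorm_integral_le_lintegral_enorm _).trans_eq ?_
      simp only [enorm_mul]

theorem lintegral_ball_enorm_inv_le {r : ℝ} (hr : 0 ≤ r) :
    ∫⁻ ζ in ball (0 : ℂ) r, ‖ζ⁻¹‖ₑ ≤ ENNReal.ofReal (2 * Real.pi * r) := by
  rw [← lintegral_indicator measurableSet_ball, ← Complex.lintegral_comp_polarCoord_symm]
  calc ∫⁻ p in polarCoord.target, ENNReal.ofReal p.1 •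
        (ball (0 : ℂ) r).indicator (fun ζ => ‖ζ⁻¹‖ₑ) (Complex.polarCoord.symm p)
      ≤ ∫⁻ p in polarCoord.target,
          (Set.Ioo (0 : ℝ) r ×ˢ Set.Ioo (-Real.pi) Real.pi).indicator (fun _ => 1) p := by
        refine setLIntegral_mono' polarCoord.open_target.measurableSet ?_
        rintro ⟨s, θ⟩ ⟨hs, hθ⟩
        have hs : 0 < s := hs
        have hn : ‖Complex.polarCoord.symm (s, θ)‖ = s := by
          rw [Complex.norm_polarCoord_symm, abs_of_pos hs]
        by_cases h : s < r
        · rw [Set.indicator_of_mem (by rw [mem_ball_zero_iff, hn]; exact h),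
            Set.indicator_of_mem (by exact ⟨⟨hs, h⟩, hθ⟩), ← ofReal_norm, norm_inv, hn,
            smul_eq_mul, ← ENNReal.ofReal_mul hs.le, mul_inv_cancel₀ hs.ne', ENNReal.ofReal_one]
        · rw [Set.indicator_of_notMem (by rw [mem_ball_zero_iff, hn]; exact h)]
          simp
    _ ≤ ∫⁻ p : ℝ × ℝ,
          (Set.Ioo (0 : ℝ) r ×ˢ Set.Ioo (-Real.pi) Real.pi).indicator (fun _ => 1) p :=
        setLIntegral_le_lintegral _ _
    _ = ENNReal.ofReal (2 * Real.pi * r) := by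
        rw [lintegral_indicator (measurableSet_Ioo.prod measurableSet_Ioo),
          setLIntegral_one, Measure.volume_eq_prod, Measure.prod_prod, Real.volume_Ioo, Real.volume_Ioo,
          ← ENNReal.ofReal_mul (by linarith)]
        congr 1
        ring

/-- The condition `s < 2` gives integrability at the pole. Outside the unit disc `|ζ|^{-s} ≤
|ζ|^{-1}` because `s ≥ 1`, and the latter has linearly growing integrals. -/
theorem exists_lintegral_ball_enorm_inv_rpow_le {s : ℝ} (hs1 : 1 ≤ s) (hs2 : s < 2) :
    ∃ K : ℝ, 0 < K ∧ ∀ r : ℝ, 1 ≤ r → ∀ z : ℂ,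
      ∫⁻ ζ in ball z r, ‖(z - ζ)⁻¹‖ₑ ^ s ≤ ENNReal.ofReal (K * r) := by
  have hint : IntegrableOn (fun ζ : ℂ => ‖ζ⁻¹‖ ^ s) (ball 0 1) := by
    refine integrableOn_ball_of_norm_le_rpow (C := 1) (α := s) (by simp) (by simpa using hs2)
      (Eventually.of_forall fun z => ?_) ?_
    · rw [Real.norm_of_nonneg (by positivity), norm_inv, one_mul, Real.rpow_neg (norm_nonneg _),
        Real.inv_rpow (norm_nonneg _)]
    · exact (measurable_inv.norm.pow_const s).aestronglyMeasurable
  set I := ∫ ζ in ball (0 : ℂ) 1, ‖ζ⁻¹‖ ^ s with hI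
  have hI0 : 0 ≤ I := integral_nonneg fun _ => by positivity
  have he : ∀ ζ : ℂ, ‖ζ⁻¹‖ₑ ^ s = ENNReal.ofReal (‖ζ⁻¹‖ ^ s) := fun ζ => by
    rw [← ofReal_norm, ENNReal.ofReal_rpow_of_nonneg (norm_nonneg _) (by linarith)]
  have hIl : ∫⁻ ζ in ball (0 : ℂ) 1, ‖ζ⁻¹‖ₑ ^ s = ENNReal.ofReal I := by
    rw [hI, ofReal_integral_eq_lintegral_ofReal hint (Eventually.of_forall fun _ => by positivity)]
    simp only [he]
  refine ⟨I + 2 * Real.pi, by positivity, fun r hr z => ?_⟩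
  have htr : ∫⁻ ζ in ball z r, ‖(z - ζ)⁻¹‖ₑ ^ s = ∫⁻ ζ in ball (0 : ℂ) r, ‖ζ⁻¹‖ₑ ^ s := by
    rw [← lintegral_indicator measurableSet_ball, ← lintegral_indicator measurableSet_ball,
      ← lintegral_sub_left_eq_self _ z]
    congr 1
    funext ζ
    simp [Set.indicator, dist_eq_norm]
  have hsub : ball (0 : ℂ) r ⊆ ball 0 1 ∪ (ball 0 r \ ball 0 1) := by
    rw [Set.union_sdiff_self]
    exact Set.subset_union_right
  calc _ = ∫⁻ ζ in ball 0 r, ‖ζ⁻¹‖ₑ ^ s := htr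
    _ ≤ ∫⁻ ζ in ball (0 : ℂ) 1 ∪ (ball 0 r \ ball 0 1), ‖ζ⁻¹‖ₑ ^ s := lintegral_mono_set hsub
    _ ≤ (∫⁻ ζ in ball (0 : ℂ) 1, ‖ζ⁻¹‖ₑ ^ s) + ∫⁻ ζ in (ball 0 r \ ball 0 1), ‖ζ⁻¹‖ₑ ^ s :=
      lintegral_union_le _ _ _
    _ ≤ ENNReal.ofReal I + ENNReal.ofReal (2 * Real.pi * r) := by
      rw [hIl]
      gcongr
      refine le_trans ?_ (lintegral_ball_enorm_inv_le (by linarith))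
      refine le_trans ?_ (lintegral_mono_set (s := ball (0 : ℂ) r \ ball 0 1) Set.sdiff_subset)
      refine setLIntegral_mono' (measurableSet_ball.diff measurableSet_ball) fun ζ hζ => ?_
      have h1 : ‖ζ⁻¹‖ₑ ≤ 1 := by
        have : 1 ≤ ‖ζ‖ := by simpa using hζ.2
        rw [← ofReal_norm, norm_inv]
        exact ENNReal.ofReal_le_one.2 (inv_le_one_of_one_le₀ this)
      calc ‖ζ⁻¹‖ₑ ^ s ≤ ‖ζ⁻¹‖ₑ ^ (1 : ℝ) := ENNReal.rpow_le_rpow_of_exponent_ge h1 hs1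
        _ = _ := ENNReal.rpow_one _
    _ ≤ ENNReal.ofReal ((I + 2 * Real.pi) * r) := by
      rw [← ENNReal.ofReal_add hI0 (by positivity)]
      apply ENNReal.ofReal_le_ofReal
      nlinarith

/-- This is where `p > 2` is essential: the conjugate exponent is below `2`, so that power of the
kernel is locally integrable. Young's inequality is used in place of Hölder's; it loses a power of
`ρ`, but linear growth is all that the final exponent allows for. Discs about the origin are
replaced by discs of twice the radius about `z`. -/
theorem exists_lintegral_mul_enorm_inv_le {p : ℝ≥0∞} (hp : 2 < p) :
    ∃ K : ℝ, 0 < K ∧ ∀ w : ℂ → ℂ, AEStronglyMeasurable w → eLpNorm w p volume ≤ 1 →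
      ∀ ρ : ℝ, 1 ≤ ρ → ∀ z ∈ ball (0 : ℂ) ρ,
        ∫⁻ ζ in ball 0 ρ, ‖w ζ‖ₑ * ‖(z - ζ)⁻¹‖ₑ ≤ ENNReal.ofReal (K * ρ) := by
  have hball : ∀ ρ : ℝ, ∀ z ∈ ball (0 : ℂ) ρ, ball 0 ρ ⊆ ball z (2 * ρ) := by
    intro ρ z hz
    apply ball_subset_ball'
    rw [dist_comm]
    linarith [mem_ball.1 hz]
  rcases eq_or_ne p ⊤ with rfl | hpt
  · obtain ⟨K, hK, h⟩ := exists_lintegral_ball_enorm_inv_rpow_le le_rfl one_lt_two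
    refine ⟨2 * K, by positivity, fun w _ hw1 ρ hρ z hz => ?_⟩
    rw [eLpNorm_exponent_top] at hw1
    have hae : ∀ᵐ ζ, ‖w ζ‖ₑ ≤ 1 := by
      filter_upwards [enorm_ae_le_eLpNormEssSup w volume] with ζ hζ using hζ.trans hw1
    calc _ ≤ ∫⁻ ζ in ball 0 ρ, ‖(z - ζ)⁻¹‖ₑ ^ (1 : ℝ) := by
          refine lintegral_mono_ae (ae_restrict_of_ae ?_)
          filter_upwards [hae] with ζ hζ
          rw [ENNReal.rpow_one]
          exact mul_le_of_le_one_left' hζ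
      _ ≤ ∫⁻ ζ in ball z (2 * ρ), ‖(z - ζ)⁻¹‖ₑ ^ (1 : ℝ) := lintegral_mono_set (hball ρ z hz)
      _ ≤ _ := (h (2 * ρ) (by linarith) z).trans (by
        apply ENNReal.ofReal_le_ofReal
        linarith)
  · set P := p.toReal with hP
    have hP2 : 2 < P := by
      have := (ENNReal.toReal_lt_toReal (by simp) hpt).2 hp
      simpa using this
    have hconj : P.HolderConjugate (P.conjExponent) := Real.HolderConjugate.conjExponent (by linarith)
    have hq1 : 1 ≤ P.conjExponent := hconj.symm.lt.le
    have hq2 : P.conjExponent < 2 := by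
      rw [Real.conjExponent, div_lt_iff₀ (by linarith)]
      linarith
    obtain ⟨K, hK, h⟩ := exists_lintegral_ball_enorm_inv_rpow_le hq1 hq2
    refine ⟨1 + 2 * K, by positivity, fun w hw hw1 ρ hρ z hz => ?_⟩
    have hwp : ∫⁻ ζ, ‖w ζ‖ₑ ^ P ≤ 1 := by
      have h0 := eLpNorm_eq_lintegral_rpow_enorm_toReal (f := w) (μ := volume)
        (p := p) (by rintro rfl; simp at hp) hpt
      rw [h0] at hw1
      have := ENNReal.rpow_le_rpow hw1 (z := P) (by linarith)
      rwa [← ENNReal.rpow_mul, ENNReal.one_rpow, ← hP, one_div,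
        inv_mul_cancel₀ (by linarith), ENNReal.rpow_one] at this
    have hone : ∀ x : ℝ, 1 ≤ x → (ENNReal.ofReal x)⁻¹ ≤ 1 := fun x hx =>
      ENNReal.inv_le_one.2 (ENNReal.one_le_ofReal.2 hx)
    calc _ ≤ ∫⁻ ζ in ball 0 ρ, (‖w ζ‖ₑ ^ P + ‖(z - ζ)⁻¹‖ₑ ^ P.conjExponent) := by
          refine lintegral_mono fun ζ => (ENNReal.young_inequality _ _ hconj).trans ?_
          gcongr
          · exact mul_le_of_le_one_right' (hone _ (by linarith))
          · exact mul_le_of_le_one_right' (hone _ hq1)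
      _ = (∫⁻ ζ in ball 0 ρ, ‖w ζ‖ₑ ^ P) + ∫⁻ ζ in ball 0 ρ, ‖(z - ζ)⁻¹‖ₑ ^ P.conjExponent :=
          lintegral_add_left' (hw.enorm.pow_const P).restrict _
      _ ≤ 1 + ENNReal.ofReal (K * (2 * ρ)) := by
          gcongr
          · exact (setLIntegral_le_lintegral _ _).trans hwp
          · exact (lintegral_mono_set (hball ρ z hz)).trans (h (2 * ρ) (by linarith) z)
      _ ≤ _ := by
          rw [← ENNReal.ofReal_one, ← ENNReal.ofReal_add zero_le_one (by positivity)]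
          apply ENNReal.ofReal_le_ofReal
          nlinarith

/-! ### Mollification -/

/-- A sequence of bump functions shrinking to the origin. -/
noncomputable def shrinkingBump (E : Type*) [NormedAddCommGroup E] (n : ℕ) :
    ContDiffBump (0 : E) where
  rIn := 1 / (n + 2)
  rOut := 2 / (n + 2)
  rIn_pos := by positivity
  rIn_lt_rOut := by gcongr; norm_num

theorem shrinkingBump_rOut_le_one (E : Type*) [NormedAddCommGroup E] (n : ℕ) :
    (shrinkingBump E n).rOut ≤ 1 := by
  change 2 / ((n : ℝ) + 2) ≤ 1
  rw [div_le_one (by positivity)]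
  linarith [(Nat.cast_nonneg n : (0 : ℝ) ≤ n)]

theorem tendsto_shrinkingBump_rOut (E : Type*) [NormedAddCommGroup E] :
    Tendsto (fun n => (shrinkingBump E n).rOut) atTop (𝓝 0) := by
  change Tendsto (fun n : ℕ => 2 / ((n : ℝ) + 2)) atTop (𝓝 0)
  exact tendsto_const_nhds.div_atTop
    (tendsto_atTop_add_const_right _ _ tendsto_natCast_atTop_atTop)

/-- A bounded ratio of the two radii is what makes the mollifications converge almost everywhere, by
Lebesgue differentiation. -/
theorem shrinkingBump_rOut_le (E : Type*) [NormedAddCommGroup E] (n : ℕ) :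
    (shrinkingBump E n).rOut ≤ 2 * (shrinkingBump E n).rIn := by
  change 2 / ((n : ℝ) + 2) ≤ 2 * (1 / ((n : ℝ) + 2))
  exact le_of_eq (by ring)

section Mollify

variable {E F : Type*} [NormedAddCommGroup E] [InnerProductSpace ℝ E] [FiniteDimensional ℝ E]
  [MeasurableSpace E] [BorelSpace E] [NormedAddCommGroup F] [NormedSpace ℝ F]

/-- The mollification of `g` by the normalized `n`-th shrinking bump function. -/
noncomputable def mollify (n : ℕ) (g : E → F) (x : E) : F :=
  ∫ y, (shrinkingBump E n).normed volume (x - y) • g y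

theorem mollify_eq_convolution (n : ℕ) (g : E → F) :
    mollify n g = convolution ((shrinkingBump E n).normed volume) g
      (ContinuousLinearMap.lsmul ℝ ℝ) volume := by
  funext x
  simp [mollify, convolution_eq_swap]

theorem contDiff_mollify (n : ℕ) {g : E → F} (hg : LocallyIntegrable g) [CompleteSpace F] :
    ContDiff ℝ ∞ (mollify n g) := by
  rw [mollify_eq_convolution]
  exact (shrinkingBump E n).hasCompactSupport_normed.contDiff_convolution_left (n := ⊤) _
    (shrinkingBump E n).contDiff_normed hg

theorem ae_tendsto_mollify {g : E → F} (hg : LocallyIntegrable g) [CompleteSpace F] :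
    ∀ᵐ x, Tendsto (fun n => mollify n g x) atTop (𝓝 (g x)) := by
  simp only [mollify_eq_convolution]
  exact ContDiffBump.ae_convolution_tendsto_right_of_locallyIntegrable
    (tendsto_shrinkingBump_rOut E) (Eventually.of_forall (shrinkingBump_rOut_le E)) hg

theorem shrinkingBump_normed_eq_zero {n : ℕ} {x : E} (hx : (shrinkingBump E n).rOut ≤ ‖x‖) :
    (shrinkingBump E n).normed volume x = 0 := by
  have : x ∉ Function.support ((shrinkingBump E n).normed (volume : Measure E)) := by
    rw [ContDiffBump.support_normed_eq]
    simpa using hx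
  simpa using this

theorem norm_mollify_le {n : ℕ} {g : E → F} {x : E} {k : ℝ}
    (hg : ∀ᵐ y, y ∈ ball x (shrinkingBump E n).rOut → ‖g y‖ ≤ k) : ‖mollify n g x‖ ≤ k := by
  have hint : Integrable fun y => (shrinkingBump E n).normed volume (x - y) * k :=
    ((shrinkingBump E n).integrable_normed.comp_sub_left x).mul_const k
  refine (norm_integral_le_of_norm_le hint ?_).trans_eq ?_
  · filter_upwards [hg] with y hy
    rw [norm_smul, Real.norm_of_nonneg (ContDiffBump.nonneg_normed _ _)]
    by_cases h : y ∈ ball x (shrinkingBump E n).rOut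
    · gcongr
      · exact ContDiffBump.nonneg_normed _ _
      · exact hy h
    · rw [shrinkingBump_normed_eq_zero]
      · simp
      · simpa [dist_eq_norm, norm_sub_rev] using h
  · rw [integral_mul_const, integral_sub_left_eq_self (fun y => (shrinkingBump E n).normed volume y),
      ContDiffBump.integral_normed, one_mul]

theorem mollify_eq_zero {n : ℕ} {g : E → F} {x : E}
    (hg : ∀ y ∈ ball x (shrinkingBump E n).rOut, g y = 0) : mollify n g x = 0 := by
  have := norm_mollify_le (n := n) (g := g) (x := x) (k := 0)
    (Eventually.of_forall fun y hy => by simp [hg y hy])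
  simpa using this

end Mollify

/-! ### Gauging away the coefficient of the ∂̄-equation -/

theorem AEStronglyMeasurable.cauchyTransform {α : ℂ → ℂ} (hα : AEStronglyMeasurable α) :
    AEStronglyMeasurable (cauchyTransform α) := by
  have h : AEStronglyMeasurable (fun p : ℂ × ℂ => α p.2 * (p.1 - p.2)⁻¹)
      (volume.prod volume) :=
    hα.comp_snd.mul (measurable_fst.sub measurable_snd).inv.aestronglyMeasurable
  exact h.integral_prod_right'.const_mul _

/-- The equation `∂v/∂z̄ = α v` in `U`, in the sense of distributions. -/
def IsWeakDbarSolution (U : Set ℂ) (α v : ℂ → ℂ) : Prop :=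
  ∀ φ : ℂ → ℂ, ContDiff ℝ ∞ φ → HasCompactSupport φ → tsupport φ ⊆ U →
    ∫ z, v z * dbar φ z = -∫ z, α z * v z * φ z

theorem integrable_mul_of_bounded {v ψ : ℂ → ℂ} (hv : AEStronglyMeasurable v)
    (hv1 : ∀ᵐ z, ‖v z‖ ≤ 1) (hψ : Continuous ψ) (hc : HasCompactSupport ψ) :
    Integrable fun z => v z * ψ z :=
  (hψ.integrable_of_hasCompactSupport hc).bdd_mul hv hv1

/-- Test the equation with `e^{-h} φ` and apply the product rule. The factor `∂h/∂z̄ - α` is what a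
good choice of `h` will annihilate. -/
theorem IsWeakDbarSolution.gauge_smooth {U : Set ℂ} {α v h φ : ℂ → ℂ}
    (H : IsWeakDbarSolution U α v) (hα : Integrable α) (hv : AEStronglyMeasurable v)
    (hv1 : ∀ᵐ z, ‖v z‖ ≤ 1) (hh : ContDiff ℝ ∞ h) (hφ : ContDiff ℝ ∞ φ)
    (hc : HasCompactSupport φ) (hs : tsupport φ ⊆ U) :
    ∫ z, v z * Complex.exp (-h z) * dbar φ z
      = ∫ z, (dbar h z - α z) * v z * Complex.exp (-h z) * φ z := by
  have hexp : ContDiff ℝ ∞ fun z => Complex.exp (-h z) := hh.neg.cexp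
  have htop : (∞ : WithTop ℕ∞) ≠ 0 := by simp
  have H1 := H (fun z => Complex.exp (-h z) * φ z) (hexp.mul hφ) hc.mul_left
    ((tsupport_mul_subset_right).trans hs)
  have hd : ∀ z, dbar (fun z => Complex.exp (-h z) * φ z) z
      = -(dbar h z * Complex.exp (-h z) * φ z) + Complex.exp (-h z) * dbar φ z := by
    intro z
    rw [dbar_mul (hexp.differentiable htop z) (hφ.differentiable htop z),
      dbar_cexp (hh.neg.differentiable htop z), dbar_neg]
    ring
  simp only [hd] at H1
  have i1 : Integrable fun z => v z * (dbar h z * Complex.exp (-h z) * φ z) :=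
    integrable_mul_of_bounded hv hv1 (((hh.dbar.continuous).mul hexp.continuous).mul hφ.continuous)
      hc.mul_left
  have i2 : Integrable fun z => v z * (Complex.exp (-h z) * dbar φ z) :=
    integrable_mul_of_bounded hv hv1 (hexp.continuous.mul hφ.dbar.continuous) hc.dbar.mul_left
  have i3 : Integrable fun z => α z * v z * (Complex.exp (-h z) * φ z) := by
    obtain ⟨C, hC⟩ := (hc.mul_left (f := fun z => Complex.exp (-h z))).exists_bound_of_continuous
      (hexp.continuous.mul hφ.continuous)
    exact (hα.mul_bdd hv hv1).mul_bdd (hexp.continuous.mul hφ.continuous).aestronglyMeasurable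
      (Eventually.of_forall hC)
  have e1 : ∀ z, v z * (-(dbar h z * Complex.exp (-h z) * φ z) + Complex.exp (-h z) * dbar φ z)
      = -(v z * (dbar h z * Complex.exp (-h z) * φ z)) + v z * (Complex.exp (-h z) * dbar φ z) :=
    fun z => by ring
  simp only [e1] at H1
  rw [integral_add (by exact i1.neg) i2, integral_neg] at H1
  have e2 : ∀ z, (dbar h z - α z) * v z * Complex.exp (-h z) * φ z
      = v z * (dbar h z * Complex.exp (-h z) * φ z) - α z * v z * (Complex.exp (-h z) * φ z) :=
    fun z => by ring
  simp only [e2]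
  rw [integral_sub i1 i3]
  simp only [mul_assoc] at H1 ⊢
  linear_combination H1

theorem norm_cauchyTransform_le_of_lintegral {α : ℂ → ℂ} {z : ℂ} {M : ℝ} (hM : 0 ≤ M)
    (h : ∫⁻ ζ, ‖α ζ‖ₑ * ‖(z - ζ)⁻¹‖ₑ ≤ ENNReal.ofReal M) : ‖cauchyTransform α z‖ ≤ M := by
  have := (enorm_cauchyTransform_le α z).trans h
  rwa [← ofReal_norm, ENNReal.ofReal_le_ofReal_iff hM] at this

theorem norm_cexp_neg_le {w : ℂ} {M : ℝ} (h : ‖w‖ ≤ M) : ‖Complex.exp (-w)‖ ≤ Real.exp M := by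
  rw [Complex.norm_exp]
  apply Real.exp_le_exp.2
  have := Complex.abs_re_le_norm w
  have := neg_abs_le w.re
  simp only [Complex.neg_re]
  linarith

theorem integrable_indicator_ball_inv (r : ℝ) (z : ℂ) :
    Integrable fun ζ => (ball (0 : ℂ) r).indicator (fun ζ => ‖(z - ζ)⁻¹‖) ζ := by
  rw [integrable_indicator_iff measurableSet_ball]
  have h1 : LocallyIntegrable fun ζ : ℂ => (z - ζ)⁻¹ := by
    rw [locallyIntegrable_iff]
    intro K hK
    have hK' : IsCompact ((fun ζ => z - ζ) ⁻¹' K) :=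
      (Homeomorph.subLeft z).isCompact_preimage.2 hK
    have := locallyIntegrable_complex_inv.integrableOn_isCompact hK'
    have h2 := (Measure.measurePreserving_sub_left (volume : Measure ℂ) z).integrableOn_comp_preimage
      (Homeomorph.subLeft z).measurableEmbedding (f := fun ζ : ℂ => ζ⁻¹)
      (s := (fun ζ => z - ζ) ⁻¹' K)
    have h3 := h2.2 this
    rw [← Set.preimage_comp] at h3
    have h4 : ((fun ζ => z - ζ) ∘ fun ζ => z - ζ) = id := by
      funext ζ
      simp
    rw [h4] at h3
    exact h3
  exact ((h1.integrableOn_isCompact (isCompact_closedBall 0 r)).mono_set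
    ball_subset_closedBall).norm

/-- The gauge function must be smooth to enter a test function, so `β` is mollified and the limit is
taken by dominated convergence. Keeping `β` apart from `α` allows it to be bounded, which supplies
the dominating functions; `α` itself is merely integrable. -/
theorem IsWeakDbarSolution.gauge_bounded {U : Set ℂ} {α v β φ : ℂ → ℂ} {ρ k : ℝ}
    (H : IsWeakDbarSolution U α v) (hρ : 0 ≤ ρ) (hU : U ⊆ ball 0 ρ) (hα : Integrable α)
    (hv : AEStronglyMeasurable v) (hv1 : ∀ᵐ z, ‖v z‖ ≤ 1)
    (hβ : AEStronglyMeasurable β) (hk : 0 ≤ k) (hβk : ∀ z, ‖β z‖ ≤ k)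
    (hβs : ∀ z, z ∉ ball 0 ρ → β z = 0) (hφ : ContDiff ℝ ∞ φ)
    (hc : HasCompactSupport φ) (hs : tsupport φ ⊆ U) :
    ∫ z, v z * Complex.exp (-cauchyTransform β z) * dbar φ z
      = ∫ z, (β z - α z) * v z * Complex.exp (-cauchyTransform β z) * φ z := by
  have hβint : Integrable β := by
    have : Integrable ((ball (0 : ℂ) ρ).indicator β) := by
      rw [integrable_indicator_iff measurableSet_ball]
      exact Measure.integrableOn_of_bounded measure_ball_lt_top.ne hβ
        (Eventually.of_forall hβk)
    refine this.congr (Eventually.of_forall fun z => ?_)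
    by_cases h : z ∈ ball (0 : ℂ) ρ
    · simp only [Set.indicator_of_mem h]
    · simp only [Set.indicator_of_notMem h, hβs z h]
  -- The bumps have radius at most `1`, so all mollifications live in one fixed disc.
  have hb0 : ∀ n, ∀ z, z ∉ ball (0 : ℂ) (ρ + 1) → mollify n β z = 0 := by
    intro n z hz
    refine mollify_eq_zero fun y hy => hβs y fun hy2 => hz ?_
    have h1 : ‖z - y‖ < 1 := by
      rw [norm_sub_rev, ← dist_eq_norm]
      exact (mem_ball.1 hy).trans_le (shrinkingBump_rOut_le_one ℂ n)
    rw [mem_ball_zero_iff] at hy2 ⊢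
    linarith [norm_le_norm_add_norm_sub' z y]
  have hbc : ∀ n, HasCompactSupport (mollify n β) := fun n =>
    HasCompactSupport.of_support_subset_isCompact (isCompact_closedBall (0 : ℂ) (ρ + 1)) fun z hz => by
      by_contra h
      exact hz (hb0 n z fun h2 => h (ball_subset_closedBall h2))
  have hbs : ∀ n, ContDiff ℝ ∞ (mollify n β) := fun n => contDiff_mollify n hβint.locallyIntegrable
  have hbk : ∀ n z, ‖mollify n β z‖ ≤ k := fun n z =>
    norm_mollify_le (Eventually.of_forall fun y _ => hβk y)
  have hlim : ∀ᵐ z, Tendsto (fun n => mollify n β z) atTop (𝓝 (β z)) :=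
    ae_tendsto_mollify hβint.locallyIntegrable
  have hdom : ∀ n z ζ, ‖mollify n β ζ * (z - ζ)⁻¹‖
      ≤ k * (ball (0 : ℂ) (ρ + 1)).indicator (fun ζ => ‖(z - ζ)⁻¹‖) ζ := by
    intro n z ζ
    by_cases h : ζ ∈ ball (0 : ℂ) (ρ + 1)
    · rw [Set.indicator_of_mem h, norm_mul]
      gcongr
      exact hbk n ζ
    · rw [hb0 n ζ h, Set.indicator_of_notMem h]
      simp
  have hT : ∀ z, Tendsto (fun n => cauchyTransform (mollify n β) z) atTop
      (𝓝 (cauchyTransform β z)) := by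
    intro z
    refine Tendsto.const_mul _ (tendsto_integral_of_dominated_convergence
      (fun ζ => k * (ball (0 : ℂ) (ρ + 1)).indicator (fun ζ => ‖(z - ζ)⁻¹‖) ζ) (fun n => ?_)
      ((integrable_indicator_ball_inv _ z).const_mul k)
      (fun n => Eventually.of_forall (hdom n z)) ?_)
    · exact (hbs n).continuous.aestronglyMeasurable.mul
        (measurable_const.sub measurable_id).inv.aestronglyMeasurable
    · filter_upwards [hlim] with ζ hζ using hζ.mul_const _
  obtain ⟨K, hK, hKb⟩ := exists_lintegral_ball_enorm_inv_rpow_le le_rfl one_lt_two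
  set M := k * (K * (2 * (ρ + 1))) with hM
  have hM0 : 0 ≤ M := by positivity
  have hTb : ∀ n, ∀ z ∈ U, ‖cauchyTransform (mollify n β) z‖ ≤ M := by
    intro n z hz
    apply norm_cauchyTransform_le_of_lintegral hM0
    calc ∫⁻ ζ, ‖mollify n β ζ‖ₑ * ‖(z - ζ)⁻¹‖ₑ
        ≤ ∫⁻ ζ, ENNReal.ofReal k *
            (ball z (2 * (ρ + 1))).indicator (fun ζ => ‖(z - ζ)⁻¹‖ₑ ^ (1 : ℝ)) ζ := by
          refine lintegral_mono fun ζ => ?_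
          by_cases h : ζ ∈ ball (0 : ℂ) (ρ + 1)
          · have h2 : ζ ∈ ball z (2 * (ρ + 1)) := by
              have h3 := hU hz
              rw [mem_ball, dist_eq_norm]
              rw [mem_ball_zero_iff] at h h3
              linarith [norm_sub_le ζ z]
            simp only [Set.indicator_of_mem h2, ENNReal.rpow_one]
            gcongr
            rw [← ofReal_norm]
            exact ENNReal.ofReal_le_ofReal (hbk n ζ)
          · simp [hb0 n ζ h]
      _ = ENNReal.ofReal k * ∫⁻ ζ in ball z (2 * (ρ + 1)), ‖(z - ζ)⁻¹‖ₑ ^ (1 : ℝ) := by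
          rw [lintegral_const_mul' _ _ ENNReal.ofReal_ne_top, lintegral_indicator measurableSet_ball]
      _ ≤ ENNReal.ofReal k * ENNReal.ofReal (K * (2 * (ρ + 1))) := by
          gcongr
          exact hKb _ (by linarith) z
      _ = ENNReal.ofReal M := by rw [← ENNReal.ofReal_mul hk]
  obtain ⟨Cφ, hCφ⟩ := hc.exists_bound_of_continuous hφ.continuous
  have hexp : ∀ n, ∀ z ∈ U, ‖Complex.exp (-cauchyTransform (mollify n β) z)‖ ≤ Real.exp M :=
    fun n z hz => norm_cexp_neg_le (hTb n z hz)
  have hTm : ∀ n, AEStronglyMeasurable fun z => Complex.exp (-cauchyTransform (mollify n β) z) :=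
    fun n => (((hbs n).cauchyTransform (hbc n)).neg.cexp).continuous.aestronglyMeasurable
  have hexpt : ∀ z, Tendsto (fun n => Complex.exp (-cauchyTransform (mollify n β) z)) atTop
      (𝓝 (Complex.exp (-cauchyTransform β z))) := fun z =>
    (Complex.continuous_exp.tendsto _).comp (hT z).neg
  have L1 : Tendsto (fun n => ∫ z, v z * Complex.exp (-cauchyTransform (mollify n β) z) * dbar φ z)
      atTop (𝓝 (∫ z, v z * Complex.exp (-cauchyTransform β z) * dbar φ z)) := by
    refine tendsto_integral_of_dominated_convergence (fun z => Real.exp M * ‖dbar φ z‖)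
      (fun n => (hv.mul (hTm n)).mul hφ.dbar.continuous.aestronglyMeasurable)
      ((hφ.dbar.continuous.integrable_of_hasCompactSupport hc.dbar).norm.const_mul _)
      (fun n => ?_) (Eventually.of_forall fun z => ((hexpt z).const_mul _).mul_const _)
    filter_upwards [hv1] with z hz
    by_cases h : z ∈ tsupport φ
    · rw [norm_mul, norm_mul]
      gcongr
      calc _ ≤ 1 * Real.exp M := by gcongr; exact hexp n z (hs h)
        _ = _ := one_mul _
    · simp [dbar_of_notMem_tsupport h]
  have L2 : Tendsto (fun n => ∫ z, (mollify n β z - α z) * v z *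
        Complex.exp (-cauchyTransform (mollify n β) z) * φ z)
      atTop (𝓝 (∫ z, (β z - α z) * v z * Complex.exp (-cauchyTransform β z) * φ z)) := by
    refine tendsto_integral_of_dominated_convergence
      (fun z => k * Real.exp M * ‖φ z‖ + Real.exp M * Cφ * ‖α z‖)
      (fun n => ((((hbs n).continuous.aestronglyMeasurable.sub hα.1).mul hv).mul (hTm n)).mul
        hφ.continuous.aestronglyMeasurable)
      (((hφ.continuous.integrable_of_hasCompactSupport hc).norm.const_mul _).add
        (hα.norm.const_mul _)) (fun n => ?_) ?_
    · filter_upwards [hv1] with z hz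
      by_cases h : z ∈ tsupport φ
      · have h1 : ‖mollify n β z - α z‖ ≤ k + ‖α z‖ :=
          (norm_sub_le _ _).trans (by gcongr; exact hbk n z)
        have h2 := hexp n z (hs h)
        have h3 := hCφ z
        simp only [norm_mul]
        calc _ ≤ (k + ‖α z‖) * 1 * Real.exp M * ‖φ z‖ := by gcongr
          _ = k * Real.exp M * ‖φ z‖ + Real.exp M * ‖φ z‖ * ‖α z‖ := by ring
          _ ≤ _ := by gcongr
      · rw [image_eq_zero_of_notMem_tsupport h]
        have : 0 ≤ Cφ := (norm_nonneg _).trans (hCφ 0)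
        simp only [mul_zero, norm_zero]
        positivity
    · filter_upwards [hlim] with z hz
      exact (((hz.sub_const _).mul_const _).mul (hexpt z)).mul_const _
  refine tendsto_nhds_unique L1 (L2.congr fun n => ?_)
  have hG := H.gauge_smooth hα hv hv1 ((hbs n).cauchyTransform (hbc n)) hφ hc hs
  simp only [dbar_cauchyTransform (hbs n) (hbc n)] at hG
  exact hG.symm

/-- Apply the bounded case to the truncations of `α` at height `k`. Since they are dominated by
`|α|`, the bound `M` holds for all their transforms at once, and in the limit the right-hand side
vanishes. -/
theorem IsWeakDbarSolution.gauge {U : Set ℂ} {α v φ : ℂ → ℂ} {ρ M : ℝ}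
    (H : IsWeakDbarSolution U α v) (hρ : 0 ≤ ρ) (hU : U ⊆ ball 0 ρ) (hα : Integrable α)
    (hαs : ∀ z, z ∉ ball 0 ρ → α z = 0)
    (hv : AEStronglyMeasurable v) (hv1 : ∀ᵐ z, ‖v z‖ ≤ 1) (hM : 0 ≤ M)
    (hαM : ∀ z ∈ U, ∫⁻ ζ, ‖α ζ‖ₑ * ‖(z - ζ)⁻¹‖ₑ ≤ ENNReal.ofReal M) (hφ : ContDiff ℝ ∞ φ)
    (hc : HasCompactSupport φ) (hs : tsupport φ ⊆ U) :
    ∫ z, v z * Complex.exp (-cauchyTransform α z) * dbar φ z = 0 := by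
  classical
  set β : ℕ → ℂ → ℂ := fun k => {z | ‖α z‖ ≤ k}.indicator α with hβ_def
  have hβm : ∀ k, AEStronglyMeasurable (β k) := fun k =>
    hα.1.indicator₀ (hα.1.norm.aemeasurable.nullMeasurable measurableSet_Iic)
  have hβle : ∀ k z, ‖β k z‖ ≤ ‖α z‖ := fun k z => norm_indicator_le_norm_self _ _
  have hβk : ∀ k z, ‖β k z‖ ≤ k := by
    intro k z
    by_cases h : ‖α z‖ ≤ k
    · exact (hβle k z).trans h
    · rw [hβ_def]
      simp only
      rw [Set.indicator_of_notMem (by exact h)]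
      simp
  have hβs : ∀ k z, z ∉ ball (0 : ℂ) ρ → β k z = 0 := fun k z hz => by
    have := hβle k z
    rw [hαs z hz] at this
    simpa using this
  have hβlim : ∀ z, Tendsto (fun k => β k z) atTop (𝓝 (α z)) := by
    intro z
    refine tendsto_const_nhds.congr' ?_
    filter_upwards [tendsto_natCast_atTop_atTop.eventually_ge_atTop ‖α z‖] with k hk
    exact (Set.indicator_of_mem (by exact hk) _).symm
  have hlint : ∀ k, ∀ z ∈ U, ∫⁻ ζ, ‖β k ζ‖ₑ * ‖(z - ζ)⁻¹‖ₑ ≤ ENNReal.ofReal M := fun k z hz =>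
    (lintegral_mono fun ζ => by
      gcongr
      exact enorm_le_iff_norm_le.2 (hβle k ζ)).trans (hαM z hz)
  have hexp : ∀ k, ∀ z ∈ U, ‖Complex.exp (-cauchyTransform (β k) z)‖ ≤ Real.exp M :=
    fun k z hz => norm_cexp_neg_le (norm_cauchyTransform_le_of_lintegral hM (hlint k z hz))
  have hinvm : ∀ z : ℂ, AEStronglyMeasurable fun ζ : ℂ => (z - ζ)⁻¹ := fun z =>
    (measurable_const.sub measurable_id).inv.aestronglyMeasurable
  have hT : ∀ z ∈ U, Tendsto (fun k => cauchyTransform (β k) z) atTop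
      (𝓝 (cauchyTransform α z)) := by
    intro z hz
    refine Tendsto.const_mul _ (tendsto_integral_of_dominated_convergence
      (fun ζ => ‖α ζ * (z - ζ)⁻¹‖) (fun k => (hβm k).mul (hinvm z)) ?_
      (fun k => Eventually.of_forall fun ζ => ?_)
      (Eventually.of_forall fun ζ => (hβlim ζ).mul_const _))
    · refine Integrable.norm ⟨hα.1.mul (hinvm z), ?_⟩
      refine lt_of_le_of_lt ?_ (ENNReal.ofReal_lt_top (r := M))
      simpa only [enorm_mul] using hαM z hz
    · rw [norm_mul, norm_mul]
      gcongr
      exact hβle k ζ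
  have hexpt : ∀ z ∈ U, Tendsto (fun k => Complex.exp (-cauchyTransform (β k) z)) atTop
      (𝓝 (Complex.exp (-cauchyTransform α z))) := fun z hz =>
    (Complex.continuous_exp.tendsto _).comp (hT z hz).neg
  have hTm : ∀ k, AEStronglyMeasurable fun z => Complex.exp (-cauchyTransform (β k) z) :=
    fun k => Complex.continuous_exp.comp_aestronglyMeasurable
      (AEStronglyMeasurable.cauchyTransform (hβm k)).neg
  obtain ⟨Cφ, hCφ⟩ := hc.exists_bound_of_continuous hφ.continuous
  have L1 : Tendsto (fun k => ∫ z, v z * Complex.exp (-cauchyTransform (β k) z) * dbar φ z)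
      atTop (𝓝 (∫ z, v z * Complex.exp (-cauchyTransform α z) * dbar φ z)) := by
    refine tendsto_integral_of_dominated_convergence (fun z => Real.exp M * ‖dbar φ z‖)
      (fun n => (hv.mul (hTm n)).mul hφ.dbar.continuous.aestronglyMeasurable)
      ((hφ.dbar.continuous.integrable_of_hasCompactSupport hc.dbar).norm.const_mul _)
      (fun n => ?_) (Eventually.of_forall fun z => ?_)
    · filter_upwards [hv1] with z hz
      by_cases h : z ∈ tsupport φ
      · rw [norm_mul, norm_mul]
        gcongr
        calc _ ≤ 1 * Real.exp M := by gcongr; exact hexp n z (hs h)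
          _ = _ := one_mul _
      · simp [dbar_of_notMem_tsupport h]
    · by_cases h : z ∈ tsupport φ
      · exact ((hexpt z (hs h)).const_mul _).mul_const _
      · simp [dbar_of_notMem_tsupport h]
  have L2 : Tendsto (fun k => ∫ z, (β k z - α z) * v z *
        Complex.exp (-cauchyTransform (β k) z) * φ z) atTop (𝓝 (∫ _ : ℂ, (0 : ℂ))) := by
    refine tendsto_integral_of_dominated_convergence (fun z => 2 * Real.exp M * Cφ * ‖α z‖)
      (fun n => ((((hβm n).sub hα.1).mul hv).mul (hTm n)).mul
        hφ.continuous.aestronglyMeasurable) (hα.norm.const_mul _) (fun n => ?_)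
      (Eventually.of_forall fun z => ?_)
    · filter_upwards [hv1] with z hz
      by_cases h : z ∈ tsupport φ
      · have h1 : ‖β n z - α z‖ ≤ 2 * ‖α z‖ :=
          (norm_sub_le _ _).trans (by linarith [hβle n z])
        have h2 := hexp n z (hs h)
        have h3 := hCφ z
        simp only [norm_mul]
        calc _ ≤ (2 * ‖α z‖) * 1 * Real.exp M * Cφ := by gcongr
          _ = _ := by ring
      · rw [image_eq_zero_of_notMem_tsupport h]
        have : 0 ≤ Cφ := (norm_nonneg _).trans (hCφ 0)
        simp only [mul_zero, norm_zero]
        positivity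
    · by_cases h : z ∈ tsupport φ
      · have := ((((hβlim z).sub_const (α z)).mul_const (v z)).mul (hexpt z (hs h))).mul_const (φ z)
        simpa using this
      · simp [image_eq_zero_of_notMem_tsupport h]
  rw [integral_zero] at L2
  refine tendsto_nhds_unique L1 (L2.congr fun k => ?_)
  exact (H.gauge_bounded hρ hU hα hv hv1 (hβm k) (Nat.cast_nonneg k)
    (hβk k) (hβs k) hφ hc hs).symm

/-! ### The Caccioppoli inequality -/

theorem fderiv_mollify {E F : Type*} [NormedAddCommGroup E] [InnerProductSpace ℝ E]
    [FiniteDimensional ℝ E] [MeasurableSpace E] [BorelSpace E] [NormedAddCommGroup F]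
    [NormedSpace ℝ F] [CompleteSpace F] (n : ℕ) {g : E → F} (hg : LocallyIntegrable g) (x w : E) :
    fderiv ℝ (mollify n g) x w
      = ∫ y, (fderiv ℝ ((shrinkingBump E n).normed volume) (x - y) w) • g y := by
  set ρ := (shrinkingBump E n).normed (volume : Measure E)
  have hρ : ContDiff ℝ 1 ρ := (shrinkingBump E n).contDiff_normed
  have hc : HasCompactSupport ρ := (shrinkingBump E n).hasCompactSupport_normed
  have h1 : mollify n g
      = convolution g ρ (ContinuousLinearMap.lsmul ℝ ℝ : ℝ →L[ℝ] F →L[ℝ] F).flip volume := by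
    funext x
    simp [mollify, convolution_def, ρ]
  rw [h1, (hc.hasFDerivAt_convolution_right _ hg hρ x).fderiv,
    convolution_precompR_apply _ hg (hc.fderiv ℝ) (hρ.continuous_fderiv one_ne_zero)]
  simp [convolution_def]

theorem continuous_gradient {f : Plane → ℝ} (hf : ContDiff ℝ ∞ f) : Continuous (∇ f) := by
  unfold gradient
  exact (LinearIsometryEquiv.continuous _).comp (hf.continuous_fderiv (by simp))

theorem norm_gradient (f : Plane → ℝ) (x : Plane) : ‖∇ f x‖ = ‖fderiv ℝ f x‖ := by
  rw [← toDual_gradient, LinearIsometryEquiv.norm_map]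

theorem gradient_mul {f g : Plane → ℝ} {x : Plane} (hf : DifferentiableAt ℝ f x)
    (hg : DifferentiableAt ℝ g x) : ∇ (fun y => f y * g y) x = f x • ∇ g x + g x • ∇ f x := by
  refine ext_inner_right ℝ fun w => ?_
  rw [inner_gradient_left, fderiv_fun_mul hf hg, inner_add_left, real_inner_smul_left,
    real_inner_smul_left, inner_gradient_left, inner_gradient_left]
  simp

theorem gradient_eq_zero_of_notMem_tsupport {f : Plane → ℝ} {x : Plane} (hx : x ∉ tsupport f) :
    ∇ f x = 0 := by
  have h : fderiv ℝ f x = 0 := by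
    by_contra h
    exact hx (support_fderiv_subset ℝ h)
  simp [gradient, h]

/-- The test function is the translated bump `ρ (x - ·)`; it is supported within `3/4 + 1/8 = 7/8 <
1` of `a`, so the weak gradient relation in the unit ball applies to it. -/
theorem gradient_mollify_of_byParts {a : Plane} {u : Plane → ℝ} {G : Plane → Plane}
    (hu : Integrable u) (hG : Integrable G)
    (hparts : ∀ φ : Plane → ℝ, IsTestFunction (ball a 1) φ → ∫ x, u x • ∇ φ x = -∫ x, φ x • G x)
    {n : ℕ} (hn : (shrinkingBump Plane n).rOut ≤ 1 / 8) {x : Plane} (hx : x ∈ closedBall a (3 / 4)) :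
    ∇ (mollify n u) x = mollify n G x := by
  set ρ := (shrinkingBump Plane n).normed (volume : Measure Plane) with hρ_def
  have hρ : ContDiff ℝ ∞ ρ := (shrinkingBump Plane n).contDiff_normed
  have hρ0 : ∀ y, (shrinkingBump Plane n).rOut ≤ ‖y‖ → ρ y = 0 := fun y hy =>
    shrinkingBump_normed_eq_zero hy
  have hsupp : tsupport (fun y => ρ (x - y)) ⊆ closedBall a (7 / 8) := by
    refine closure_minimal (fun y hy => ?_) isClosed_closedBall
    by_contra hy2
    refine hy (hρ0 _ ?_)
    rw [mem_closedBall, not_le] at hy2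
    rw [mem_closedBall] at hx
    rw [← dist_eq_norm, dist_comm]
    linarith [dist_triangle y x a]
  have hball : closedBall a (7 / 8 : ℝ) ⊆ ball a 1 := closedBall_subset_ball (by norm_num)
  have htest : IsTestFunction (ball a 1) (fun y => ρ (x - y)) :=
    ⟨hρ.comp (contDiff_const.sub contDiff_id),
      HasCompactSupport.of_support_subset_isCompact (isCompact_closedBall a (7 / 8))
        ((subset_tsupport _).trans hsupp), hsupp.trans hball⟩
  have hgrad : ∀ y w, ⟪∇ (fun y => ρ (x - y)) y, w⟫ = -fderiv ℝ ρ (x - y) w := by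
    intro y w
    have h1 : HasFDerivAt (fun t : Plane => x - t) (-ContinuousLinearMap.id ℝ Plane) y :=
      (hasFDerivAt_id y).const_sub x
    have h2 := ((hρ.differentiable (by simp) (x - y)).hasFDerivAt).comp y h1
    rw [inner_gradient_left, show fderiv ℝ (fun t => ρ (x - t)) y = _ from h2.fderiv]
    simp
  have hP := hparts _ htest
  have hi1 : Integrable fun y => u y • ∇ (fun y => ρ (x - y)) y := by
    obtain ⟨C, hC⟩ := (htest.compactSupport.fderiv ℝ).exists_bound_of_continuous
      (htest.smooth.continuous_fderiv (by simp))
    exact hu.smul_bdd C (continuous_gradient htest.smooth).aestronglyMeasurable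
      (Eventually.of_forall fun y => by rw [norm_gradient]; exact hC y)
  have hi2 : Integrable fun y => ρ (x - y) • G y := by
    obtain ⟨C, hC⟩ := htest.compactSupport.exists_bound_of_continuous htest.smooth.continuous
    exact hG.bdd_smul C htest.smooth.continuous.aestronglyMeasurable
      (Eventually.of_forall fun y => hC y)
  refine ext_inner_left ℝ fun w => ?_
  have hP' := congrArg (fun v => ⟪w, v⟫) hP
  simp only [inner_neg_right] at hP'
  rw [← integral_inner hi1, ← integral_inner hi2] at hP'
  rw [real_inner_comm, inner_gradient_left, fderiv_mollify n hu.locallyIntegrable, mollify,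
    ← integral_inner hi2]
  have e : ∀ y, ⟪w, u y • ∇ (fun y => ρ (x - y)) y⟫ = -((fderiv ℝ ρ (x - y) w) • u y) := by
    intro y
    rw [real_inner_smul_right, real_inner_comm, hgrad, smul_eq_mul]
    ring
  simp only [e, integral_neg, neg_inj] at hP'
  exact hP'

/-- Formally, test the equation with `η u`: then `∫ η |∇u|²` equals minus `∫ (u ∇u·∇η + (W·∇u) η
u)`. As `|∇u| ≤ 1` is known, nothing needs to be absorbed, and one factor `|u| ≤ ε` comes out of the
right-hand side. Since `u` is only weakly differentiable, its mollifications are used instead. -/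
theorem integral_sq_norm_le_of_weak_solution {a : Plane} {u : Plane → ℝ} {G W : Plane → Plane}
    {η : Plane → ℝ} {ε C : ℝ}
    (hu : Integrable u) (hG : Integrable G) (hW : Integrable W) (hε : 0 ≤ ε)
    (huε : ∀ᵐ x, ‖u x‖ ≤ ε) (hG1 : ∀ᵐ x, ‖G x‖ ≤ 1) (hG0 : ∀ x, x ∉ ball a 1 → G x = 0)
    (hparts : ∀ φ : Plane → ℝ, IsTestFunction (ball a 1) φ → ∫ x, u x • ∇ φ x = -∫ x, φ x • G x)
    (heq : ∀ φ : Plane → ℝ, IsTestFunction (ball a 1) φ →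
      ∫ x, (⟪G x, ∇ φ x⟫ + ⟪W x, G x⟫ * φ x) = 0)
    (hη : ContDiff ℝ ∞ η) (hηs : tsupport η ⊆ closedBall a (3 / 4))
    (hη0 : ∀ x, 0 ≤ η x) (hη1 : ∀ x, η x ≤ 1) (hηC : ∀ x, ‖fderiv ℝ η x‖ ≤ C) :
    ∫ x, η x * ‖G x‖ ^ 2 ≤ ε * (C * (volume (ball a 1)).toReal + ∫ x, ‖W x‖) := by
  have hηc : HasCompactSupport η :=
    HasCompactSupport.of_support_subset_isCompact (isCompact_closedBall a (3 / 4))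
      ((subset_tsupport _).trans hηs)
  have hC : 0 ≤ C := (norm_nonneg _).trans (hηC 0)
  have hball : closedBall a (3 / 4 : ℝ) ⊆ ball a 1 := closedBall_subset_ball (by norm_num)
  have hus : ∀ n, ContDiff ℝ ∞ (mollify n u) := fun n => contDiff_mollify n hu.locallyIntegrable
  have hub : ∀ n x, ‖mollify n u x‖ ≤ ε := fun n x => norm_mollify_le (by
    filter_upwards [huε] with y hy _ using hy)
  have hGs : ∀ n, Continuous (mollify n G) := fun n =>
    (contDiff_mollify n hG.locallyIntegrable).continuous
  have hGb : ∀ n x, ‖mollify n G x‖ ≤ 1 := fun n x => norm_mollify_le (by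
    filter_upwards [hG1] with y hy _ using hy)
  have hi1 : ∀ n, Integrable fun x => η x * ⟪G x, mollify n G x⟫ := by
    intro n
    refine (hG.norm).mono' (hη.continuous.aestronglyMeasurable.mul
      (hG.1.inner (hGs n).aestronglyMeasurable)) (Eventually.of_forall fun x => ?_)
    rw [norm_mul, Real.norm_of_nonneg (hη0 x)]
    calc _ ≤ 1 * (‖G x‖ * 1) := by
          gcongr
          · exact hη1 x
          · exact (norm_inner_le_norm _ _).trans (by gcongr; exact hGb n x)
      _ = ‖G x‖ := by ring
  have hbound : ∀ᶠ n in atTop, ∫ x, η x * ⟪G x, mollify n G x⟫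
      ≤ ε * (C * (volume (ball a 1)).toReal + ∫ x, ‖W x‖) := by
    filter_upwards [(tendsto_shrinkingBump_rOut Plane).eventually_le_const
      (show (0 : ℝ) < 1 / 8 by norm_num)] with n hn
    -- The mollified function is differentiable everywhere, and its gradient is the mollification of
    -- `G` wherever `η` does not vanish.
    have htest : IsTestFunction (ball a 1) (fun x => η x * mollify n u x) :=
      ⟨hη.mul (hus n), hηc.mul_right, (tsupport_mul_subset_left).trans (hηs.trans hball)⟩
    have hgrad : ∀ x, ∇ (fun x => η x * mollify n u x) x
        = η x • mollify n G x + mollify n u x • ∇ η x := by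
      intro x
      rw [gradient_mul (hη.differentiable (by simp) x) ((hus n).differentiable (by simp) x)]
      by_cases hx : x ∈ tsupport η
      · rw [gradient_mollify_of_byParts hu hG hparts hn (hηs hx)]
      · rw [image_eq_zero_of_notMem_tsupport hx]
        simp
    have hrw : ∀ x, ⟪G x, ∇ (fun x => η x * mollify n u x) x⟫ + ⟪W x, G x⟫ * (η x * mollify n u x)
        = η x * ⟪G x, mollify n G x⟫
          - (-(mollify n u x * ⟪G x, ∇ η x⟫ + ⟪W x, G x⟫ * (η x * mollify n u x))) := by
      intro x
      rw [hgrad, inner_add_right, real_inner_smul_right, real_inner_smul_right]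
      ring
    have hdom : ∀ᵐ x, ‖-(mollify n u x * ⟪G x, ∇ η x⟫ + ⟪W x, G x⟫ * (η x * mollify n u x))‖
        ≤ ε * (C * (ball a 1).indicator (fun _ => (1 : ℝ)) x + ‖W x‖) := by
      filter_upwards [hG1] with x hx
      rw [norm_neg, mul_add]
      refine (norm_add_le _ _).trans (add_le_add ?_ ?_)
      · by_cases hxb : x ∈ ball a 1
        · rw [Set.indicator_of_mem hxb, norm_mul, mul_one]
          gcongr
          · exact hub n x
          · calc _ ≤ ‖G x‖ * ‖∇ η x‖ := norm_inner_le_norm _ _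
              _ ≤ 1 * C := by
                gcongr
                rw [norm_gradient]
                exact hηC x
              _ = C := one_mul C
        · simp [hG0 x hxb, hxb]
      · rw [norm_mul, norm_mul, Real.norm_of_nonneg (hη0 x)]
        calc _ ≤ (‖W x‖ * 1) * (1 * ε) := by
              have h1 : ‖⟪W x, G x⟫‖ ≤ ‖W x‖ * 1 :=
                (norm_inner_le_norm (W x) (G x)).trans (by gcongr)
              exact mul_le_mul h1 (mul_le_mul (hη1 x) (hub n x) (norm_nonneg _) zero_le_one)
                (mul_nonneg (hη0 x) (norm_nonneg _)) (by positivity)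
          _ = _ := by ring
    have hind : Integrable fun x => (ball a 1).indicator (fun _ => (1 : ℝ)) x := by
      rw [integrable_indicator_iff measurableSet_ball]
      exact integrableOn_const measure_ball_lt_top.ne
    have hint : Integrable fun x => ε * (C * (ball a 1).indicator (fun _ => (1 : ℝ)) x + ‖W x‖) :=
      ((hind.const_mul C).add hW.norm).const_mul ε
    have hi2 : Integrable fun x =>
        -(mollify n u x * ⟪G x, ∇ η x⟫ + ⟪W x, G x⟫ * (η x * mollify n u x)) := by
      refine hint.mono' ?_ hdom
      exact (((hus n).continuous.aestronglyMeasurable.mul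
        (hG.1.inner (continuous_gradient hη).aestronglyMeasurable)).add
        ((hW.1.inner hG.1).mul (hη.continuous.mul (hus n).continuous).aestronglyMeasurable)).neg
    have h0 := heq _ htest
    simp only [hrw] at h0
    rw [integral_sub (hi1 n) hi2, sub_eq_zero] at h0
    rw [h0]
    calc _ ≤ ‖∫ x, -(mollify n u x * ⟪G x, ∇ η x⟫ + ⟪W x, G x⟫ * (η x * mollify n u x))‖ :=
          Real.le_norm_self _
      _ ≤ ∫ x, ε * (C * (ball a 1).indicator (fun _ => (1 : ℝ)) x + ‖W x‖) :=
          norm_integral_le_of_norm_le hint hdom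
      _ = _ := by
          rw [integral_const_mul, integral_add (hind.const_mul C) hW.norm, integral_const_mul,
            integral_indicator measurableSet_ball]
          simp [Measure.real]
  have hlim : Tendsto (fun n => ∫ x, η x * ⟪G x, mollify n G x⟫) atTop
      (𝓝 (∫ x, η x * ‖G x‖ ^ 2)) := by
    refine tendsto_integral_of_dominated_convergence (fun x => ‖G x‖) (fun n => (hi1 n).1)
      hG.norm (fun n => Eventually.of_forall fun x => ?_) ?_
    · rw [norm_mul, Real.norm_of_nonneg (hη0 x)]
      calc _ ≤ 1 * (‖G x‖ * 1) := by
            gcongr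
            · exact hη1 x
            · exact (norm_inner_le_norm _ _).trans (by gcongr; exact hGb n x)
        _ = ‖G x‖ := by ring
    · filter_upwards [ae_tendsto_mollify hG.locallyIntegrable] with x hx
      rw [← real_inner_self_eq_norm_sq]
      exact (tendsto_const_nhds.inner hx).const_mul _
  exact le_of_tendsto hlim hbound

theorem IsTestFunction.mono {D D' : Set Plane} {φ : Plane → ℝ} (h : IsTestFunction D φ)
    (hD : D ⊆ D') : IsTestFunction D' φ :=
  ⟨h.smooth, h.compactSupport, h.support_subset.trans hD⟩

theorem measurableSet_exteriorDomain : MeasurableSet exteriorDomain :=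
  measurableSet_closedBall.compl

theorem mem_exteriorDomain {x : Plane} : x ∈ exteriorDomain ↔ 1 < ‖x‖ := by
  simp [exteriorDomain]

theorem ball_subset_exteriorDomain {a : Plane} {r : ℝ} (ha : r + 1 ≤ ‖a‖) :
    ball a r ⊆ exteriorDomain := by
  intro x hx
  rw [mem_ball, dist_comm, dist_eq_norm] at hx
  rw [mem_exteriorDomain]
  linarith [norm_sub_norm_le a x]

theorem IsNormalizedSolution.ae_norm_grad_le {p : ℝ≥0∞} {C₀ : ℝ} {W : Plane → Plane}
    {u : Plane → ℝ} {G : Plane → Plane} (H : IsNormalizedSolution p C₀ W u G) :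
    ∀ᵐ x ∂volume.restrict exteriorDomain, ‖G x‖ ≤ 1 := by
  have h := H.grad_le
  rw [eLpNorm_exponent_top] at h
  filter_upwards [enorm_ae_le_eLpNormEssSup G (volume.restrict exteriorDomain)] with x hx
  have := hx.trans h
  rwa [← ofReal_norm, ENNReal.ofReal_le_one] at this

theorem exists_setLIntegral_sq_enorm_grad_le {p : ℝ≥0∞} (hp : 2 < p) :
    ∃ K : ℝ, 0 < K ∧ ∀ (C₀ : ℝ) (W : Plane → Plane) (u : Plane → ℝ) (G : Plane → Plane),
      IsNormalizedSolution p C₀ W u G → ∀ a : Plane, 2 ≤ ‖a‖ → ∀ ε : ℝ, 0 ≤ ε →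
        (∀ᵐ x ∂volume.restrict (ball a 1), ‖u x‖ ≤ ε) →
          ∫⁻ x in ball a (1 / 2), ‖G x‖ₑ ^ 2 ≤ ENNReal.ofReal (K * ε) := by
  let b : ContDiffBump (0 : Plane) := ⟨1 / 2, 3 / 4, by norm_num, by norm_num⟩
  obtain ⟨C, hC⟩ := (b.hasCompactSupport.fderiv ℝ).exists_bound_of_continuous
    (b.contDiff.continuous_fderiv (n := ∞) (by simp))
  have hC0 : 0 ≤ C := (norm_nonneg _).trans (hC 0)
  set V := volume (ball (0 : Plane) 1) with hV
  have hVtop : V ≠ ⊤ := measure_ball_lt_top.ne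
  have hVa : ∀ a : Plane, volume (ball a 1) = V := fun a => Measure.addHaar_ball_center _ a 1
  have hexp : (0 : ℝ) ≤ 1 / (1 : ℝ≥0∞).toReal - 1 / p.toReal := by
    rcases eq_or_ne p ⊤ with rfl | hpt
    · simp
    · have := (ENNReal.toReal_lt_toReal (by simp) hpt).2 hp
      simp only [ENNReal.toReal_ofNat] at this
      rw [ENNReal.toReal_one, sub_nonneg, div_le_div_iff₀ (by linarith) one_pos]
      linarith
  -- Hölder's factor for passing from `L^p` to `L¹` on a unit ball; it does not depend on the
  -- centre.
  set L := V ^ (1 / (1 : ℝ≥0∞).toReal - 1 / p.toReal) with hL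
  have hLtop : L ≠ ⊤ := ENNReal.rpow_ne_top_of_nonneg hexp hVtop
  refine ⟨C * V.toReal + L.toReal + 1, by positivity, fun C₀ W u G H a ha ε hε huε => ?_⟩
  have hBD : ball a 1 ⊆ exteriorDomain := ball_subset_exteriorDomain (by linarith)
  have hrestr : volume.restrict (ball a 1) ≤ volume.restrict exteriorDomain :=
    Measure.restrict_mono hBD le_rfl
  have hmB : MeasurableSet (ball a (1 : ℝ)) := measurableSet_ball
  have hum : AEStronglyMeasurable u (volume.restrict (ball a 1)) :=
    (H.solution.weakGradient.locInt.aestronglyMeasurable).mono_measure hrestr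
  have hGm : AEStronglyMeasurable G (volume.restrict (ball a 1)) :=
    (H.solution.weakGradient.locInt_grad.aestronglyMeasurable).mono_measure hrestr
  have hWm : AEStronglyMeasurable W (volume.restrict (ball a 1)) :=
    H.drift_memLp.1.mono_measure hrestr
  have hG1 : ∀ᵐ x ∂volume.restrict (ball a 1), ‖G x‖ ≤ 1 :=
    ae_mono hrestr H.ae_norm_grad_le
  have hWL : ∫⁻ x in ball a 1, ‖W x‖ₑ ≤ L := by
    rw [← eLpNorm_one_eq_lintegral_enorm]
    refine (eLpNorm_le_eLpNorm_mul_rpow_measure_univ (q := p)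
      ((by norm_num : (1 : ℝ≥0∞) ≤ 2).trans hp.le) hWm).trans ?_
    rw [Measure.restrict_apply_univ, hVa]
    calc _ ≤ 1 * L := by
          gcongr
          exact (eLpNorm_mono_measure _ hrestr).trans H.drift_le
      _ = L := one_mul _
  have hWi : IntegrableOn W (ball a 1) := ⟨hWm, hWL.trans_lt hLtop.lt_top⟩
  have hui : IntegrableOn u (ball a 1) :=
    ⟨hum, HasFiniteIntegral.restrict_of_bounded (C := ε) measure_ball_lt_top huε⟩
  have hGi : IntegrableOn G (ball a 1) :=
    ⟨hGm, HasFiniteIntegral.restrict_of_bounded (C := 1) measure_ball_lt_top hG1⟩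
  set B := ball a (1 : ℝ) with hB
  -- All functions are extended by zero outside the unit ball, which changes neither identity for
  -- test functions supported in that ball.
  have hind : ∀ {F : Type} [NormedAddCommGroup F] (f : Plane → F) (c : ℝ), 0 ≤ c →
      (∀ᵐ x ∂volume.restrict B, ‖f x‖ ≤ c) → ∀ᵐ x, ‖B.indicator f x‖ ≤ c := by
    intro F _ f c hc h
    filter_upwards [(ae_restrict_iff' hmB).1 h] with x hx
    by_cases hxB : x ∈ B
    · rw [Set.indicator_of_mem hxB]
      exact hx hxB
    · rw [Set.indicator_of_notMem hxB]
      simpa using hc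
  have hparts : ∀ φ : Plane → ℝ, IsTestFunction B φ →
      ∫ x, B.indicator u x • ∇ φ x = -∫ x, φ x • B.indicator G x := by
    intro φ hφ
    have h := H.solution.weakGradient.byParts φ (hφ.mono hBD)
    have h0 : ∀ x, x ∉ B → φ x = 0 := fun x hx =>
      image_eq_zero_of_notMem_tsupport fun h => hx (hφ.support_subset h)
    have h1 : ∀ x, x ∉ B → ∇ φ x = 0 := fun x hx =>
      gradient_eq_zero_of_notMem_tsupport fun h => hx (hφ.support_subset h)
    rw [setIntegral_eq_integral_of_forall_compl_eq_zero fun x hx => by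
        rw [h1 x fun h => hx (hBD h), smul_zero],
      setIntegral_eq_integral_of_forall_compl_eq_zero fun x hx => by
        rw [h0 x fun h => hx (hBD h), zero_smul]] at h
    convert h using 3 with x
    · by_cases hx : x ∈ B
      · simp [hx]
      · simp [h1 x hx]
    · funext x
      by_cases hx : x ∈ B
      · simp [hx]
      · simp [h0 x hx]
  have heq : ∀ φ : Plane → ℝ, IsTestFunction B φ →
      ∫ x, (⟪B.indicator G x, ∇ φ x⟫ + ⟪B.indicator W x, B.indicator G x⟫ * φ x) = 0 := by
    intro φ hφ
    have h := H.solution.equation φ (hφ.mono hBD)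
    have h0 : ∀ x, x ∉ B → φ x = 0 := fun x hx =>
      image_eq_zero_of_notMem_tsupport fun h => hx (hφ.support_subset h)
    have h1 : ∀ x, x ∉ B → ∇ φ x = 0 := fun x hx =>
      gradient_eq_zero_of_notMem_tsupport fun h => hx (hφ.support_subset h)
    rw [setIntegral_eq_integral_of_forall_compl_eq_zero fun x hx => by
        rw [h1 x fun h => hx (hBD h), h0 x fun h => hx (hBD h)]; simp] at h
    convert h using 2
    funext x
    by_cases hx : x ∈ B
    · simp [hx]
    · simp [h0 x hx, h1 x hx]
  have htrans : ContDiff ℝ ∞ fun x : Plane => x - a := contDiff_id.sub contDiff_const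
  have hηs : tsupport (fun x => b (x - a)) ⊆ closedBall a (3 / 4) := by
    refine closure_minimal (fun x hx => ?_) isClosed_closedBall
    have : x - a ∈ Function.support b := hx
    rw [b.support_eq, mem_ball_zero_iff] at this
    rw [mem_closedBall, dist_eq_norm]
    exact this.le
  have hηC : ∀ x, ‖fderiv ℝ (fun x => b (x - a)) x‖ ≤ C := by
    intro x
    rw [fderiv_comp_sub]
    exact hC _
  have main := integral_sq_norm_le_of_weak_solution (a := a) (η := fun x => b (x - a))
    ((integrable_indicator_iff hmB).2 hui) ((integrable_indicator_iff hmB).2 hGi)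
    ((integrable_indicator_iff hmB).2 hWi) hε (hind u ε hε huε) (hind G 1 zero_le_one hG1)
    (fun x hx => Set.indicator_of_notMem hx G) hparts heq (b.contDiff.comp htrans) hηs
    (fun x => b.nonneg) (fun x => b.le_one) hηC
  have hWint : ∫ x, ‖B.indicator W x‖ ≤ L.toReal := by
    simp only [norm_indicator_eq_indicator_norm]
    rw [integral_indicator hmB, integral_norm_eq_lintegral_enorm hWm]
    exact ENNReal.toReal_mono hLtop hWL
  have hint : Integrable fun x => b (x - a) * ‖B.indicator G x‖ ^ 2 := by
    refine ((integrable_indicator_iff hmB).2 hGi).norm.mono' ?_ ?_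
    · exact (b.continuous.comp htrans.continuous).aestronglyMeasurable.mul
        (((integrable_indicator_iff hmB).2 hGi).1.norm.pow 2)
    · filter_upwards [hind G 1 zero_le_one hG1] with x hx
      rw [Real.norm_of_nonneg (mul_nonneg b.nonneg (by positivity))]
      calc _ ≤ 1 * ‖B.indicator G x‖ ^ 2 := by gcongr; exact b.le_one
        _ ≤ ‖B.indicator G x‖ := by
          rw [one_mul]
          exact pow_le_of_le_one (norm_nonneg _) hx two_ne_zero
  calc ∫⁻ x in ball a (1 / 2), ‖G x‖ₑ ^ 2
      ≤ ∫⁻ x in ball a (1 / 2), ENNReal.ofReal (b (x - a) * ‖B.indicator G x‖ ^ 2) := by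
        refine setLIntegral_mono' measurableSet_ball fun x hx => ?_
        have hxB : x ∈ B := ball_subset_ball (by norm_num) hx
        have hb1 : b (x - a) = 1 := by
          refine b.one_of_mem_closedBall ?_
          rw [mem_closedBall_zero_iff, ← dist_eq_norm]
          exact (mem_ball.1 hx).le
        rw [hb1, one_mul, Set.indicator_of_mem hxB, ENNReal.ofReal_pow (norm_nonneg _), ofReal_norm]
    _ ≤ ∫⁻ x, ENNReal.ofReal (b (x - a) * ‖B.indicator G x‖ ^ 2) := setLIntegral_le_lintegral _ _
    _ = ENNReal.ofReal (∫ x, b (x - a) * ‖B.indicator G x‖ ^ 2) :=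
        (ofReal_integral_eq_lintegral_ofReal hint
          (Eventually.of_forall fun x => mul_nonneg b.nonneg (by positivity))).symm
    _ ≤ _ := by
        apply ENNReal.ofReal_le_ofReal
        refine main.trans ?_
        rw [hVa, mul_comm]
        refine mul_le_mul_of_nonneg_right ?_ hε
        linarith

/-! ### From the drift equation to the ∂̄-equation -/

/-- The identification of `ℂ` with the Euclidean plane. -/
noncomputable def complexPlane : ℂ ≃ₗᵢ[ℝ] Plane := Complex.orthonormalBasisOneI.repr

theorem complexPlane_apply_zero (z : ℂ) : complexPlane z 0 = z.re := by
  simp [complexPlane]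

theorem complexPlane_apply_one (z : ℂ) : complexPlane z 1 = z.im := by
  simp [complexPlane]

theorem measurePreserving_complexPlane : MeasurePreserving complexPlane :=
  LinearIsometryEquiv.measurePreserving complexPlane

theorem measurableEmbedding_complexPlane : MeasurableEmbedding complexPlane :=
  complexPlane.toHomeomorph.measurableEmbedding

theorem inner_complexPlane_one (x : Plane) : ⟪x, complexPlane 1⟫ = x 0 := by
  simp [PiLp.inner_apply, complexPlane_apply_zero, complexPlane_apply_one]

theorem inner_complexPlane_I (x : Plane) : ⟪x, complexPlane Complex.I⟫ = x 1 := by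
  simp [PiLp.inner_apply, complexPlane_apply_zero, complexPlane_apply_one]

theorem inner_plane (x y : Plane) : ⟪x, y⟫ = x 0 * y 0 + x 1 * y 1 := by
  simp [PiLp.inner_apply, mul_comm]

theorem IsTestFunction.fderiv_apply {D : Set Plane} {φ : Plane → ℝ} (h : IsTestFunction D φ)
    (w : Plane) : IsTestFunction D (fun x => fderiv ℝ φ x w) := by
  refine ⟨(h.smooth.fderiv_right (by simp)).clm_apply contDiff_const,
    (h.compactSupport.fderiv ℝ).comp_left (g := fun L : Plane →L[ℝ] ℝ => L w) (by simp), ?_⟩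
  refine (closure_mono fun x hx => ?_).trans ((tsupport_fderiv_subset ℝ).trans h.support_subset)
  intro h0
  exact hx (by simp [h0])

theorem integrableOn_mul_of_locallyIntegrableOn {D : Set Plane} {f φ : Plane → ℝ}
    (hf : LocallyIntegrableOn f D) (hφ : Continuous φ) (hc : HasCompactSupport φ)
    (hs : tsupport φ ⊆ D) : Integrable fun x => f x * φ x := by
  have h1 : IntegrableOn (fun x => f x * φ x) (tsupport φ) :=
    (hf.integrableOn_compact_subset hs hc.isCompact).mul_continuousOn hφ.continuousOn hc.isCompact
  refine (integrableOn_iff_integrable_of_support_subset fun x hx => ?_).1 h1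
  refine subset_tsupport _ fun h0 => hx ?_
  simp [h0]

/-- Use the two directional derivatives of `φ` as test functions for the weak gradient; the
resulting integrals agree because second derivatives of `φ` commute. -/
theorem IsWeakGradient.integral_curl_eq_zero {D : Set Plane} {u : Plane → ℝ} {G : Plane → Plane}
    (H : IsWeakGradient D u G) {φ : Plane → ℝ} (hφ : IsTestFunction D φ) (w w' : Plane) :
    ∫ x in D, (⟪G x, w⟫ * fderiv ℝ φ x w' - ⟪G x, w'⟫ * fderiv ℝ φ x w) = 0 := by
  have hcomp : ∀ ψ : Plane → ℝ, IsTestFunction D ψ → ∀ w : Plane,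
      IntegrableOn (fun x => ⟪G x, w⟫ * ψ x) D ∧
        ∫ x in D, u x * fderiv ℝ ψ x w = -∫ x in D, ⟪G x, w⟫ * ψ x := by
    intro ψ hψ w
    have h0 : ∀ x, x ∉ D → ψ x = 0 := fun x hx =>
      image_eq_zero_of_notMem_tsupport fun h => hx (hψ.support_subset h)
    have h1 : ∀ x, x ∉ D → ∇ ψ x = 0 := fun x hx =>
      gradient_eq_zero_of_notMem_tsupport fun h => hx (hψ.support_subset h)
    have hi1 : Integrable fun x => u x • ∇ ψ x := by
      have hi : IntegrableOn (fun x => u x • ∇ ψ x) (tsupport ψ) :=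
        (H.locInt.integrableOn_compact_subset hψ.support_subset
          hψ.compactSupport.isCompact).smul_continuousOn (continuous_gradient hψ.smooth).continuousOn
          hψ.compactSupport.isCompact
      refine (integrableOn_iff_integrable_of_support_subset fun x hx => ?_).1 hi
      by_contra h
      exact hx (by simp [gradient_eq_zero_of_notMem_tsupport h])
    have hi2 : Integrable fun x => ψ x • G x := by
      have hi : IntegrableOn (fun x => ψ x • G x) (tsupport ψ) :=
        (H.locInt_grad.integrableOn_compact_subset hψ.support_subset
          hψ.compactSupport.isCompact).continuousOn_smul hψ.smooth.continuous.continuousOn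
          hψ.compactSupport.isCompact
      refine (integrableOn_iff_integrable_of_support_subset fun x hx => ?_).1 hi
      refine subset_tsupport _ fun h0 => hx ?_
      simp [h0]
    have e1 : ∀ x, ⟪w, u x • ∇ ψ x⟫ = u x * fderiv ℝ ψ x w := fun x => by
      rw [real_inner_smul_right, real_inner_comm, inner_gradient_left]
    have e2 : ∀ x, ⟪w, ψ x • G x⟫ = ⟪G x, w⟫ * ψ x := fun x => by
      rw [real_inner_smul_right, real_inner_comm, mul_comm]
    have hP := congrArg (fun v => ⟪w, v⟫) (H.byParts ψ hψ)
    simp only [inner_neg_right] at hP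
    rw [← integral_inner hi1.integrableOn, ← integral_inner hi2.integrableOn] at hP
    simp only [e1, e2] at hP
    refine ⟨?_, hP⟩
    have := (hi2.inner_const (𝕜 := ℝ) w).integrableOn (s := D)
    refine this.congr (Eventually.of_forall fun x => ?_)
    change ⟪ψ x • G x, w⟫ = _
    rw [real_inner_smul_left, mul_comm]
  obtain ⟨i1, h1⟩ := hcomp _ (hφ.fderiv_apply w') w
  obtain ⟨i2, h2⟩ := hcomp _ (hφ.fderiv_apply w) w'
  have hsymm : ∀ x, fderiv ℝ (fun x => fderiv ℝ φ x w') x w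
      = fderiv ℝ (fun x => fderiv ℝ φ x w) x w' := by
    intro x
    have hd : DifferentiableAt ℝ (fderiv ℝ φ) x :=
      (hφ.smooth.fderiv_right (m := ∞) (by simp)).differentiable (by simp) x
    have hs : IsSymmSndFDerivAt ℝ φ x :=
      (hφ.smooth.contDiffAt).isSymmSndFDerivAt (by
        simp only [minSmoothness_of_isRCLikeNormedField]
        exact WithTop.coe_le_coe.2 (le_top (a := (2 : ℕ∞))))
    have hv : ∀ v v', fderiv ℝ (fun x => fderiv ℝ φ x v) x v' = fderiv ℝ (fderiv ℝ φ) x v' v := by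
      intro v v'
      rw [fderiv_clm_apply hd (differentiableAt_const v)]
      simp
    rw [hv, hv]
    exact hs.eq w w'
  simp only [hsymm] at h1
  rw [integral_sub i1 i2, sub_eq_zero, ← neg_inj, ← h1, ← h2]

theorem dbar_ofReal {ψ : ℂ → ℝ} {z : ℂ} (hψ : DifferentiableAt ℝ ψ z) :
    dbar (fun z => (ψ z : ℂ)) z
      = ((fderiv ℝ ψ z 1 : ℝ) + Complex.I * (fderiv ℝ ψ z Complex.I : ℝ)) / 2 := by
  have h : HasFDerivAt (fun z => (ψ z : ℂ)) (Complex.ofRealCLM.comp (fderiv ℝ ψ z)) z :=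
    Complex.ofRealCLM.hasFDerivAt.comp z hψ.hasFDerivAt
  rw [dbar, h.fderiv]
  simp

theorem dbar_eq_re_add_im {φ : ℂ → ℂ} {z : ℂ} (hφ : DifferentiableAt ℝ φ z) :
    dbar φ z = dbar (fun z => ((φ z).re : ℂ)) z + Complex.I * dbar (fun z => ((φ z).im : ℂ)) z := by
  have h1 : HasFDerivAt (fun z => (φ z).re) (Complex.reCLM.comp (fderiv ℝ φ z)) z :=
    Complex.reCLM.hasFDerivAt.comp z hφ.hasFDerivAt
  have h2 : HasFDerivAt (fun z => (φ z).im) (Complex.imCLM.comp (fderiv ℝ φ z)) z :=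
    Complex.imCLM.hasFDerivAt.comp z hφ.hasFDerivAt
  rw [dbar_ofReal h1.differentiableAt, dbar_ofReal h2.differentiableAt, h1.fderiv, h2.fderiv, dbar]
  simp only [ContinuousLinearMap.comp_apply, Complex.reCLM_apply, Complex.imCLM_apply]
  conv_lhs => rw [← Complex.re_add_im (fderiv ℝ φ z 1), ← Complex.re_add_im (fderiv ℝ φ z Complex.I)]
  ring

/-- Take `v = G₀ - i G₁` and `α = (W·G) / (2 v)`. For real `ψ` the real part of `2 v ∂ψ/∂z̄` is
`G·∇ψ`, governed by the equation, and the imaginary part is the curl expression, whose integral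
vanishes. Both functions are cut off to `U`. -/
theorem IsNormalizedSolution.exists_isWeakDbarSolution {p : ℝ≥0∞} {C₀ : ℝ} {W : Plane → Plane}
    {u : Plane → ℝ} {G : Plane → Plane} (H : IsNormalizedSolution p C₀ W u G) {U : Set ℂ}
    (hUm : MeasurableSet U) (hU : ∀ z ∈ U, 1 < ‖z‖) (hUb : volume U ≠ ⊤) (hp : 1 ≤ p) :
    ∃ α v : ℂ → ℂ, AEStronglyMeasurable v ∧ (∀ᵐ z, ‖v z‖ ≤ 1) ∧ Integrable α ∧
      eLpNorm α p volume ≤ 1 ∧ (∀ z, z ∉ U → α z = 0) ∧ IsWeakDbarSolution U α v ∧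
      ∀ z ∈ U, ‖v z‖ = ‖G (complexPlane z)‖ := by
  set e := complexPlane with he
  have hUD : U ⊆ e ⁻¹' exteriorDomain := fun z hz => by
    rw [Set.mem_preimage, mem_exteriorDomain, e.norm_map]
    exact hU z hz
  have hmp : MeasurePreserving e (volume.restrict (e ⁻¹' exteriorDomain))
      (volume.restrict exteriorDomain) :=
    measurePreserving_complexPlane.restrict_preimage measurableSet_exteriorDomain
  have hrU : volume.restrict U ≤ volume.restrict (e ⁻¹' exteriorDomain) :=
    Measure.restrict_mono hUD le_rfl
  have hGm : AEStronglyMeasurable (fun z => G (e z)) (volume.restrict U) :=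
    (H.solution.weakGradient.locInt_grad.aestronglyMeasurable.comp_measurePreserving hmp).mono_measure
      hrU
  have hWm : AEStronglyMeasurable (fun z => W (e z)) (volume.restrict U) :=
    (H.drift_memLp.1.comp_measurePreserving hmp).mono_measure hrU
  have hG1 : ∀ᵐ z ∂volume.restrict U, ‖G (e z)‖ ≤ 1 :=
    ae_mono hrU (hmp.quasiMeasurePreserving.ae H.ae_norm_grad_le)
  have hWp : eLpNorm (fun z => W (e z)) p (volume.restrict U) ≤ 1 := by
    refine (eLpNorm_mono_measure _ hrU).trans (le_trans (le_of_eq ?_) H.drift_le)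
    exact eLpNorm_comp_measurePreserving H.drift_memLp.1 hmp
  set V : ℂ → ℂ := fun z => (G (e z) 0 : ℂ) - Complex.I * (G (e z) 1 : ℂ) with hV
  set w : ℂ → ℂ := fun z => ((⟪W (e z), G (e z)⟫ : ℝ) : ℂ) with hw
  have hcoord : ∀ i : Fin 2, Continuous fun x : Plane => x i := fun i => by fun_prop
  have hVm : AEStronglyMeasurable V (volume.restrict U) :=
    (Complex.continuous_ofReal.comp_aestronglyMeasurable
      ((hcoord 0).comp_aestronglyMeasurable hGm)).sub
      ((Complex.continuous_ofReal.comp_aestronglyMeasurable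
        ((hcoord 1).comp_aestronglyMeasurable hGm)).const_mul _)
  have hwm : AEStronglyMeasurable w (volume.restrict U) :=
    Complex.continuous_ofReal.comp_aestronglyMeasurable (hWm.inner hGm)
  have hVn : ∀ z, ‖V z‖ = ‖G (e z)‖ := by
    intro z
    rw [EuclideanSpace.norm_eq, Complex.norm_def, Complex.normSq_apply]
    simp [hV, Fin.sum_univ_two, pow_two]
  -- Where `V` vanishes so does `G`, hence also `W·G`; the value `0` given to the quotient there is
  -- therefore harmless.
  set A : ℂ → ℂ := fun z => w z / (2 * V z) with hA
  have hAm : AEStronglyMeasurable A (volume.restrict U) :=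
    (hwm.aemeasurable.div (hVm.aemeasurable.const_mul 2)).aestronglyMeasurable
  have hAV : ∀ z, A z * V z = w z / 2 := by
    intro z
    by_cases h : V z = 0
    · have : G (e z) = 0 := by rw [← norm_eq_zero, ← hVn, h, norm_zero]
      simp [hw, h, this]
    · simp only [hA]
      field_simp
  have hAn : ∀ z, ‖A z‖ ≤ ‖W (e z)‖ := by
    intro z
    simp only [hA]
    rw [norm_div, norm_mul, hVn]
    have h1 : ‖w z‖ ≤ ‖W (e z)‖ * ‖G (e z)‖ := by
      simp only [hw, Complex.norm_real]
      exact norm_inner_le_norm _ _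
    refine div_le_of_le_mul₀ (by positivity) (norm_nonneg _) (h1.trans ?_)
    rw [Complex.norm_ofNat]
    nlinarith [mul_nonneg (norm_nonneg (W (e z))) (norm_nonneg (G (e z)))]
  have hAp : eLpNorm A p (volume.restrict U) ≤ 1 := (eLpNorm_mono hAn).trans hWp
  have : IsFiniteMeasure (volume.restrict U) :=
    ⟨by rw [Measure.restrict_apply_univ]; exact hUb.lt_top⟩
  have hAi : IntegrableOn A U :=
    (show MemLp A p (volume.restrict U) from ⟨hAm, hAp.trans_lt ENNReal.one_lt_top⟩).integrable hp
  refine ⟨U.indicator A, U.indicator V, (aestronglyMeasurable_indicator_iff hUm).2 hVm, ?_,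
    (integrable_indicator_iff hUm).2 hAi, ?_, fun z hz => Set.indicator_of_notMem hz _, ?_,
    fun z hz => ?_⟩
  · filter_upwards [(ae_restrict_iff' hUm).1 hG1] with z hz
    by_cases h : z ∈ U
    · rw [Set.indicator_of_mem h, hVn]
      exact hz h
    · simp [h]
  · rwa [eLpNorm_indicator_eq_eLpNorm_restrict hUm]
  · have hv : AEStronglyMeasurable (U.indicator V) :=
      (aestronglyMeasurable_indicator_iff hUm).2 hVm
    have hα : Integrable (U.indicator A) := (integrable_indicator_iff hUm).2 hAi
    have hv1 : ∀ᵐ z, ‖U.indicator V z‖ ≤ 1 := by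
      filter_upwards [(ae_restrict_iff' hUm).1 hG1] with z hz
      by_cases h : z ∈ U
      · rw [Set.indicator_of_mem h, hVn]
        exact hz h
      · simp [h]
    have hint1 : ∀ φ : ℂ → ℂ, ContDiff ℝ ∞ φ → HasCompactSupport φ →
        Integrable fun z => U.indicator V z * dbar φ z := fun φ hφ hc =>
      integrable_mul_of_bounded hv hv1 hφ.dbar.continuous hc.dbar
    have hint2 : ∀ φ : ℂ → ℂ, ContDiff ℝ ∞ φ → HasCompactSupport φ →
        Integrable fun z => U.indicator A z * U.indicator V z * φ z := fun φ hφ hc => by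
      obtain ⟨C, hC⟩ := hc.exists_bound_of_continuous hφ.continuous
      exact (hα.mul_bdd hv hv1).mul_bdd hφ.continuous.aestronglyMeasurable
        (Eventually.of_forall hC)
    -- Real test functions suffice, because the weak identity is complex linear in the test
    -- function.
    have hreal : ∀ ψ : ℂ → ℝ, ContDiff ℝ ∞ ψ → HasCompactSupport ψ → tsupport ψ ⊆ U →
        ∫ z, (U.indicator V z * dbar (fun z => (ψ z : ℂ)) z
          + U.indicator A z * U.indicator V z * (ψ z : ℂ)) = 0 := by
      intro ψ hψ hc hs
      set Ψ : Plane → ℝ := fun x => ψ (e.symm x) with hΨ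
      have hsup : tsupport Ψ = e.symm ⁻¹' tsupport ψ :=
        tsupport_comp_eq_preimage ψ e.symm.toHomeomorph
      have htest : IsTestFunction exteriorDomain Ψ := by
        refine ⟨hψ.comp e.symm.contDiff, hc.comp_homeomorph e.symm.toHomeomorph, ?_⟩
        rw [hsup]
        intro x hx
        have := hUD (hs hx)
        simpa using this
      have hfd : ∀ z v, fderiv ℝ Ψ (e z) (e v) = fderiv ℝ ψ z v := by
        intro z v
        have h1 : HasFDerivAt (fun x => ψ (e.symm x))
            ((fderiv ℝ ψ z).comp (e.symm.toContinuousLinearEquiv : Plane →L[ℝ] ℂ)) (e z) := by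
          have h2 : HasFDerivAt ψ (fderiv ℝ ψ z) (e.symm (e z)) := by
            rw [e.symm_apply_apply]
            exact (hψ.differentiable (by simp) z).hasFDerivAt
          exact h2.comp (e z) e.symm.toContinuousLinearEquiv.hasFDerivAt
        rw [hΨ, h1.fderiv]
        simp
      have h0 : ∀ x, x ∉ exteriorDomain → Ψ x = 0 := fun x hx =>
        image_eq_zero_of_notMem_tsupport fun h => hx (htest.support_subset h)
      have h1 : ∀ x, x ∉ exteriorDomain → ∇ Ψ x = 0 := fun x hx =>
        gradient_eq_zero_of_notMem_tsupport fun h => hx (htest.support_subset h)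
      have h1' : ∀ x, x ∉ exteriorDomain → fderiv ℝ Ψ x = 0 := fun x hx => by
        by_contra h
        exact hx (htest.support_subset (support_fderiv_subset ℝ h))
      have E1 := H.solution.equation Ψ htest
      have E2 := H.solution.weakGradient.integral_curl_eq_zero htest (e 1) (e Complex.I)
      rw [setIntegral_eq_integral_of_forall_compl_eq_zero fun x hx => by
        rw [h1 x hx, h0 x hx]; simp] at E1
      rw [setIntegral_eq_integral_of_forall_compl_eq_zero fun x hx => by
        rw [h1' x hx]; simp] at E2
      rw [← measurePreserving_complexPlane.integral_comp measurableEmbedding_complexPlane] at E1 E2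
      have hgr : ∀ z, ⟪G (e z), ∇ Ψ (e z)⟫
          = G (e z) 0 * fderiv ℝ ψ z 1 + G (e z) 1 * fderiv ℝ ψ z Complex.I := by
        intro z
        rw [inner_plane, ← hfd z 1, ← hfd z Complex.I, ← inner_gradient_left, ← inner_gradient_left,
          he, inner_complexPlane_one, inner_complexPlane_I]
      have hψe : ∀ z, Ψ (e z) = ψ z := fun z => by simp [hΨ]
      have hE1 : ∫ z, (G (e z) 0 * fderiv ℝ ψ z 1 + G (e z) 1 * fderiv ℝ ψ z Complex.I
          + ⟪W (e z), G (e z)⟫ * ψ z) = 0 := by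
        rw [← E1]
        refine integral_congr_ae (Eventually.of_forall fun z => ?_)
        change _ = ⟪G (e z), ∇ Ψ (e z)⟫ + ⟪W (e z), G (e z)⟫ * Ψ (e z)
        rw [hgr, hψe]
      have hE2 : ∫ z, (G (e z) 0 * fderiv ℝ ψ z Complex.I - G (e z) 1 * fderiv ℝ ψ z 1) = 0 := by
        rw [← E2]
        refine integral_congr_ae (Eventually.of_forall fun z => ?_)
        change _ = ⟪G (e z), e 1⟫ * fderiv ℝ Ψ (e z) (e Complex.I)
          - ⟪G (e z), e Complex.I⟫ * fderiv ℝ Ψ (e z) (e 1)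
        rw [hfd, hfd, he, inner_complexPlane_one, inner_complexPlane_I]
      have hz0 : ∀ z, z ∉ U → ψ z = 0 ∧ fderiv ℝ ψ z = 0 := by
        intro z hz
        refine ⟨image_eq_zero_of_notMem_tsupport fun h => hz (hs h), ?_⟩
        by_contra h
        exact hz (hs (support_fderiv_subset ℝ h))
      have hpt : ∀ z, U.indicator V z * dbar (fun z => (ψ z : ℂ)) z
          + U.indicator A z * U.indicator V z * (ψ z : ℂ)
          = (1 / 2 : ℂ) * ((G (e z) 0 * fderiv ℝ ψ z 1 + G (e z) 1 * fderiv ℝ ψ z Complex.I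
              + ⟪W (e z), G (e z)⟫ * ψ z : ℝ) : ℂ)
            + (Complex.I / 2) * ((G (e z) 0 * fderiv ℝ ψ z Complex.I
              - G (e z) 1 * fderiv ℝ ψ z 1 : ℝ) : ℂ) := by
        intro z
        by_cases hz : z ∈ U
        · rw [Set.indicator_of_mem hz, Set.indicator_of_mem hz, hAV,
            dbar_ofReal (hψ.differentiable (by simp) z)]
          simp only [hV, hw]
          push_cast
          linear_combination (-(G (e z) 1 : ℂ) * (fderiv ℝ ψ z Complex.I : ℝ) / 2) * Complex.I_sq
        · simp [hz, (hz0 z hz).1, (hz0 z hz).2]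
      have hfdc : ∀ v, Continuous fun z => fderiv ℝ ψ z v := fun v =>
        (hψ.continuous_fderiv (by simp)).clm_apply continuous_const
      have hfds : ∀ v, HasCompactSupport fun z => fderiv ℝ ψ z v := fun v =>
        (hc.fderiv ℝ).comp_left (g := fun L : ℂ →L[ℝ] ℝ => L v) (by simp)
      have hGψ : ∀ (i : Fin 2) (v : ℂ), Integrable fun z => G (e z) i * fderiv ℝ ψ z v := by
        intro i v
        have hb : Integrable fun z => U.indicator (fun z => G (e z) i) z * fderiv ℝ ψ z v := by
          refine ((hfdc v).integrable_of_hasCompactSupport (hfds v)).bdd_mul (c := 1)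
            ((aestronglyMeasurable_indicator_iff hUm).2 ((hcoord i).comp_aestronglyMeasurable hGm)) ?_
          filter_upwards [(ae_restrict_iff' hUm).1 hG1] with z hz
          by_cases h : z ∈ U
          · rw [Set.indicator_of_mem h]
            exact (PiLp.norm_apply_le _ i).trans (hz h)
          · simp [h]
        refine hb.congr (Eventually.of_forall fun z => ?_)
        by_cases h : z ∈ U
        · simp [h]
        · simp [h, (hz0 z h).2]
      have hwψ : Integrable fun z => ⟪W (e z), G (e z)⟫ * ψ z := by
        have h2 := integrableOn_mul_of_locallyIntegrableOn H.solution.locInt_drift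
          htest.smooth.continuous htest.compactSupport htest.support_subset
        have h3 := (measurePreserving_complexPlane.integrable_comp_emb
          measurableEmbedding_complexPlane).2 h2
        refine h3.congr (Eventually.of_forall fun z => ?_)
        change ⟪W (e z), G (e z)⟫ * Ψ (e z) = _
        rw [hψe]
      simp only [hpt]
      rw [integral_add, integral_const_mul, integral_const_mul, integral_complex_ofReal, integral_complex_ofReal,
        hE1, hE2]
      · simp
      · exact (((hGψ 0 1).add (hGψ 1 Complex.I)).add hwψ).ofReal.const_mul _
      · exact ((hGψ 0 Complex.I).sub (hGψ 1 1)).ofReal.const_mul _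
    intro φ hφ hc hs
    have hre : ContDiff ℝ ∞ fun z => (φ z).re := Complex.reCLM.contDiff.comp hφ
    have him : ContDiff ℝ ∞ fun z => (φ z).im := Complex.imCLM.contDiff.comp hφ
    have hrec : HasCompactSupport fun z => (φ z).re := hc.comp_left (g := Complex.re) rfl
    have himc : HasCompactSupport fun z => (φ z).im := hc.comp_left (g := Complex.im) rfl
    have hres : tsupport (fun z => (φ z).re) ⊆ U :=
      (closure_mono fun z (hz : (φ z).re ≠ 0) (h : φ z = 0) => hz (by simp [h])).trans hs
    have hims : tsupport (fun z => (φ z).im) ⊆ U :=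
      (closure_mono fun z (hz : (φ z).im ≠ 0) (h : φ z = 0) => hz (by simp [h])).trans hs
    have hreC : ContDiff ℝ ∞ fun z => ((φ z).re : ℂ) := Complex.ofRealCLM.contDiff.comp hre
    have himC : ContDiff ℝ ∞ fun z => ((φ z).im : ℂ) := Complex.ofRealCLM.contDiff.comp him
    have hrecC : HasCompactSupport fun z => ((φ z).re : ℂ) :=
      hc.comp_left (g := fun w : ℂ => (w.re : ℂ)) (by simp)
    have himcC : HasCompactSupport fun z => ((φ z).im : ℂ) :=
      hc.comp_left (g := fun w : ℂ => (w.im : ℂ)) (by simp)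
    have R := hreal _ hre hrec hres
    have I := hreal _ him himc hims
    rw [← add_eq_zero_iff_eq_neg, ← integral_add (hint1 φ hφ hc) (hint2 φ hφ hc)]
    have hpt : ∀ z, U.indicator V z * dbar φ z + U.indicator A z * U.indicator V z * φ z
        = (U.indicator V z * dbar (fun z => ((φ z).re : ℂ)) z
            + U.indicator A z * U.indicator V z * ((φ z).re : ℂ))
          + Complex.I * (U.indicator V z * dbar (fun z => ((φ z).im : ℂ)) z
            + U.indicator A z * U.indicator V z * ((φ z).im : ℂ)) := by
      intro z
      rw [dbar_eq_re_add_im (hφ.differentiable (by simp) z)]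
      conv_lhs => rw [← Complex.re_add_im (φ z)]
      ring
    simp only [hpt]
    rw [integral_add, integral_const_mul, R, I]
    · simp
    · exact (hint1 _ hreC hrecC).add (hint2 _ hreC hrecC)
    · exact ((hint1 _ himC himcC).add (hint2 _ himC himcC)).const_mul _
  · rw [Set.indicator_of_mem hz, hVn]

/-! ### Pointwise bounds for weakly holomorphic functions -/

/-- This is Cauchy–Pompeiu for `F q` in dual form: test with `q` times the Cauchy transform of `ψ`,
whose ∂̄-derivative is `ψ`. -/
theorem integral_mul_mul_eq_neg_of_weakly_holomorphic {U : Set ℂ} {F q ψ : ℂ → ℂ}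
    (hF : ∀ φ : ℂ → ℂ, ContDiff ℝ ∞ φ → HasCompactSupport φ → tsupport φ ⊆ U →
      ∫ z, F z * dbar φ z = 0)
    (hq : ContDiff ℝ ∞ q) (hqc : HasCompactSupport q) (hqs : tsupport q ⊆ U)
    (hFq : Integrable fun z => F z * q z) (hFdq : Integrable fun z => F z * dbar q z)
    (hψ : ContDiff ℝ ∞ ψ) (hψc : HasCompactSupport ψ) :
    ∫ z, F z * q z * ψ z = -∫ z, F z * dbar q z * cauchyTransform ψ z := by
  have hT := hψ.cauchyTransform hψc
  have h := hF (fun z => q z * cauchyTransform ψ z) (hq.mul hT) hqc.mul_right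
    (tsupport_mul_subset_left.trans hqs)
  have hd : ∀ z, F z * dbar (fun z => q z * cauchyTransform ψ z) z
      = F z * dbar q z * cauchyTransform ψ z + F z * q z * ψ z := by
    intro z
    rw [dbar_mul (hq.differentiable (by simp) z) (hT.differentiable (by simp) z),
      dbar_cauchyTransform hψ hψc]
    ring
  simp only [hd] at h
  have i2 : Integrable fun z => F z * q z * ψ z := by
    obtain ⟨C, hC⟩ := hψc.exists_bound_of_continuous hψ.continuous
    exact hFq.mul_bdd hψ.continuous.aestronglyMeasurable (Eventually.of_forall hC)
  have i1 : Integrable fun z => F z * dbar q z * cauchyTransform ψ z := by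
    obtain ⟨C, hC⟩ := hqc.isCompact.exists_bound_of_continuousOn hT.continuous.continuousOn
    refine (hFdq.norm.const_mul C).mono' (hFdq.1.mul hT.continuous.aestronglyMeasurable)
      (Eventually.of_forall fun z => ?_)
    by_cases hz : z ∈ tsupport q
    · rw [norm_mul, mul_comm]
      gcongr
      exact hC z hz
    · simp [dbar_of_notMem_tsupport hz]
  rw [integral_add i1 i2] at h
  linear_combination h

/-- Let `ψ` be a bump concentrating at `z`. The left side of the dual formula tends to `F q` at
almost every `z`, while on the right the transform of `ψ` is at most `1` wherever `∂q/∂z̄` can be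
nonzero. -/
theorem ae_norm_mul_le_integral_of_weakly_holomorphic {U : Set ℂ} {F q : ℂ → ℂ}
    (hF : ∀ φ : ℂ → ℂ, ContDiff ℝ ∞ φ → HasCompactSupport φ → tsupport φ ⊆ U →
      ∫ z, F z * dbar φ z = 0)
    (hq : ContDiff ℝ ∞ q) (hqc : HasCompactSupport q) (hqs : tsupport q ⊆ U)
    (hFq : Integrable fun z => F z * q z) (hFdq : Integrable fun z => F z * dbar q z) :
    ∀ᵐ z, (∀ ζ, ‖ζ - z‖ < 1 / 2 → dbar q ζ = 0) → ‖F z * q z‖ ≤ ∫ ζ, ‖F ζ * dbar q ζ‖ := by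
  filter_upwards [ae_tendsto_mollify hFq.locallyIntegrable] with z hz hd
  refine le_of_tendsto hz.norm ?_
  filter_upwards [(tendsto_shrinkingBump_rOut ℂ).eventually_le_const
    (show (0 : ℝ) < 1 / 6 by norm_num)] with n hn
  set ρ := (shrinkingBump ℂ n).normed (volume : Measure ℂ) with hρ_def
  have hρ : ContDiff ℝ ∞ ρ := (shrinkingBump ℂ n).contDiff_normed
  have hρc : HasCompactSupport ρ := (shrinkingBump ℂ n).hasCompactSupport_normed
  set ψ : ℂ → ℂ := fun y => (ρ (z - y) : ℂ) with hψ_def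
  have hψ : ContDiff ℝ ∞ ψ :=
    Complex.ofRealCLM.contDiff.comp (hρ.comp (contDiff_const.sub contDiff_id))
  have hψc : HasCompactSupport ψ :=
    (hρc.comp_homeomorph (Homeomorph.subLeft z)).comp_left (g := fun x : ℝ => (x : ℂ)) rfl
  have hm : mollify n (fun z => F z * q z) z = ∫ y, F y * q y * ψ y := by
    rw [mollify]
    congr 1
    funext y
    rw [Complex.real_smul, mul_comm]
  rw [hm, integral_mul_mul_eq_neg_of_weakly_holomorphic hF hq hqc hqs hFq hFdq hψ hψc, norm_neg]
  refine norm_integral_le_of_norm_le hFdq.norm (Eventually.of_forall fun ζ => ?_)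
  rw [norm_mul]
  by_cases hζ : ‖ζ - z‖ < 1 / 2
  · simp [hd ζ hζ]
  · refine mul_le_of_le_one_right (norm_nonneg _) ?_
    have hint : Integrable fun y => ρ (z - y) * 3 :=
      ((shrinkingBump ℂ n).integrable_normed.comp_sub_left z).mul_const 3
    -- Distance at least `1/2` to `z`, less the bump radius `1/6`, leaves `1/3`. The bound `3` is
    -- then beaten by the normalisation `1/π`.
    have hb : ‖∫ y, ψ y * (ζ - y)⁻¹‖ ≤ 3 := by
      refine (norm_integral_le_of_norm_le hint (Eventually.of_forall fun y => ?_)).trans_eq ?_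
      · have h0 : 0 ≤ ρ (z - y) := ContDiffBump.nonneg_normed _ _
        rw [norm_mul, hψ_def, Complex.norm_real, Real.norm_of_nonneg h0]
        by_cases hy : (shrinkingBump ℂ n).rOut ≤ ‖z - y‖
        · rw [hρ_def, shrinkingBump_normed_eq_zero hy]
          simp
        · gcongr
          rw [norm_inv]
          have h3 : 1 / 3 ≤ ‖ζ - y‖ := by
            have := norm_sub_le_norm_sub_add_norm_sub ζ y z
            rw [norm_sub_rev y z] at this
            linarith
          exact inv_le_of_inv_le₀ (by norm_num) (by simpa using h3)
      · rw [integral_mul_const,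
          integral_sub_left_eq_self (fun y => (shrinkingBump ℂ n).normed volume y),
          ContDiffBump.integral_normed, one_mul]
    rw [cauchyTransform, norm_mul, norm_inv, Complex.norm_real, Real.norm_of_nonneg Real.pi_pos.le,
      inv_mul_le_iff₀ Real.pi_pos, mul_one]
    exact hb.trans Real.pi_gt_three.le

/-! ### Cutoffs and the weight with a zero and a pole -/

/-- A radial cutoff equal to `1` on the unit disc and supported in the disc of radius `5/4`. -/
noncomputable def unitBump : ContDiffBump (0 : ℂ) := ⟨1, 5 / 4, by norm_num, by norm_num⟩

/-- The cutoff `unitBump` rescaled to the disc of radius `1/s` about `c`. -/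
noncomputable def discCutoff (s : ℝ) (c z : ℂ) : ℂ := (unitBump (s * (z - c)) : ℂ)

section discCutoff

variable {s : ℝ} {c z : ℂ}

theorem contDiff_ofReal_unitBump : ContDiff ℝ ∞ fun z => (unitBump z : ℂ) :=
  Complex.ofRealCLM.contDiff.comp unitBump.contDiff

theorem contDiff_discCutoff (s : ℝ) (c : ℂ) : ContDiff ℝ ∞ (discCutoff s c) :=
  contDiff_ofReal_unitBump.comp (contDiff_const.mul (contDiff_id.sub contDiff_const))

theorem norm_discCutoff_le_one : ‖discCutoff s c z‖ ≤ 1 := by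
  rw [discCutoff, Complex.norm_real, Real.norm_of_nonneg unitBump.nonneg]
  exact unitBump.le_one

theorem norm_one_sub_discCutoff_le_one : ‖1 - discCutoff s c z‖ ≤ 1 := by
  have h : 1 - discCutoff s c z = ((1 - unitBump (s * (z - c)) : ℝ) : ℂ) := by
    rw [discCutoff]
    push_cast
    rfl
  rw [h, Complex.norm_real, Real.norm_of_nonneg (sub_nonneg.2 unitBump.le_one)]
  linarith [unitBump.nonneg (x := s * (z - c))]

theorem norm_ofReal_mul_sub (hs : 0 < s) : ‖(s : ℂ) * (z - c)‖ = s * ‖z - c‖ := by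
  rw [norm_mul, Complex.norm_real, Real.norm_of_nonneg hs.le]

theorem discCutoff_eq_one (hs : 0 < s) (h : s * ‖z - c‖ ≤ 1) : discCutoff s c z = 1 := by
  rw [discCutoff, unitBump.one_of_mem_closedBall]
  · simp
  · rw [mem_closedBall_zero_iff, norm_ofReal_mul_sub hs]
    exact h

theorem discCutoff_eq_zero (hs : 0 < s) (h : 5 / 4 ≤ s * ‖z - c‖) : discCutoff s c z = 0 := by
  rw [discCutoff, unitBump.zero_of_le_dist]
  · simp
  · rw [dist_zero_right, norm_ofReal_mul_sub hs]
    exact h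

theorem dbar_discCutoff : dbar (discCutoff s c) z
    = s * dbar (fun z => (unitBump z : ℂ)) (s * (z - c)) :=
  dbar_comp_sub_mul (contDiff_ofReal_unitBump.differentiable (by simp)) s c z

theorem dbar_discCutoff_eq_zero_of_lt (hs : 0 < s) (h : s * ‖z - c‖ < 1) :
    dbar (discCutoff s c) z = 0 := by
  have hev : discCutoff s c =ᶠ[𝓝 z] fun _ => 1 := by
    have : ∀ᶠ w in 𝓝 z, s * ‖w - c‖ < 1 :=
      (continuous_const.mul (continuous_id.sub continuous_const).norm).continuousAt.eventually_lt
        continuousAt_const h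
    filter_upwards [this] with w hw using discCutoff_eq_one hs hw.le
  rw [hev.dbar_eq]
  simp [dbar]

theorem dbar_discCutoff_eq_zero_of_gt (hs : 0 < s) (h : 5 / 4 < s * ‖z - c‖) :
    dbar (discCutoff s c) z = 0 := by
  have hev : discCutoff s c =ᶠ[𝓝 z] fun _ => 0 := by
    have : ∀ᶠ w in 𝓝 z, 5 / 4 < s * ‖w - c‖ :=
      continuousAt_const.eventually_lt
        (continuous_const.mul (continuous_id.sub continuous_const).norm).continuousAt h
    filter_upwards [this] with w hw using discCutoff_eq_zero hs hw.le
  rw [hev.dbar_eq]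
  simp [dbar]

theorem exists_norm_dbar_discCutoff_le : ∃ C : ℝ, 0 < C ∧ ∀ (s : ℝ) (c z : ℂ), 0 < s → s ≤ 4 →
    ‖dbar (discCutoff s c) z‖ ≤ C := by
  have hc : HasCompactSupport fun z => (unitBump z : ℂ) :=
    unitBump.hasCompactSupport.comp_left (g := fun x : ℝ => (x : ℂ)) rfl
  obtain ⟨C, hC⟩ := hc.dbar.exists_bound_of_continuous contDiff_ofReal_unitBump.dbar.continuous
  have hC0 : 0 ≤ C := (norm_nonneg _).trans (hC 0)
  refine ⟨4 * C + 1, by positivity, fun s c z hs hs4 => ?_⟩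
  rw [dbar_discCutoff, norm_mul, Complex.norm_real, Real.norm_of_nonneg hs.le]
  have := hC (s * (z - c))
  nlinarith [norm_nonneg (dbar (fun z => (unitBump z : ℂ)) (s * (z - c)))]

end discCutoff

/-- The cutoff to the annulus `1.1 ≤ |z| ≤ 5R` with a small disc about `a` removed. -/
noncomputable def annulusCutoff (R : ℝ) (a z : ℂ) : ℂ :=
  (1 - discCutoff (10 / 11) 0 z) * discCutoff (1 / (4 * R)) 0 z * (1 - discCutoff 4 a z)

theorem contDiff_annulusCutoff (R : ℝ) (a : ℂ) : ContDiff ℝ ∞ (annulusCutoff R a) :=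
  ((contDiff_const.sub (contDiff_discCutoff _ _)).mul (contDiff_discCutoff _ _)).mul
    (contDiff_const.sub (contDiff_discCutoff _ _))

theorem dbar_annulusCutoff (R : ℝ) (a z : ℂ) : dbar (annulusCutoff R a) z
    = -dbar (discCutoff (10 / 11) 0) z * discCutoff (1 / (4 * R)) 0 z * (1 - discCutoff 4 a z)
      + (1 - discCutoff (10 / 11) 0 z) * dbar (discCutoff (1 / (4 * R)) 0) z
        * (1 - discCutoff 4 a z)
      - (1 - discCutoff (10 / 11) 0 z) * discCutoff (1 / (4 * R)) 0 z * dbar (discCutoff 4 a) z := by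
  have hd : ∀ s c, DifferentiableAt ℝ (discCutoff s c) z := fun s c =>
    (contDiff_discCutoff s c).differentiable (by simp) z
  have hd1 : ∀ s c, DifferentiableAt ℝ (fun z => 1 - discCutoff s c z) z := fun s c =>
    (hd s c).const_sub 1
  unfold annulusCutoff
  rw [dbar_mul ((hd1 _ _).fun_mul (hd _ _)) (hd1 _ _), dbar_mul (hd1 _ _) (hd _ _), dbar_one_sub,
    dbar_one_sub]
  ring

theorem norm_dbar_annulusCutoff_le (R : ℝ) (a z : ℂ) : ‖dbar (annulusCutoff R a) z‖
    ≤ ‖dbar (discCutoff (10 / 11) 0) z‖ + ‖dbar (discCutoff (1 / (4 * R)) 0) z‖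
      + ‖dbar (discCutoff 4 a) z‖ := by
  rw [dbar_annulusCutoff]
  have key : ∀ x y w : ℂ, ‖y‖ ≤ 1 → ‖w‖ ≤ 1 → ‖x * y * w‖ ≤ ‖x‖ := fun x y w hy hw => by
    rw [norm_mul, norm_mul]
    calc _ ≤ ‖x‖ * 1 * 1 := by gcongr
      _ = _ := by ring
  refine (norm_sub_le _ _).trans (add_le_add ((norm_add_le _ _).trans (add_le_add ?_ ?_)) ?_)
  · rw [← norm_neg (dbar (discCutoff (10 / 11) 0) z)]
    exact key _ _ _ norm_discCutoff_le_one norm_one_sub_discCutoff_le_one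
  · rw [mul_comm (1 - _) (dbar _ z)]
    exact key _ _ _ norm_one_sub_discCutoff_le_one norm_one_sub_discCutoff_le_one
  · rw [mul_comm, ← mul_assoc]
    exact key _ _ _ norm_one_sub_discCutoff_le_one norm_discCutoff_le_one

/-- The rational weight `z ^ m / (z - a) ^ k`. -/
noncomputable def poleWeight (m k : ℕ) (a z : ℂ) : ℂ := z ^ m * ((z - a)⁻¹) ^ k

theorem dbar_poleWeight {m k : ℕ} {a z : ℂ} (hz : z ≠ a) : dbar (poleWeight m k a) z = 0 := by
  apply dbar_eq_zero_of_differentiableAt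
  unfold poleWeight
  exact (differentiableAt_id.pow m).mul
    (((differentiableAt_id.sub_const a).inv (sub_ne_zero.2 hz)).pow k)

theorem contDiffAt_poleWeight {m k : ℕ} {a z : ℂ} (hz : z ≠ a) :
    ContDiffAt ℝ ∞ (poleWeight m k a) z := by
  unfold poleWeight
  exact (contDiffAt_id.pow m).mul
    (((contDiffAt_id.sub contDiffAt_const).inv (sub_ne_zero.2 hz)).pow k)

theorem norm_poleWeight {m k : ℕ} {a z : ℂ} : ‖poleWeight m k a z‖ = ‖z‖ ^ m / ‖z - a‖ ^ k := by
  rw [poleWeight, norm_mul, norm_pow, norm_pow, norm_inv, inv_pow, div_eq_mul_inv]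

section annulusCutoff

variable {R : ℝ} {a z : ℂ} {m k : ℕ}

theorem annulusCutoff_eventuallyEq_zero : annulusCutoff R a =ᶠ[𝓝 a] fun _ => 0 := by
  have : ∀ᶠ w in 𝓝 a, ‖w - a‖ < 1 / 4 := by
    filter_upwards [ball_mem_nhds a (show (0 : ℝ) < 1 / 4 by norm_num)] with w hw
    rwa [← dist_eq_norm]
  filter_upwards [this] with w hw
  rw [annulusCutoff, discCutoff_eq_one (s := 4) (by norm_num) (by linarith)]
  ring

/-- The pole does no harm, because the cutoff vanishes identically near `a`. -/
theorem contDiff_annulusCutoff_mul_poleWeight :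
    ContDiff ℝ ∞ fun z => annulusCutoff R a z * poleWeight m k a z := by
  rw [contDiff_iff_contDiffAt]
  intro z
  by_cases hz : z = a
  · subst hz
    refine (contDiffAt_const (c := (0 : ℂ))).congr_of_eventuallyEq ?_
    filter_upwards [annulusCutoff_eventuallyEq_zero (R := R) (a := z)] with w hw
    rw [hw, zero_mul]
  · exact (contDiff_annulusCutoff R a).contDiffAt.mul (contDiffAt_poleWeight hz)

theorem dbar_annulusCutoff_mul_poleWeight :
    dbar (fun z => annulusCutoff R a z * poleWeight m k a z) z
      = dbar (annulusCutoff R a) z * poleWeight m k a z := by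
  by_cases hz : z = a
  · subst hz
    have h : (fun w => annulusCutoff R z w * poleWeight m k z w) =ᶠ[𝓝 z] fun _ => 0 := by
      filter_upwards [annulusCutoff_eventuallyEq_zero (R := R) (a := z)] with w hw
      rw [hw, zero_mul]
    rw [h.dbar_eq, annulusCutoff_eventuallyEq_zero.dbar_eq]
    simp [dbar]
  · rw [dbar_mul ((contDiff_annulusCutoff R a).differentiable (by simp) z)
      ((contDiffAt_poleWeight hz).differentiableAt (by simp)), dbar_poleWeight hz, mul_zero, add_zero]

theorem tsupport_annulusCutoff_mul_subset (hR : 0 < R) (g : ℂ → ℂ) :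
    tsupport (fun z => annulusCutoff R a z * g z) ⊆ {z | 11 / 10 ≤ ‖z‖ ∧ ‖z‖ ≤ 5 * R} := by
  refine closure_minimal (fun z hz => ?_) ?_
  · by_contra h
    refine hz ?_
    simp only [Set.mem_ofPred_eq, not_and_or, not_le] at h
    simp only [annulusCutoff]
    rcases h with h | h
    · rw [discCutoff_eq_one (s := 10 / 11) (by norm_num) (by rw [sub_zero]; linarith)]
      ring
    · rw [discCutoff_eq_zero (s := 1 / (4 * R)) (by positivity)]
      · ring
      · rw [sub_zero, div_mul_eq_mul_div, one_mul, le_div_iff₀ (by positivity)]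
        linarith
  · exact (isClosed_le continuous_const continuous_norm).inter
      (isClosed_le continuous_norm continuous_const)

theorem annulusCutoff_eq_one (hR : 8 ≤ R) (ha : ‖a‖ = R) (h1 : 3 / 2 ≤ ‖z‖) (h2 : ‖z‖ ≤ 5) :
    annulusCutoff R a z = 1 := by
  have h3 : R - 5 ≤ ‖z - a‖ := by
    have := norm_sub_norm_le a z
    rw [norm_sub_rev] at this
    linarith
  rw [annulusCutoff, discCutoff_eq_zero (s := 10 / 11) (by norm_num) (by rw [sub_zero]; linarith),
    discCutoff_eq_one (s := 1 / (4 * R)) (by positivity),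
    discCutoff_eq_zero (s := 4) (by norm_num) (by linarith)]
  · ring
  · rw [sub_zero, div_mul_eq_mul_div, one_mul, div_le_one (by positivity)]
    linarith

theorem dbar_annulusCutoff_eq_zero (hR : 8 ≤ R) (ha : ‖a‖ = R) (h1 : 3 / 2 < ‖z‖) (h2 : ‖z‖ < 5) :
    dbar (annulusCutoff R a) z = 0 := by
  have hev : annulusCutoff R a =ᶠ[𝓝 z] fun _ => 1 := by
    filter_upwards [continuous_norm.continuousAt.eventually_const_lt h1,
      continuous_norm.continuousAt.eventually_lt_const h2] with w hw1 hw2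
      using annulusCutoff_eq_one hR ha hw1.le hw2.le
  rw [hev.dbar_eq]
  simp [dbar]

end annulusCutoff

/-! ### The weighted estimate on the ring `2 < |z| < 4` -/

theorem volume_real_closedBall_complex (c : ℂ) {r : ℝ} (hr : 0 ≤ r) :
    volume.real (closedBall c r) = Real.pi * r ^ 2 := by
  rw [Measure.real, Complex.volume_closedBall]
  simp [ENNReal.toReal_ofReal hr, mul_comm]

/-- The derivative of the cutoff lives on three thin rings. For `11/10 ≤ |z| ≤ 11/8` one has `|z| ≤
3/2` and `|z - a| ≥ R - 2`; for `4R ≤ |z| ≤ 5R` one has `|z - a| ≥ 3R`; for `1/4 ≤ |z - a| ≤ 5/16`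
one has `|z| ≤ 2R`. The rings are enlarged to discs, of areas `4π` and `25πR²` for the first two.
There `|v| ≤ 1` is enough, whereas near `a` the factor `|v|` must be kept. -/
theorem exists_integral_norm_dbar_annulusCutoff_le : ∃ C : ℝ, 0 < C ∧
    ∀ (R : ℝ) (a : ℂ) (m k : ℕ) (F v : ℂ → ℂ) (E : ℝ), 8 ≤ R → ‖a‖ = R → 0 ≤ E →
      AEStronglyMeasurable v → (∀ᵐ z, ‖v z‖ ≤ 1) →
      (∀ᵐ z, 1 < ‖z‖ → ‖z‖ < 6 * R → ‖F z‖ ≤ E * ‖v z‖) →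
      ∫ z, ‖F z * dbar (fun z => annulusCutoff R a z * poleWeight m k a z) z‖
        ≤ E * C * (4 * Real.pi * ((3 / 2) ^ m / (R - 2) ^ k)
          + 25 * Real.pi * R ^ 2 * ((5 * R) ^ m / (3 * R) ^ k)
          + (2 * R) ^ m * 4 ^ k * ∫ z in ball a (1 / 2), ‖v z‖) := by
  obtain ⟨C, hC, hb⟩ := exists_norm_dbar_discCutoff_le
  refine ⟨C, hC, fun R a m k F v E hR ha hE hv hv1 hF => ?_⟩
  have hR0 : 0 < R := by linarith
  have hR2 : 0 < R - 2 := by linarith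
  set c1 : ℝ := (3 / 2) ^ m / (R - 2) ^ k with hc1
  set c2 : ℝ := (5 * R) ^ m / (3 * R) ^ k with hc2
  set c3 : ℝ := (2 * R) ^ m * 4 ^ k with hc3
  have hc10 : 0 ≤ c1 := by positivity
  have hc20 : 0 ≤ c2 := by positivity
  have hc30 : 0 ≤ c3 := by positivity
  set S1 := closedBall (0 : ℂ) 2
  set S2 := closedBall (0 : ℂ) (5 * R)
  set S3 := ball a (1 / 2 : ℝ)
  set w : ℂ → ℝ := fun z => E * C * (c1 * S1.indicator (fun _ => 1) z
    + c2 * S2.indicator (fun _ => 1) z + c3 * S3.indicator (fun z => ‖v z‖) z) with hw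
  have hI1 : Integrable (S1.indicator fun _ => (1 : ℝ)) :=
    (integrable_indicator_iff measurableSet_closedBall).2
      (integrableOn_const measure_closedBall_lt_top.ne)
  have hI2 : Integrable (S2.indicator fun _ => (1 : ℝ)) :=
    (integrable_indicator_iff measurableSet_closedBall).2
      (integrableOn_const measure_closedBall_lt_top.ne)
  have hvS : IntegrableOn v S3 := ⟨hv.restrict, HasFiniteIntegral.restrict_of_bounded (C := 1)
    measure_ball_lt_top (ae_restrict_of_ae hv1)⟩
  have hI3 : Integrable (S3.indicator fun z => ‖v z‖) :=
    (integrable_indicator_iff measurableSet_ball).2 hvS.norm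
  have hwi : Integrable w :=
    (((hI1.const_mul c1).add (hI2.const_mul c2)).add (hI3.const_mul c3)).const_mul _
  have hle : ∀ᵐ z, ‖F z * dbar (fun z => annulusCutoff R a z * poleWeight m k a z) z‖ ≤ w z := by
    filter_upwards [hv1, hF] with z hz1 hzF
    rw [dbar_annulusCutoff_mul_poleWeight]
    have hind1 : 0 ≤ S1.indicator (fun _ => (1 : ℝ)) z := Set.indicator_nonneg (fun _ _ => zero_le_one) z
    have hind2 : 0 ≤ S2.indicator (fun _ => (1 : ℝ)) z := Set.indicator_nonneg (fun _ _ => zero_le_one) z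
    have hind3 : 0 ≤ S3.indicator (fun z => ‖v z‖) z :=
      Set.indicator_nonneg (fun _ _ => norm_nonneg _) z
    by_cases hann : 11 / 10 ≤ ‖z‖ ∧ ‖z‖ ≤ 5 * R
    swap
    · have h0 : dbar (annulusCutoff R a) z = 0 := by
        refine dbar_of_notMem_tsupport fun h => hann ?_
        have := tsupport_annulusCutoff_mul_subset (a := a) hR0 (fun _ => 1)
        simp only [mul_one] at this
        exact this h
      simp only [h0, zero_mul, mul_zero, norm_zero]
      positivity
    have hzv := hzF (by linarith [hann.1]) (by linarith [hann.2])
    have hX : ‖F z‖ ≤ E := hzv.trans (by nlinarith)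
    rw [norm_mul, norm_mul]
    set P := ‖poleWeight m k a z‖ with hP
    have hza : R - ‖z‖ ≤ ‖z - a‖ := by
      have := norm_sub_norm_le a z
      rw [norm_sub_rev] at this
      linarith
    have hza' : ‖z‖ - R ≤ ‖z - a‖ := by
      have := norm_sub_norm_le z a
      linarith
    have t1 : ‖F z‖ * ‖dbar (discCutoff (10 / 11) 0) z‖ * P
        ≤ E * C * (c1 * S1.indicator (fun _ => 1) z) := by
      by_cases h : ‖z‖ ≤ 3 / 2
      · have hS : z ∈ S1 := by
          rw [mem_closedBall_zero_iff]
          linarith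
        rw [Set.indicator_of_mem hS, mul_one, hP, norm_poleWeight, hc1]
        gcongr
        · exact hb _ _ _ (by norm_num) (by norm_num)
        · linarith
      · rw [dbar_discCutoff_eq_zero_of_gt (by norm_num) (by rw [sub_zero]; linarith)]
        simp only [norm_zero, mul_zero, zero_mul]
        positivity
    have t2 : ‖F z‖ * ‖dbar (discCutoff (1 / (4 * R)) 0) z‖ * P
        ≤ E * C * (c2 * S2.indicator (fun _ => 1) z) := by
      by_cases h : 4 * R ≤ ‖z‖
      · have hS : z ∈ S2 := by
          rw [mem_closedBall_zero_iff]
          exact hann.2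
        rw [Set.indicator_of_mem hS, mul_one, hP, norm_poleWeight, hc2]
        gcongr
        · refine hb _ _ _ (by positivity) ?_
          rw [div_le_iff₀ (by positivity)]
          linarith
        · exact hann.2
        · linarith
      · rw [dbar_discCutoff_eq_zero_of_lt (by positivity)]
        · simp only [norm_zero, mul_zero, zero_mul]
          positivity
        · rw [sub_zero, div_mul_eq_mul_div, one_mul, div_lt_one (by positivity)]
          linarith
    have t3 : ‖F z‖ * ‖dbar (discCutoff 4 a) z‖ * P
        ≤ E * C * (c3 * S3.indicator (fun z => ‖v z‖) z) := by
      by_cases h : 1 / 4 ≤ ‖z - a‖ ∧ ‖z - a‖ ≤ 5 / 16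
      · have hS : z ∈ S3 := by
          rw [mem_ball, dist_eq_norm]
          linarith [h.2]
        have hPc : P ≤ c3 := by
          rw [hP, norm_poleWeight, hc3, div_le_iff₀ (by have := h.1; positivity), mul_assoc,
            ← mul_pow]
          have h4 : 1 ≤ (4 * ‖z - a‖) ^ k := one_le_pow₀ (by linarith [h.1])
          have h5 : ‖z‖ ^ m ≤ (2 * R) ^ m := by
            gcongr
            linarith [h.2]
          calc ‖z‖ ^ m ≤ (2 * R) ^ m * 1 := by rw [mul_one]; exact h5
            _ ≤ _ := by gcongr
        rw [Set.indicator_of_mem hS]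
        calc _ ≤ (E * ‖v z‖) * C * c3 := by
              gcongr
              exact hb _ _ _ (by norm_num) le_rfl
          _ = _ := by ring
      · have h0 : dbar (discCutoff 4 a) z = 0 := by
          rw [not_and_or, not_le, not_le] at h
          rcases h with h | h
          · exact dbar_discCutoff_eq_zero_of_lt (by norm_num) (by linarith)
          · exact dbar_discCutoff_eq_zero_of_gt (by norm_num) (by linarith)
        rw [h0]
        simp only [norm_zero, mul_zero, zero_mul]
        positivity
    calc ‖F z‖ * (‖dbar (annulusCutoff R a) z‖ * P)
        ≤ ‖F z‖ * ((‖dbar (discCutoff (10 / 11) 0) z‖ + ‖dbar (discCutoff (1 / (4 * R)) 0) z‖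
          + ‖dbar (discCutoff 4 a) z‖) * P) := by
          gcongr
          exact norm_dbar_annulusCutoff_le R a z
      _ = ‖F z‖ * ‖dbar (discCutoff (10 / 11) 0) z‖ * P
          + ‖F z‖ * ‖dbar (discCutoff (1 / (4 * R)) 0) z‖ * P
          + ‖F z‖ * ‖dbar (discCutoff 4 a) z‖ * P := by ring
      _ ≤ w z := by
          simp only [hw]
          linarith
  calc _ ≤ ∫ z, w z := integral_mono_of_nonneg (Eventually.of_forall fun z => norm_nonneg _) hwi hle
    _ = _ := by
      simp only [hw]
      rw [integral_const_mul, integral_add (by exact (hI1.const_mul c1).add (hI2.const_mul c2))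
          (hI3.const_mul c3), integral_add (hI1.const_mul c1) (hI2.const_mul c2),
        integral_const_mul, integral_const_mul, integral_const_mul,
        integral_indicator_const _ measurableSet_closedBall,
        integral_indicator_const _ measurableSet_closedBall, integral_indicator measurableSet_ball,
        volume_real_closedBall_complex _ (by norm_num),
        volume_real_closedBall_complex _ (by positivity)]
      simp only [smul_eq_mul, mul_one]
      ring

/-- Gauge `v` to `F = v e^{-h}` and apply the pointwise bound with the weighted cutoff. The
prefactor is the reciprocal of a lower bound for the weight on the ring. One `e^M` is paid in
passing from `v` to `F` and another in returning. -/
theorem exists_ae_norm_le_of_isWeakDbarSolution : ∃ C : ℝ, 0 < C ∧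
    ∀ (R M : ℝ) (a : ℂ) (m k : ℕ) (α v : ℂ → ℂ), 8 ≤ R → ‖a‖ = R → 0 ≤ M →
      AEStronglyMeasurable v → (∀ᵐ z, ‖v z‖ ≤ 1) → Integrable α →
      (∀ z, z ∉ {z : ℂ | 1 < ‖z‖ ∧ ‖z‖ < 6 * R} → α z = 0) →
      IsWeakDbarSolution {z : ℂ | 1 < ‖z‖ ∧ ‖z‖ < 6 * R} α v →
      (∀ z ∈ ball (0 : ℂ) (6 * R), ∫⁻ ζ, ‖α ζ‖ₑ * ‖(z - ζ)⁻¹‖ₑ ≤ ENNReal.ofReal M) →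
      ∀ᵐ z, 2 < ‖z‖ → ‖z‖ < 4 → ‖v z‖ ≤ (R + 4) ^ k / 2 ^ m * (Real.exp M * (Real.exp M * C *
        (4 * Real.pi * ((3 / 2) ^ m / (R - 2) ^ k)
          + 25 * Real.pi * R ^ 2 * ((5 * R) ^ m / (3 * R) ^ k)
          + (2 * R) ^ m * 4 ^ k * ∫ z in ball a (1 / 2), ‖v z‖))) := by
  obtain ⟨C, hC, hest⟩ := exists_integral_norm_dbar_annulusCutoff_le
  refine ⟨C, hC, fun R M a m k α v hR ha hM hv hv1 hα hαs H hαM => ?_⟩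
  have hR0 : 0 < R := by linarith
  set U := {z : ℂ | 1 < ‖z‖ ∧ ‖z‖ < 6 * R} with hU_def
  have hUb : U ⊆ ball 0 (6 * R) := fun z hz => by
    rw [mem_ball_zero_iff]
    exact hz.2
  set h := cauchyTransform α
  have hhM : ∀ z ∈ U, ‖h z‖ ≤ M := fun z hz =>
    norm_cauchyTransform_le_of_lintegral hM (hαM z (hUb hz))
  set F : ℂ → ℂ := fun z => v z * Complex.exp (-h z) with hF_def
  have hFm : AEStronglyMeasurable F := hv.mul (Complex.continuous_exp.comp_aestronglyMeasurable
    (AEStronglyMeasurable.cauchyTransform hα.1).neg)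
  have hF : ∀ φ : ℂ → ℂ, ContDiff ℝ ∞ φ → HasCompactSupport φ → tsupport φ ⊆ U →
      ∫ z, F z * dbar φ z = 0 := fun φ hφ hc hs =>
    H.gauge (by positivity) hUb hα (fun z hz => hαs z fun h => hz (hUb h)) hv hv1 hM
      (fun z hz => hαM z (hUb hz)) hφ hc hs
  have hFv : ∀ z ∈ U, ‖F z‖ ≤ Real.exp M * ‖v z‖ := fun z hz => by
    rw [hF_def, norm_mul, mul_comm]
    gcongr
    exact norm_cexp_neg_le (hhM z hz)
  have hvF : ∀ z ∈ U, ‖v z‖ ≤ Real.exp M * ‖F z‖ := fun z hz => by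
    have h1 : v z = F z * Complex.exp (-(-h z)) := by
      rw [hF_def, mul_assoc, ← Complex.exp_add]
      simp
    rw [h1, norm_mul, mul_comm]
    gcongr
    exact norm_cexp_neg_le (by rw [norm_neg]; exact hhM z hz)
  set q : ℂ → ℂ := fun z => annulusCutoff R a z * poleWeight m k a z with hq_def
  have hq : ContDiff ℝ ∞ q := contDiff_annulusCutoff_mul_poleWeight
  have hqs' : tsupport q ⊆ {z | 11 / 10 ≤ ‖z‖ ∧ ‖z‖ ≤ 5 * R} :=
    tsupport_annulusCutoff_mul_subset hR0 _
  have hqs : tsupport q ⊆ U := fun z hz =>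
    ⟨by linarith [(hqs' hz).1], by linarith [(hqs' hz).2]⟩
  have hqc : HasCompactSupport q :=
    HasCompactSupport.of_support_subset_isCompact (isCompact_closedBall 0 (5 * R)) fun z hz => by
      rw [mem_closedBall_zero_iff]
      exact (hqs' (subset_tsupport _ hz)).2
  have hFg : ∀ g : ℂ → ℂ, Continuous g → HasCompactSupport g → (∀ z, z ∉ U → g z = 0) →
      Integrable fun z => F z * g z := by
    intro g hg hgc hg0
    refine ((hg.integrable_of_hasCompactSupport hgc).norm.const_mul (Real.exp M)).mono'
      (hFm.mul hg.aestronglyMeasurable) ?_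
    filter_upwards [hv1] with z hz
    by_cases hzU : z ∈ U
    · rw [norm_mul]
      gcongr
      calc _ ≤ Real.exp M * ‖v z‖ := hFv z hzU
        _ ≤ Real.exp M * 1 := by gcongr
        _ = _ := mul_one _
    · simp [hg0 z hzU]
  have hFq : Integrable fun z => F z * q z := hFg q hq.continuous hqc fun z hz =>
    image_eq_zero_of_notMem_tsupport fun h => hz (hqs h)
  have hFdq : Integrable fun z => F z * dbar q z := hFg _ hq.dbar.continuous hqc.dbar fun z hz =>
    dbar_of_notMem_tsupport fun h => hz (hqs h)
  have hJ := hest R a m k F v (Real.exp M) hR ha (Real.exp_pos M).le hv hv1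
    (Eventually.of_forall fun z h1 h2 => hFv z ⟨h1, h2⟩)
  filter_upwards [ae_norm_mul_le_integral_of_weakly_holomorphic hF hq hqc hqs hFq hFdq]
    with z hz h2 h4
  -- Points within `1/2` of the ring satisfy `3/2 < |ζ| < 5`, where the cutoff is constantly `1`.
  have hz1 := hz fun ζ hζ => by
    have hn1 := norm_sub_norm_le z ζ
    have hn2 := norm_sub_norm_le ζ z
    rw [norm_sub_rev] at hn1
    rw [hq_def, dbar_annulusCutoff_mul_poleWeight,
      dbar_annulusCutoff_eq_zero hR ha (by linarith) (by linarith), zero_mul]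
  have hzU : z ∈ U := ⟨by linarith, by linarith⟩
  have hza : ‖z - a‖ ≤ R + 4 := (norm_sub_le _ _).trans (by linarith)
  have hza0 : 0 < ‖z - a‖ := by
    have := norm_sub_norm_le a z
    rw [norm_sub_rev] at this
    linarith
  have hqz : 2 ^ m / (R + 4) ^ k ≤ ‖q z‖ := by
    rw [hq_def]
    simp only
    rw [annulusCutoff_eq_one hR ha (by linarith) (by linarith), one_mul, norm_poleWeight]
    gcongr
  set J := Real.exp M * C * (4 * Real.pi * ((3 / 2) ^ m / (R - 2) ^ k)
          + 25 * Real.pi * R ^ 2 * ((5 * R) ^ m / (3 * R) ^ k)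
          + (2 * R) ^ m * 4 ^ k * ∫ z in ball a (1 / 2), ‖v z‖) with hJ_def
  have h5 : ‖F z‖ * (2 ^ m / (R + 4) ^ k) ≤ J := by
    refine le_trans ?_ (hz1.trans hJ)
    exact (mul_le_mul_of_nonneg_left hqz (norm_nonneg _)).trans (norm_mul _ _).ge
  calc ‖v z‖ ≤ Real.exp M * ‖F z‖ := hvF z hzU
    _ = (R + 4) ^ k / 2 ^ m * (Real.exp M * (‖F z‖ * (2 ^ m / (R + 4) ^ k))) := by
      field_simp
    _ ≤ (R + 4) ^ k / 2 ^ m * (Real.exp M * J) := by gcongr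

/-! ### The choice of the exponents -/

/-- The gain is `(3/4)^m ≤ e^{-m/4}`. The pole loses at most `(1 + 8/R)^k ≤ e^{8k/R}`, and the
hypothesis on `k` makes this no more than `e^{m/8}`. -/
theorem inner_ring_pole_estimate {R : ℝ} (hR8 : 8 ≤ R) {m k : ℕ} (hk : 64 * (k : ℝ) ≤ m * R) :
    (R + 4) ^ k / 2 ^ m * ((3 / 2) ^ m / (R - 2) ^ k) ≤ Real.exp (-(m / 8)) := by
  have hR0 : 0 < R := by linarith
  have hR2 : 0 < R - 2 := by linarith
  have e1 : (R + 4) ^ k / 2 ^ m * ((3 / 2) ^ m / (R - 2) ^ k)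
      = (3 / 4) ^ m * ((R + 4) / (R - 2)) ^ k := by
    rw [div_pow (R + 4), show (3 / 4 : ℝ) = (3 / 2) / 2 by norm_num, div_pow (3 / 2 : ℝ) 2 m]
    field_simp
  have e2 : (3 / 4 : ℝ) ^ m ≤ Real.exp (-(m / 4)) := by
    rw [show -((m : ℝ) / 4) = m * (-(1 / 4)) by ring, Real.exp_nat_mul]
    gcongr
    linarith [Real.add_one_le_exp (-(1 / 4 : ℝ))]
  have e3 : ((R + 4) / (R - 2)) ^ k ≤ Real.exp (k * (8 / R)) := by
    rw [Real.exp_nat_mul]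
    have : (R + 4) / (R - 2) ≤ 8 / R + 1 := by
      rw [div_add_one hR0.ne', div_le_div_iff₀ hR2 hR0]
      -- After expansion this inequality is precisely `R ≥ 8`.
      nlinarith
    have h0 : 0 ≤ (R + 4) / (R - 2) := by positivity
    gcongr
    exact this.trans (Real.add_one_le_exp _)
  rw [e1]
  calc _ ≤ Real.exp (-(m / 4)) * Real.exp (k * (8 / R)) := by gcongr
    _ ≤ _ := by
      rw [← Real.exp_add]
      apply Real.exp_le_exp.2
      have : (k : ℝ) * (8 / R) ≤ m / 8 := by
        rw [mul_div_assoc', div_le_iff₀ hR0]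
        linarith
      linarith

/-- The zero loses `(5R/2)^m ≤ e^{2ml}`; the pole gains `2^{-k} ≤ e^{-k/2} ≤ e^{-3ml}`. The surplus
`e^{-ml}` also pays for the area factor `R² = e^{2l}`, as `m ≥ 64`. -/
theorem outer_ring_pole_estimate {R l : ℝ} (hR8 : 8 ≤ R) (hRl : R = Real.exp l) {m k : ℕ}
    (hm : 64 * l ≤ m * l) (hml : (m : ℝ) ≤ m * l) (hk : 6 * (m * l) ≤ k) :
    R ^ 2 * ((R + 4) ^ k / 2 ^ m * ((5 * R) ^ m / (3 * R) ^ k)) ≤ Real.exp (-(m / 8)) := by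
  have hR5 : 5 * R / 2 ≤ Real.exp (2 * l) := by
    rw [two_mul, Real.exp_add, ← hRl]
    nlinarith
  have e1 : (R + 4) ^ k / 2 ^ m * ((5 * R) ^ m / (3 * R) ^ k)
      = (5 * R / 2) ^ m * ((R + 4) / (3 * R)) ^ k := by
    rw [div_pow (R + 4), div_pow (5 * R)]
    field_simp
  have e2 : (5 * R / 2) ^ m ≤ Real.exp (m * (2 * l)) := by
    rw [Real.exp_nat_mul]
    gcongr
  have e3 : ((R + 4) / (3 * R)) ^ k ≤ Real.exp (k * (-(1 / 2))) := by
    rw [Real.exp_nat_mul]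
    gcongr
    have : (R + 4) / (3 * R) ≤ 1 / 2 := by
      rw [div_le_div_iff₀ (by positivity) two_pos]
      linarith
    linarith [Real.add_one_le_exp (-(1 / 2 : ℝ))]
  have e4 : R ^ 2 = Real.exp (2 * l) := by
    rw [two_mul, Real.exp_add, ← hRl, pow_two]
  rw [e1, e4]
  calc _ ≤ Real.exp (2 * l) * (Real.exp (m * (2 * l)) * Real.exp (k * (-(1 / 2)))) := by gcongr
    _ ≤ _ := by
      rw [← Real.exp_add, ← Real.exp_add]
      apply Real.exp_le_exp.2
      have : (m : ℝ) * (2 * l) = 2 * (m * l) := by ring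
      linarith

/-- With `4(R + 4) ≤ R² = e^{2l}`, the product is at most `e^{ml + 2kl}`; since `k ≤ 7ml`, this is
at most `e^{15 m l²}`. -/
theorem near_ball_pole_estimate {R l c : ℝ} (hR8 : 8 ≤ R) (hRl : R = Real.exp l) (hl1 : 1 ≤ l)
    {m k : ℕ} (hm : (m : ℝ) ≤ (c + 1) * R) (hk : (k : ℝ) ≤ 7 * (m * l)) :
    (R + 4) ^ k / 2 ^ m * ((2 * R) ^ m * 4 ^ k) ≤ Real.exp (15 * (c + 1) * R * l ^ 2) := by
  have e1 : (R + 4) ^ k / 2 ^ m * ((2 * R) ^ m * 4 ^ k) = R ^ m * (4 * (R + 4)) ^ k := by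
    rw [mul_pow, mul_pow]
    field_simp
  have e2 : R ^ m = Real.exp (m * l) := by rw [Real.exp_nat_mul, ← hRl]
  have e3 : (4 * (R + 4)) ^ k ≤ Real.exp (k * (2 * l)) := by
    rw [Real.exp_nat_mul]
    gcongr
    rw [two_mul, Real.exp_add, ← hRl]
    nlinarith
  rw [e1, e2]
  calc _ ≤ Real.exp (m * l) * Real.exp (k * (2 * l)) := by gcongr
    _ ≤ _ := by
      rw [← Real.exp_add]
      apply Real.exp_le_exp.2
      have h1 : (k : ℝ) * (2 * l) ≤ 7 * (m * l) * (2 * l) := by gcongr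
      have h2 : (m : ℝ) * l * 1 ≤ m * l * l := by gcongr
      have h3 : (m : ℝ) * l ^ 2 ≤ (c + 1) * R * l ^ 2 := by gcongr
      linarith

theorem exists_exponents_of_pole_estimate {K C s : ℝ} (hK : 0 < K) (hC : 0 < C) (hs : 0 < s) :
    ∃ A B R₁ : ℝ, 0 < A ∧ 0 < B ∧ 8 ≤ R₁ ∧ ∀ R, R₁ ≤ R → ∃ m k : ℕ, ∀ τ : ℝ, 0 ≤ τ →
      s ≤ (R + 4) ^ k / 2 ^ m * (Real.exp (K * R) * (Real.exp (K * R) * C *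
        (4 * Real.pi * ((3 / 2) ^ m / (R - 2) ^ k)
          + 25 * Real.pi * R ^ 2 * ((5 * R) ^ m / (3 * R) ^ k)
          + (2 * R) ^ m * 4 ^ k * τ))) →
      B * Real.exp (-(A * R * Real.log R ^ 2)) ≤ τ := by
  -- The first two terms together carry the constant `29π = 4π + 25π`. The shift `L` makes their
  -- total at most `s/2`, whence `58 = 2 · 29`.
  set L := |Real.log (s / (58 * Real.pi * C))| + 1 with hL
  have hL1 : 1 ≤ L := by linarith [abs_nonneg (Real.log (s / (58 * Real.pi * C)))]
  have hpos : 0 < s / (58 * Real.pi * C) := by positivity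
  have hLexp : Real.exp (-L) ≤ s / (58 * Real.pi * C) := by
    rw [← Real.exp_log hpos]
    apply Real.exp_le_exp.2
    linarith [neg_abs_le (Real.log (s / (58 * Real.pi * C)))]
  -- With `m ≥ cR` the gain `e^{-m/8}` beats both `e^{2KR}` and the constant `e^{-L}`.
  set c := 8 * (2 * K + L) with hc
  have hc8 : 8 ≤ c := by linarith
  -- As `k ≤ 7 m log R` and `448 = 64 · 7`, this yields the condition `64 k ≤ m R` for the inner
  -- ring.
  obtain ⟨R₂, hR₂⟩ : ∃ R₂ : ℝ, ∀ R, R₂ ≤ R → 448 * Real.log R ≤ R := by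
    have := Real.isLittleO_log_id_atTop.bound (show (0 : ℝ) < 1 / 448 by norm_num)
    obtain ⟨R₂, h⟩ := eventually_atTop.1 this
    refine ⟨max R₂ 1, fun R hR => ?_⟩
    have h1 := h R ((le_max_left _ _).trans hR)
    have h2 : 1 ≤ R := (le_max_right _ _).trans hR
    simp only [id, Real.norm_eq_abs, abs_of_nonneg (show (0 : ℝ) ≤ R by linarith)] at h1
    linarith [le_abs_self (Real.log R)]
  refine ⟨2 * K + 15 * (c + 1), s / (2 * C), max R₂ 8, by linarith, by positivity,
    le_max_right _ _, fun R hR => ?_⟩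
  have hR8 : 8 ≤ R := (le_max_right _ _).trans hR
  have hlogR := hR₂ R ((le_max_left _ _).trans hR)
  have hR0 : 0 < R := by linarith
  have hR2 : 0 < R - 2 := by linarith
  set l := Real.log R with hl
  have hl1 : 1 ≤ l := by
    rw [hl, Real.le_log_iff_exp_le hR0]
    linarith [Real.exp_one_lt_d9]
  have hRl : R = Real.exp l := (Real.exp_log hR0).symm
  obtain ⟨m, hm⟩ : ∃ m : ℕ, m = ⌈c * R⌉₊ := ⟨_, rfl⟩
  have hm1 : c * R ≤ m := by rw [hm]; exact Nat.le_ceil _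
  have hm2 : (m : ℝ) ≤ (c + 1) * R := by
    have := Nat.ceil_lt_add_one (show 0 ≤ c * R by positivity)
    rw [← hm] at this
    linarith
  have hm64 : (64 : ℝ) ≤ m := by
    have : 8 * 8 ≤ c * R := by gcongr
    linarith
  obtain ⟨k, hk⟩ : ∃ k : ℕ, k = ⌈6 * m * l⌉₊ := ⟨_, rfl⟩
  have hml : (m : ℝ) ≤ m * l := le_mul_of_one_le_right (by positivity) hl1
  have hk1 : 6 * (m * l) ≤ k := by rw [hk, ← mul_assoc]; exact Nat.le_ceil _
  have hk2 : (k : ℝ) ≤ 7 * (m * l) := by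
    have := Nat.ceil_lt_add_one (show 0 ≤ 6 * (m : ℝ) * l by positivity)
    rw [← hk] at this
    linarith
  have hm64l : 64 * l ≤ m * l := by gcongr
  refine ⟨m, k, fun τ hτ h => ?_⟩
  have T1 := inner_ring_pole_estimate hR8 (m := m) (k := k) (by
    have : (m : ℝ) * (448 * l) ≤ m * R := by gcongr
    linarith)
  have T2 := outer_ring_pole_estimate hR8 hRl hm64l hml hk1
  have T3 := near_ball_pole_estimate hR8 hRl hl1 hm2 hk2
  have hE : Real.exp (K * R) * Real.exp (K * R) = Real.exp (2 * K * R) := by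
    rw [← Real.exp_add]
    ring_nf
  have hmain : s ≤ Real.exp (2 * K * R) * C * (29 * Real.pi * Real.exp (-(m / 8))
      + Real.exp (15 * (c + 1) * R * l ^ 2) * τ) := by
    refine h.trans ?_
    have e : (R + 4) ^ k / 2 ^ m * (Real.exp (K * R) * (Real.exp (K * R) * C *
        (4 * Real.pi * ((3 / 2) ^ m / (R - 2) ^ k)
          + 25 * Real.pi * R ^ 2 * ((5 * R) ^ m / (3 * R) ^ k)
          + (2 * R) ^ m * 4 ^ k * τ)))
        = (Real.exp (K * R) * Real.exp (K * R)) * C *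
          (4 * Real.pi * ((R + 4) ^ k / 2 ^ m * ((3 / 2) ^ m / (R - 2) ^ k))
            + 25 * Real.pi * (R ^ 2 * ((R + 4) ^ k / 2 ^ m * ((5 * R) ^ m / (3 * R) ^ k)))
            + ((R + 4) ^ k / 2 ^ m * ((2 * R) ^ m * 4 ^ k)) * τ) := by ring
    rw [e, hE]
    calc _ ≤ Real.exp (2 * K * R) * C * (4 * Real.pi * Real.exp (-(m / 8))
            + 25 * Real.pi * Real.exp (-(m / 8)) + Real.exp (15 * (c + 1) * R * l ^ 2) * τ) := by
          gcongr
      _ = _ := by ring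
  have hhalf : Real.exp (2 * K * R) * C * (29 * Real.pi * Real.exp (-(m / 8))) ≤ s / 2 := by
    have h1 : Real.exp (2 * K * R) * Real.exp (-(m / 8)) ≤ Real.exp (-L) := by
      rw [← Real.exp_add]
      apply Real.exp_le_exp.2
      have : L * 1 ≤ L * R := by gcongr; linarith
      have : c * R = 8 * (2 * K * R + L * R) := by rw [hc]; ring
      linarith
    calc _ = (Real.exp (2 * K * R) * Real.exp (-(m / 8))) * (29 * Real.pi * C) := by ring
      _ ≤ s / (58 * Real.pi * C) * (29 * Real.pi * C) := by
        gcongr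
        exact h1.trans hLexp
      _ = s / 2 := by
        field_simp
        norm_num
  have hfin : s / 2 ≤ Real.exp ((2 * K + 15 * (c + 1)) * R * l ^ 2) * C * τ := by
    have h1 : s / 2 ≤ Real.exp (2 * K * R) * C * (Real.exp (15 * (c + 1) * R * l ^ 2) * τ) := by
      linarith
    refine h1.trans ?_
    have h2 : Real.exp (2 * K * R) ≤ Real.exp (2 * K * R * l ^ 2) := by
      apply Real.exp_le_exp.2
      have : 0 < K * R := by positivity
      have : 1 ≤ l ^ 2 := one_le_pow₀ hl1
      have : 0 ≤ 2 * K * R := by positivity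
      exact le_mul_of_one_le_right this ‹_›
    calc _ ≤ Real.exp (2 * K * R * l ^ 2) * C * (Real.exp (15 * (c + 1) * R * l ^ 2) * τ) := by
          gcongr
      _ = _ := by
        rw [show (2 * K + 15 * (c + 1)) * R * l ^ 2 = 2 * K * R * l ^ 2 + 15 * (c + 1) * R * l ^ 2 by
          ring, Real.exp_add]
        ring
  rw [Real.exp_neg]
  have hep := Real.exp_pos ((2 * K + 15 * (c + 1)) * R * l ^ 2)
  rw [← div_eq_mul_inv, div_le_iff₀ hep, div_le_iff₀ (by positivity)]
  linarith

/-! ### The lower bound -/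

/-- Pointwise `|v| ≤ t + |v|²/t`, and the disc has area `π/4 ≤ 1`. -/
theorem setIntegral_norm_le_of_lintegral_sq {v : ℂ → ℂ} {a : ℂ} {t D : ℝ}
    (hv : AEStronglyMeasurable v) (ht : 0 < t) (hD : 0 ≤ D)
    (h : ∫⁻ z in ball a (1 / 2), ‖v z‖ₑ ^ 2 ≤ ENNReal.ofReal (D * t ^ 2)) :
    ∫ z in ball a (1 / 2), ‖v z‖ ≤ (1 + D) * t := by
  rw [integral_norm_eq_lintegral_enorm hv.restrict]
  refine ENNReal.toReal_le_of_le_ofReal (by positivity) ?_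
  have hpt : ∀ z, ‖v z‖ₑ ≤ ENNReal.ofReal t + ENNReal.ofReal t⁻¹ * ‖v z‖ₑ ^ 2 := by
    intro z
    rw [← ofReal_norm, ← ENNReal.ofReal_pow (norm_nonneg _), ← ENNReal.ofReal_mul (by positivity),
      ← ENNReal.ofReal_add ht.le (by positivity)]
    apply ENNReal.ofReal_le_ofReal
    rw [inv_mul_eq_div, ← sub_le_iff_le_add', le_div_iff₀ ht]
    nlinarith [sq_nonneg (‖v z‖ - t), norm_nonneg (v z)]
  have hvol : volume (ball a (1 / 2)) ≤ 1 := by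
    rw [Complex.volume_ball, ← ENNReal.ofReal_pow (by norm_num), ← ENNReal.ofReal_coe_nnreal,
      ← ENNReal.ofReal_mul (by norm_num)]
    apply ENNReal.ofReal_le_one.2
    rw [NNReal.coe_real_pi]
    linarith [Real.pi_lt_four]
  calc ∫⁻ z in ball a (1 / 2), ‖v z‖ₑ
      ≤ ∫⁻ z in ball a (1 / 2), (ENNReal.ofReal t + ENNReal.ofReal t⁻¹ * ‖v z‖ₑ ^ 2) :=
        lintegral_mono hpt
    _ = ENNReal.ofReal t * volume (ball a (1 / 2))
        + ENNReal.ofReal t⁻¹ * ∫⁻ z in ball a (1 / 2), ‖v z‖ₑ ^ 2 := by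
        rw [lintegral_add_left measurable_const, setLIntegral_const,
          lintegral_const_mul' _ _ ENNReal.ofReal_ne_top]
    _ ≤ ENNReal.ofReal t * 1 + ENNReal.ofReal t⁻¹ * ENNReal.ofReal (D * t ^ 2) := by gcongr
    _ = ENNReal.ofReal ((1 + D) * t) := by
        rw [mul_one, ← ENNReal.ofReal_mul (by positivity), ← ENNReal.ofReal_add ht.le (by positivity)]
        congr 1
        field_simp

theorem setLIntegral_ball_complexPlane (f : Plane → ℝ≥0∞) (a : ℂ) (r : ℝ) :
    ∫⁻ z in ball a r, f (complexPlane z) = ∫⁻ x in ball (complexPlane a) r, f x := by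
  have := measurePreserving_complexPlane.setLIntegral_comp_preimage_emb
    measurableEmbedding_complexPlane f (ball (complexPlane a) r)
  rwa [LinearIsometryEquiv.preimage_ball, LinearIsometryEquiv.symm_apply_apply] at this

/-- If `|u| ≤ t²` near `z₀`, then Caccioppoli gives `∫ |∇u|² ≤ D t²` there, hence `∫ |v| ≤ (1 + D)
t`. The constants are such that this is half of the lower bound for that integral, a contradiction.
The square in `t²` is responsible for the `2 A` in the exponent. -/
theorem landis_lower_bound {p : ℝ≥0∞} (hp : 2 < p) {C₀ : ℝ} (hC₀ : 0 < C₀) :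
    ∃ C₁ C₂ R₀ : ℝ, 0 < C₁ ∧ 0 < C₂ ∧ 1 < R₀ ∧
      ∀ (W : Plane → Plane) (u : Plane → ℝ) (G : Plane → Plane),
        IsNormalizedSolution p C₀ W u G → ∀ R : ℝ, R₀ ≤ R →
          ENNReal.ofReal (C₂ * Real.exp (-(C₁ * R * Real.log R ^ 2))) ≤ infSup u R := by
  obtain ⟨K, hK, hker⟩ := exists_lintegral_mul_enorm_inv_le hp
  obtain ⟨D, hD, hcacc⟩ := exists_setLIntegral_sq_enorm_grad_le hp
  obtain ⟨C, hC, hest⟩ := exists_ae_norm_le_of_isWeakDbarSolution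
  -- If `|v| ≤ S` on the unit disc about `3`, of area `π`, then `C₀ ≤ π S²`, that is `s ≤ S`. Only
  -- this one centre on the circle of radius `3` is needed.
  set s := Real.sqrt (C₀ / Real.pi) with hs
  have hs0 : 0 < s := Real.sqrt_pos.2 (by positivity)
  obtain ⟨A, B, R₁, hA, hB, hR₁, hexp⟩ :=
    exists_exponents_of_pole_estimate (K := 6 * K) (by positivity) hC hs0
  refine ⟨2 * A, (B / (2 * (1 + D))) ^ 2, R₁, by positivity, by positivity, by linarith,
    fun W u G H R hR => ?_⟩
  have hR8 : 8 ≤ R := hR₁.trans hR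
  unfold infSup
  refine le_iInf₂ fun z₀ hz₀ => ?_
  by_contra! hlt
  set t := B / (2 * (1 + D)) * Real.exp (-(A * R * Real.log R ^ 2)) with ht
  have ht0 : 0 < t := by positivity
  have ht2 : (B / (2 * (1 + D))) ^ 2 * Real.exp (-(2 * A * R * Real.log R ^ 2)) = t ^ 2 := by
    rw [ht, mul_pow, ← Real.exp_nat_mul]
    push_cast
    ring_nf
  rw [ht2, eLpNorm_exponent_top] at hlt
  have hz₀R : ‖z₀‖ = R := by simpa using hz₀
  have hu : ∀ᵐ x ∂volume.restrict (ball z₀ 1), ‖u x‖ ≤ t ^ 2 := by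
    filter_upwards [enorm_ae_le_eLpNormEssSup u (volume.restrict (ball z₀ 1))] with x hx
    have := hx.trans hlt.le
    rwa [← ofReal_norm, ENNReal.ofReal_le_ofReal_iff (by positivity)] at this
  have hG2 := hcacc C₀ W u G H z₀ (by linarith) (t ^ 2) (by positivity) hu
  set a : ℂ := complexPlane.symm z₀ with ha_def
  have haz : complexPlane a = z₀ := complexPlane.apply_symm_apply z₀
  have ha : ‖a‖ = R := by rw [ha_def, LinearIsometryEquiv.norm_map, hz₀R]
  set U : Set ℂ := {z | 1 < ‖z‖ ∧ ‖z‖ < 6 * R} with hU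
  have hUo : IsOpen U := (isOpen_lt continuous_const continuous_norm).inter
    (isOpen_lt continuous_norm continuous_const)
  have hUb : U ⊆ ball 0 (6 * R) := fun z hz => by
    rw [mem_ball_zero_iff]
    exact hz.2
  obtain ⟨α, v, hv, hv1, hα, hαp, hαs, Hw, hvG⟩ := H.exists_isWeakDbarSolution hUo.measurableSet
    (fun z hz => hz.1) ((measure_mono hUb).trans_lt measure_ball_lt_top).ne
    ((by norm_num : (1 : ℝ≥0∞) ≤ 2).trans hp.le)
  have hballU : ball a (1 / 2) ⊆ U := fun z hz => by
    rw [mem_ball, dist_eq_norm] at hz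
    have h1 := norm_sub_norm_le a z
    have h2 := norm_sub_norm_le z a
    rw [norm_sub_rev] at h1
    exact ⟨by linarith, by linarith⟩
  have hball3 : ∀ z ∈ ball (3 : ℂ) 1, 2 < ‖z‖ ∧ ‖z‖ < 4 := fun z hz => by
    rw [mem_ball, dist_eq_norm] at hz
    have h1 := norm_sub_norm_le 3 z
    have h2 := norm_sub_norm_le z 3
    rw [norm_sub_rev] at h1
    rw [Complex.norm_ofNat] at h1 h2
    exact ⟨by linarith, by linarith⟩
  have hlin : ∀ z ∈ ball (0 : ℂ) (6 * R),
      ∫⁻ ζ, ‖α ζ‖ₑ * ‖(z - ζ)⁻¹‖ₑ ≤ ENNReal.ofReal (6 * K * R) := by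
    intro z hz
    have h := hker α hα.1 hαp (6 * R) (by linarith) z hz
    rw [show 6 * K * R = K * (6 * R) by ring]
    refine le_trans (le_of_eq ?_) h
    rw [← lintegral_indicator measurableSet_ball]
    refine lintegral_congr fun ζ => ?_
    by_cases hζ : ζ ∈ ball (0 : ℂ) (6 * R)
    · rw [Set.indicator_of_mem hζ]
    · rw [Set.indicator_of_notMem hζ, hαs ζ fun h => hζ (hUb h)]
      simp
  obtain ⟨m, k, hmk⟩ := hexp R hR
  set τ := ∫ z in ball a (1 / 2), ‖v z‖ with hτ
  have hτ0 : 0 ≤ τ := integral_nonneg fun z => norm_nonneg _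
  have hτt : τ ≤ (1 + D) * t := by
    refine setIntegral_norm_le_of_lintegral_sq hv ht0 hD.le (le_trans (le_of_eq ?_) hG2)
    rw [← haz, ← setLIntegral_ball_complexPlane (fun x => ‖G x‖ₑ ^ 2)]
    refine setLIntegral_congr_fun measurableSet_ball fun z hz => ?_
    rw [← ofReal_norm, hvG z (hballU hz), ofReal_norm]
  have hbd := hest R (6 * K * R) a m k α v hR8 ha (by positivity) hv hv1 hα hαs Hw hlin
  set S := (R + 4) ^ k / 2 ^ m * (Real.exp (6 * K * R) * (Real.exp (6 * K * R) * C *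
        (4 * Real.pi * ((3 / 2) ^ m / (R - 2) ^ k)
          + 25 * Real.pi * R ^ 2 * ((5 * R) ^ m / (3 * R) ^ k)
          + (2 * R) ^ m * 4 ^ k * τ))) with hS
  have hS0 : 0 ≤ S := by
    have : 0 < R - 2 := by linarith
    positivity
  have hsS : s ≤ S := by
    rw [hs, Real.sqrt_le_left hS0, div_le_iff₀ Real.pi_pos]
    have h3 : ENNReal.ofReal C₀ ≤ ∫⁻ z in ball (3 : ℂ) 1, ‖v z‖ₑ ^ 2 := by
      have h1 : complexPlane 3 ∈ sphere (0 : Plane) 3 := by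
        rw [mem_sphere_zero_iff_norm, LinearIsometryEquiv.norm_map, Complex.norm_ofNat]
      refine (H.grad_lower.trans (iInf₂_le _ h1)).trans (le_of_eq ?_)
      rw [← setLIntegral_ball_complexPlane (fun x => ‖G x‖ₑ ^ 2)]
      refine setLIntegral_congr_fun measurableSet_ball fun z hz => ?_
      have hzU : z ∈ U := ⟨by linarith [(hball3 z hz).1], by linarith [(hball3 z hz).2]⟩
      rw [← ofReal_norm (v z), hvG z hzU, ofReal_norm]
    have h4 : ∫⁻ z in ball (3 : ℂ) 1, ‖v z‖ₑ ^ 2 ≤ ENNReal.ofReal (S ^ 2 * Real.pi) := by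
      calc _ ≤ ∫⁻ _ in ball (3 : ℂ) 1, ENNReal.ofReal (S ^ 2) := by
            refine lintegral_mono_ae ((ae_restrict_iff' measurableSet_ball).2 ?_)
            filter_upwards [hbd] with z hz hzb
            rw [← ofReal_norm, ← ENNReal.ofReal_pow (norm_nonneg _)]
            apply ENNReal.ofReal_le_ofReal
            gcongr
            exact hz (hball3 z hzb).1 (hball3 z hzb).2
        _ = _ := by
            rw [setLIntegral_const, Complex.volume_ball, ENNReal.ofReal_one, one_pow, one_mul,
              ← ENNReal.ofReal_coe_nnreal, NNReal.coe_real_pi, ← ENNReal.ofReal_mul (by positivity)]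
    exact (ENNReal.ofReal_le_ofReal_iff (by positivity)).1 (h3.trans h4)
  have hfinal := (hmk τ hτ0 hsS).trans hτt
  have : (1 + D) * t = B / 2 * Real.exp (-(A * R * Real.log R ^ 2)) := by
    rw [ht]
    field_simp
  rw [this] at hfinal
  have : 0 < B * Real.exp (-(A * R * Real.log R ^ 2)) := by positivity
  linarith

/-! ### The example for `p = ∞` -/

theorem IsTestFunction.integrable_of_continuousOn {E : Type*} [NormedAddCommGroup E] {D : Set Plane}
    {φ : Plane → ℝ} (hφ : IsTestFunction D φ) {h : Plane → E} (hh : ContinuousOn h D)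
    (h0 : ∀ x, x ∉ tsupport φ → h x = 0) : Integrable h := by
  rw [← integrableOn_iff_integrable_of_support_subset (s := tsupport φ)
    fun x hx => by_contra fun h => hx (h0 x h)]
  exact (hh.mono hφ.support_subset).integrableOn_compact hφ.compactSupport

theorem fderiv_apply_eq_zero_of_notMem_tsupport {φ : Plane → ℝ} {x : Plane}
    (hx : x ∉ tsupport φ) (w : Plane) : fderiv ℝ φ x w = 0 := by
  rw [← inner_gradient_left, gradient_eq_zero_of_notMem_tsupport hx, inner_zero_left]

theorem IsTestFunction.integral_mul_fderiv {D : Set Plane} {φ : Plane → ℝ}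
    (hφ : IsTestFunction D φ) {f : Plane → ℝ} {f' : Plane → ℝ} {w : Plane}
    (hf : ContinuousOn f D) (hf' : ContinuousOn f' D)
    (hd : ∀ x ∈ D, HasLineDerivAt ℝ f (f' x) x w) :
    ∫ x, f x * fderiv ℝ φ x w = -∫ x, f' x * φ x := by
  have hc : Continuous fun x => fderiv ℝ φ x w :=
    (hφ.smooth.continuous_fderiv (by simp)).clm_apply continuous_const
  refine integral_bilinear_hasLineDerivAt_right_eq_neg_left_of_integrable
    (B := ContinuousLinearMap.mul ℝ ℝ) (v := w) (μ := volume) (f := f) (f' := f') (g := φ)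
    (g' := fun x => fderiv ℝ φ x w)
    (hφ.integrable_of_continuousOn (hf'.mul hφ.smooth.continuous.continuousOn) fun x hx => ?_)
    (hφ.integrable_of_continuousOn (hf.mul hc.continuousOn) fun x hx => ?_)
    (hφ.integrable_of_continuousOn (hf.mul hφ.smooth.continuous.continuousOn) fun x hx => ?_)
    (fun x hx => hd x (hφ.support_subset hx))
    fun x _ => ((hφ.smooth.differentiable (by simp)) x).hasFDerivAt.hasLineDerivAt w
  · simp [image_eq_zero_of_notMem_tsupport hx]
  · simp [fderiv_apply_eq_zero_of_notMem_tsupport hx w]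
  · simp [image_eq_zero_of_notMem_tsupport hx]

theorem hasFDerivAt_norm_of_ne_zero {x : Plane} (hx : x ≠ 0) :
    HasFDerivAt (fun y : Plane => ‖y‖) (‖x‖⁻¹ • innerSL ℝ x) x := by
  have h := (hasStrictFDerivAt_norm_sq x).hasFDerivAt.sqrt (by simpa using hx)
  simp only [Real.sqrt_sq (norm_nonneg _)] at h
  refine h.congr_fderiv ?_
  ext w
  simp
  field_simp

theorem hasFDerivAt_exampleSolution {x : Plane} (hx : x ≠ 0) :
    HasFDerivAt exampleSolution (-Real.exp (-‖x‖) • innerSL ℝ x) x := by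
  have hn := hasFDerivAt_norm_of_ne_zero hx
  have h0 : ‖x‖ ≠ 0 := norm_ne_zero_iff.2 hx
  refine (hn.neg.exp.mul (hn.const_add 1)).congr_fderiv ?_
  ext w
  simp
  field_simp
  ring

theorem gradient_exampleSolution {x : Plane} (hx : x ≠ 0) :
    ∇ exampleSolution x = -Real.exp (-‖x‖) • x := by
  refine ext_inner_right ℝ fun w => ?_
  rw [inner_gradient_left, (hasFDerivAt_exampleSolution hx).fderiv, real_inner_smul_left]
  simp

theorem continuous_exampleSolution : Continuous exampleSolution := by
  unfold exampleSolution
  fun_prop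

theorem ne_zero_of_mem_exteriorDomain {x : Plane} (hx : x ∈ exteriorDomain) : x ≠ 0 := by
  rintro rfl
  rw [mem_exteriorDomain, norm_zero] at hx
  linarith

theorem continuousOn_gradient_exampleSolution :
    ContinuousOn (∇ exampleSolution) exteriorDomain := by
  have : Continuous fun x : Plane => -Real.exp (-‖x‖) • x := by fun_prop
  exact this.continuousOn.congr fun x hx => gradient_exampleSolution (ne_zero_of_mem_exteriorDomain hx)

theorem continuousOn_exampleDrift : ContinuousOn exampleDrift exteriorDomain := by
  unfold exampleDrift
  refine ContinuousOn.smul (ContinuousOn.div (continuous_const.sub continuous_norm).continuousOn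
    (continuous_norm.pow 2).continuousOn fun x hx => ?_) continuousOn_id
  have := ne_zero_of_mem_exteriorDomain hx
  simpa using this

theorem inner_exampleDrift {x : Plane} (hx : x ≠ 0) :
    ⟪exampleDrift x, ∇ exampleSolution x⟫ = (‖x‖ - 2) * Real.exp (-‖x‖) := by
  have h0 : ‖x‖ ≠ 0 := norm_ne_zero_iff.2 hx
  rw [gradient_exampleSolution hx, exampleDrift, real_inner_smul_left, real_inner_smul_right,
    real_inner_self_eq_norm_sq]
  field_simp
  ring

theorem isWeakGradient_exampleSolution :
    IsWeakGradient exteriorDomain exampleSolution (∇ exampleSolution) where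
  locInt := continuous_exampleSolution.locallyIntegrable.locallyIntegrableOn _
  locInt_grad := continuousOn_gradient_exampleSolution.locallyIntegrableOn
    measurableSet_exteriorDomain
  byParts φ hφ := by
    have hφ0 : ∀ x, x ∉ exteriorDomain → x ∉ tsupport φ := fun x hx h => hx (hφ.support_subset h)
    rw [setIntegral_eq_integral_of_forall_compl_eq_zero fun x hx => by
        rw [gradient_eq_zero_of_notMem_tsupport (hφ0 x hx), smul_zero],
      setIntegral_eq_integral_of_forall_compl_eq_zero fun x hx => by
        rw [image_eq_zero_of_notMem_tsupport (hφ0 x hx), zero_smul]]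
    have hi1 : Integrable fun x => exampleSolution x • ∇ φ x :=
      hφ.integrable_of_continuousOn
        (continuous_exampleSolution.smul (continuous_gradient hφ.smooth)).continuousOn
        fun x hx => by rw [gradient_eq_zero_of_notMem_tsupport hx, smul_zero]
    have hi2 : Integrable fun x => φ x • ∇ exampleSolution x :=
      hφ.integrable_of_continuousOn
        (hφ.smooth.continuous.continuousOn.smul continuousOn_gradient_exampleSolution)
        fun x hx => by rw [image_eq_zero_of_notMem_tsupport hx, zero_smul]
    refine ext_inner_left ℝ fun w => ?_
    rw [inner_neg_right, ← integral_inner hi1, ← integral_inner hi2]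
    have h := hφ.integral_mul_fderiv (f := exampleSolution)
      (f' := fun x => ⟪w, ∇ exampleSolution x⟫) (w := w) continuous_exampleSolution.continuousOn
      (continuousOn_const.inner continuousOn_gradient_exampleSolution) fun x hx => by
        have h := (hasFDerivAt_exampleSolution (ne_zero_of_mem_exteriorDomain hx)).hasLineDerivAt w
        rwa [← (hasFDerivAt_exampleSolution (ne_zero_of_mem_exteriorDomain hx)).fderiv,
          ← inner_gradient_left, real_inner_comm] at h
    simp only [inner_smul_right, inner_gradient_right]
    simp only [inner_gradient_right, conj_trivial] at h ⊢
    rw [h]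
    simp only [mul_comm]

/-- The differentiated function is the `i`-th component of `∇u`. Summed over `i`, the derivatives
give `Δu = e^{-r} (r - 2)`, which is also `W·∇u`. -/
theorem hasLineDerivAt_exp_neg_norm_mul_coord {x : Plane} (hx : x ≠ 0) (i : Fin 2) :
    HasLineDerivAt ℝ (fun y : Plane => -Real.exp (-‖y‖) * y i)
      (Real.exp (-‖x‖) * (x i ^ 2 / ‖x‖ - 1)) x (EuclideanSpace.single i 1) := by
  have hn := hasFDerivAt_norm_of_ne_zero hx
  have hp := (EuclideanSpace.proj i : Plane →L[ℝ] ℝ).hasFDerivAt (x := x)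
  have h := (hn.neg.exp.neg.mul hp).hasLineDerivAt (EuclideanSpace.single i 1)
  refine HasDerivAt.congr_deriv h ?_
  simp [EuclideanSpace.inner_single_right]
  ring

theorem isWeakDriftSolution_exampleSolution :
    IsWeakDriftSolution exteriorDomain exampleDrift exampleSolution (∇ exampleSolution) where
  weakGradient := isWeakGradient_exampleSolution
  locInt_drift := (continuousOn_exampleDrift.inner
    continuousOn_gradient_exampleSolution).locallyIntegrableOn measurableSet_exteriorDomain
  equation φ hφ := by
    have hD : ∀ x ∈ exteriorDomain,
        ⟪∇ exampleSolution x, ∇ φ x⟫ + ⟪exampleDrift x, ∇ exampleSolution x⟫ * φ x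
        = (∑ i : Fin 2, -Real.exp (-‖x‖) * x i * fderiv ℝ φ x (EuclideanSpace.single i 1))
          + ∑ i : Fin 2, Real.exp (-‖x‖) * (x i ^ 2 / ‖x‖ - 1) * φ x := by
      intro x hx
      have hx0 := ne_zero_of_mem_exteriorDomain hx
      have h0 : ‖x‖ ≠ 0 := norm_ne_zero_iff.2 hx0
      rw [inner_exampleDrift hx0, gradient_exampleSolution hx0, real_inner_smul_left,
        inner_gradient_right]
      have hsum : x = ∑ i : Fin 2, x i • EuclideanSpace.single i (1 : ℝ) := by
        have := (EuclideanSpace.basisFun (Fin 2) ℝ).sum_repr x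
        simpa using this.symm
      have hn : ‖x‖ ^ 2 = x 0 ^ 2 + x 1 ^ 2 := by
        rw [EuclideanSpace.norm_sq_eq]
        simp
      have hfd : fderiv ℝ φ x x = x 0 * fderiv ℝ φ x (EuclideanSpace.single 0 1)
          + x 1 * fderiv ℝ φ x (EuclideanSpace.single 1 1) := by
        conv_lhs => enter [2]; rw [hsum]
        simp
      have hr : ‖x‖ = x 0 ^ 2 / ‖x‖ + x 1 ^ 2 / ‖x‖ := by
        rw [← add_div, ← hn]
        field_simp
      simp only [Fin.sum_univ_two, conj_trivial, hfd]
      linear_combination Real.exp (-‖x‖) * φ x * hr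
    rw [setIntegral_congr_fun measurableSet_exteriorDomain hD,
      setIntegral_eq_integral_of_forall_compl_eq_zero fun x hx => by
        have hx' : x ∉ tsupport φ := fun h => hx (hφ.support_subset h)
        simp [image_eq_zero_of_notMem_tsupport hx',
          fderiv_apply_eq_zero_of_notMem_tsupport hx']]
    have hc1 : ∀ i : Fin 2, ContinuousOn (fun y : Plane => -Real.exp (-‖y‖) * y i)
        exteriorDomain := fun i => by fun_prop
    have hc2 : ∀ i : Fin 2, ContinuousOn
        (fun y : Plane => Real.exp (-‖y‖) * (y i ^ 2 / ‖y‖ - 1)) exteriorDomain := fun i => by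
      refine ContinuousOn.mul (by fun_prop) ((ContinuousOn.div (by fun_prop) (by fun_prop)
        fun x hx => ?_).sub continuousOn_const)
      simpa using ne_zero_of_mem_exteriorDomain hx
    have hi1 : ∀ i ∈ Finset.univ, Integrable fun x : Plane =>
        -Real.exp (-‖x‖) * x i * fderiv ℝ φ x (EuclideanSpace.single i 1) := fun i _ =>
      hφ.integrable_of_continuousOn ((hc1 i).mul ((hφ.smooth.continuous_fderiv (by simp)).clm_apply
        continuous_const).continuousOn) fun x hx => by
          rw [fderiv_apply_eq_zero_of_notMem_tsupport hx, mul_zero]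
    have hi2 : ∀ i ∈ Finset.univ, Integrable fun x : Plane =>
        Real.exp (-‖x‖) * (x i ^ 2 / ‖x‖ - 1) * φ x := fun i _ =>
      hφ.integrable_of_continuousOn ((hc2 i).mul hφ.smooth.continuous.continuousOn) fun x hx => by
          rw [image_eq_zero_of_notMem_tsupport hx, mul_zero]
    rw [integral_add (integrable_finsetSum _ hi1) (integrable_finsetSum _ hi2),
      integral_finsetSum _ hi1, integral_finsetSum _ hi2, ← Finset.sum_add_distrib]
    refine Finset.sum_eq_zero fun i _ => ?_
    rw [hφ.integral_mul_fderiv (hc1 i) (hc2 i) fun x hx =>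
      hasLineDerivAt_exp_neg_norm_mul_coord (ne_zero_of_mem_exteriorDomain hx) i, neg_add_cancel]

theorem norm_gradient_exampleSolution {x : Plane} (hx : x ≠ 0) :
    ‖∇ exampleSolution x‖ = ‖x‖ * Real.exp (-‖x‖) := by
  rw [gradient_exampleSolution hx, norm_smul, norm_neg, Real.norm_eq_abs, Real.abs_exp, mul_comm]

theorem norm_exampleDrift_le_one {x : Plane} (hx : x ∈ exteriorDomain) : ‖exampleDrift x‖ ≤ 1 := by
  rw [mem_exteriorDomain] at hx
  have h0 : 0 < ‖x‖ := by linarith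
  rw [exampleDrift, norm_smul, norm_div, norm_pow, norm_norm, Real.norm_eq_abs,
    div_mul_eq_mul_div, div_le_one (by positivity), pow_two]
  gcongr
  -- `|2 - r| ≤ r` holds exactly when `r ≥ 1`.
  rw [abs_le]
  constructor <;> linarith

theorem isNormalizedSolution_exampleSolution :
    IsNormalizedSolution ⊤ (4 * Real.exp (-8)) exampleDrift exampleSolution
      (∇ exampleSolution) where
  solution := isWeakDriftSolution_exampleSolution
  drift_memLp := memLp_top_of_bound
    (continuousOn_exampleDrift.aestronglyMeasurable measurableSet_exteriorDomain) 1
    ((ae_restrict_iff' measurableSet_exteriorDomain).2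
      (ae_of_all _ fun _ hx => norm_exampleDrift_le_one hx))
  drift_le := by
    rw [eLpNorm_exponent_top, ← ENNReal.ofReal_one]
    exact eLpNormEssSup_le_of_ae_bound ((ae_restrict_iff' measurableSet_exteriorDomain).2
      (ae_of_all _ fun _ hx => norm_exampleDrift_le_one hx))
  grad_le := by
    rw [eLpNorm_exponent_top, ← ENNReal.ofReal_one]
    refine eLpNormEssSup_le_of_ae_bound ((ae_restrict_iff' measurableSet_exteriorDomain).2
      (ae_of_all _ fun x hx => ?_))
    rw [norm_gradient_exampleSolution (ne_zero_of_mem_exteriorDomain hx), Real.exp_neg,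
      ← div_eq_mul_inv, div_le_one (Real.exp_pos _)]
    linarith [Real.add_one_le_exp ‖x‖]
  -- On `2 < r < 4` one has `|∇u| = r e^{-r} ≥ 2 e^{-4}`, and the disc has area `π ≥ 1`; this
  -- produces `4 e^{-8}`.
  grad_lower := by
    refine le_iInf₂ fun z₀ hz₀ => ?_
    rw [mem_sphere_zero_iff_norm] at hz₀
    calc ENNReal.ofReal (4 * Real.exp (-8))
        ≤ ENNReal.ofReal (4 * Real.exp (-8)) * volume (ball z₀ 1) := by
          refine le_mul_of_one_le_right zero_le ?_
          rw [EuclideanSpace.volume_ball_fin_two, ENNReal.ofReal_one, one_pow, one_mul,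
            ← NNReal.coe_real_pi, ENNReal.ofReal_coe_nnreal]
          exact_mod_cast (by linarith [Real.pi_gt_three] : (1 : ℝ) ≤ Real.pi)
      _ = ∫⁻ _ in ball z₀ 1, ENNReal.ofReal (4 * Real.exp (-8)) := (setLIntegral_const _ _).symm
      _ ≤ _ := by
          refine setLIntegral_mono' measurableSet_ball fun z hz => ?_
          rw [mem_ball, dist_eq_norm] at hz
          have h1 := norm_sub_norm_le z z₀
          have h2 := norm_sub_norm_le z₀ z
          rw [norm_sub_rev] at h2
          have hz0 : z ≠ 0 := norm_pos_iff.1 (by linarith)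
          rw [← ofReal_norm, ← ENNReal.ofReal_pow (norm_nonneg _),
            norm_gradient_exampleSolution hz0]
          apply ENNReal.ofReal_le_ofReal
          rw [show (-8 : ℝ) = -4 + -4 by norm_num, Real.exp_add]
          have h3 : 2 * Real.exp (-4) ≤ ‖z‖ * Real.exp (-‖z‖) := by
            gcongr <;> linarith
          calc _ = (2 * Real.exp (-4)) ^ 2 := by ring
            _ ≤ _ := by gcongr

theorem abs_exampleSolution_le {z₀ z : Plane} (h : 2 ≤ ‖z₀‖) (hz : z ∈ ball z₀ 1) :
    |exampleSolution z| ≤ ‖z₀‖ * Real.exp (1 - ‖z₀‖) := by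
  rw [mem_ball, dist_eq_norm] at hz
  have h2 := norm_sub_norm_le z₀ z
  rw [norm_sub_rev] at h2
  have hn := norm_nonneg z
  rw [exampleSolution, abs_of_nonneg (by positivity)]
  -- In terms of `s`, `1 + |z| = |z₀| + s ≤ |z₀| (1 + s) ≤ |z₀| e^s`.
  obtain ⟨s, hs⟩ : ∃ s, s = 1 - ‖z₀‖ + ‖z‖ := ⟨_, rfl⟩
  have hs0 : 0 ≤ s := by linarith
  have h3 : Real.exp (1 - ‖z₀‖) = Real.exp (-‖z‖) * Real.exp s := by
    rw [← Real.exp_add, hs]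
    ring_nf
  rw [h3, mul_left_comm]
  gcongr
  have h4 : s + 1 ≤ Real.exp s := Real.add_one_le_exp s
  calc 1 + ‖z‖ ≤ ‖z₀‖ * (s + 1) := by nlinarith
    _ ≤ _ := by gcongr

theorem infSup_exampleSolution_le {R : ℝ} (hR : 2 ≤ R) :
    infSup exampleSolution R ≤ ENNReal.ofReal (R * Real.exp (1 - R)) := by
  have hn : ‖(EuclideanSpace.single 0 R : Plane)‖ = R := by
    rw [PiLp.norm_single, Real.norm_of_nonneg (by linarith)]
  have hs : (EuclideanSpace.single 0 R : Plane) ∈ sphere (0 : Plane) R := by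
    rw [mem_sphere_zero_iff_norm, hn]
  refine (iInf₂_le _ hs).trans ?_
  rw [eLpNorm_exponent_top]
  refine eLpNormEssSup_le_of_ae_bound ((ae_restrict_iff' measurableSet_ball).2
    (ae_of_all _ fun z hz => ?_))
  have h := abs_exampleSolution_le (hn.symm ▸ hR) hz
  rwa [hn] at h

/-- Eventually `C₁ g(R) ≤ R/2`, so the bound would force `C₂ e^{-R/2} ≤ R e^{1-R}` for large `R`,
which fails since `R e^{-R/2} → 0`. -/
theorem not_eventually_le_infSup_exampleSolution {g : ℝ → ℝ}
    (hg : Tendsto (fun R => g R / R) atTop (𝓝 0)) {C₁ C₂ : ℝ} (hC₁ : 0 < C₁) (hC₂ : 0 < C₂) :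
    ¬ ∀ᶠ R in atTop,
      ENNReal.ofReal (C₂ * Real.exp (-(C₁ * g R))) ≤ infSup exampleSolution R := by
  intro h
  have h1 : ∀ᶠ R in atTop, g R / R < 1 / (2 * C₁) := hg.eventually_lt_const (by positivity)
  have h2 : Tendsto (fun R : ℝ => 2 * Real.exp 1 * (R / 2 * Real.exp (-(R / 2)))) atTop (𝓝 0) := by
    have := (Real.tendsto_pow_mul_exp_neg_atTop_nhds_zero 1).comp
      (tendsto_id.atTop_div_const (show (0 : ℝ) < 2 by norm_num))
    simpa using this.const_mul (2 * Real.exp 1)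
  obtain ⟨R, hR, hgR, hlt, hR2⟩ :=
    (h.and (h1.and ((h2.eventually_lt_const hC₂).and (eventually_ge_atTop 2)))).exists
  have hle := (ENNReal.ofReal_le_ofReal_iff (by positivity)).1
    (hR.trans (infSup_exampleSolution_le hR2))
  have hR0 : 0 < R := by linarith
  have hCg : C₁ * g R ≤ R / 2 := by
    rw [div_lt_iff₀ hR0] at hgR
    calc C₁ * g R ≤ C₁ * (1 / (2 * C₁) * R) := by gcongr
      _ = R / 2 := by field_simp
  have h3 : C₂ * Real.exp (-(R / 2)) ≤ R * Real.exp (1 - R) := le_trans (by gcongr) hle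
  have h4 : R * Real.exp (1 - R)
      = 2 * Real.exp 1 * (R / 2 * Real.exp (-(R / 2))) * Real.exp (-(R / 2)) := by
    rw [show 1 - R = 1 + -(R / 2) + -(R / 2) by ring, Real.exp_add, Real.exp_add]
    ring
  rw [h4] at h3
  exact absurd (le_of_mul_le_mul_right h3 (Real.exp_pos _)) (not_le.2 hlt)

theorem theorem1p2 :
    -- the lower bound, with constants depending only on `p` and `C₀`
    (∀ (p : ℝ≥0∞), 2 < p → ∀ (C₀ : ℝ), 0 < C₀ →
      ∃ C₁ C₂ R₀ : ℝ, 0 < C₁ ∧ 0 < C₂ ∧ 1 < R₀ ∧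
        ∀ (W : Plane → Plane) (u : Plane → ℝ) (G : Plane → Plane),
          IsNormalizedSolution p C₀ W u G →
          ∀ R : ℝ, R₀ ≤ R →
            ENNReal.ofReal (C₂ * Real.exp (-(C₁ * R * Real.log R ^ 2))) ≤ infSup u R) ∧
    -- the example for `p = ∞`
    ((∃ C₀ : ℝ, 0 < C₀ ∧
        IsNormalizedSolution ⊤ C₀ exampleDrift exampleSolution (∇ exampleSolution)) ∧
      (∀ z₀ : Plane, 2 ≤ ‖z₀‖ → ∀ z ∈ ball z₀ 1,
        |exampleSolution z| ≤ ‖z₀‖ * Real.exp (1 - ‖z₀‖)) ∧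
      -- so no lower bound whose exponent is `o(R)` can hold
      (∀ g : ℝ → ℝ, Tendsto (fun R => g R / R) atTop (𝓝 0) →
        ∀ C₁ C₂ : ℝ, 0 < C₁ → 0 < C₂ →
          ¬ ∀ᶠ R in atTop,
            ENNReal.ofReal (C₂ * Real.exp (-(C₁ * g R))) ≤ infSup exampleSolution R)) :=
  ⟨fun _ hp _ hC₀ => landis_lower_bound hp hC₀,
    ⟨_, by positivity, isNormalizedSolution_exampleSolution⟩,
    fun _ h _ hz => abs_exampleSolution_le h hz,
    fun _ hg _ _ hC₁ hC₂ => not_eventually_le_infSup_exampleSolution hg hC₁ hC₂⟩
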